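/- Let $(\mathbb S,\circ)$ be a semigroup. A prefix circuit of width $N\ge 1$ is a circuit with inputs $x_1,\dots,x_N$ built from binary elements $x\circ y$ and identity elements $x$, whose $N$ outputs are, over every semigroup, the prefix sums $s_i=x_1\circ x_2\circ\cdots\circ x_i$ ($1\le i\le N$). Its complexity $C$ is the number of its binary elements, and its depth $D$ is the maximal number of elements (of both kinds) on a path from an input to an output. The circuit is called optimal (zero-deficiency) if $C+D=2N-2$. The fan-out of an element is the number of wires leaving it, a wire to an output of the circuit being counted too. Let $D(N,k)$ be the minimal depth of an optimal prefix circuit on $N$ inputs all of whose elements have fan-out at most $k$. **Theorem.** Let $k\ge 2$ be an integer. The polynomial $P_k(x)=2+x+x^2+\dots+x^{k-2}-x^k$ (with $P_2(x)=2-x^2$) has a unique positive root $\alpha_k$, and $$D(N,k)=\log_{\alpha_k}N\pm O(1),$$ that is, there is a constant $C_k$, depending only on $k$, such that for every $N\ge 1$ the number $D(N,k)$ is defined (an optimal prefix circuit on $N$ inputs with fan-out at most $k$ exists) and $|D(N,k)-\log_{\alpha_k}N|\le C_k$. -/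

import Mathlib

/-- A functional element over the basis `{x ∘ y, x}`, with arguments taken from `V`:
an identity element with one argument, or a binary element with an ordered pair of arguments. -/
inductive CircuitElement (V : Type) : Type
  | ident (a : V) : CircuitElement V
  | binary (a b : V) : CircuitElement V

namespace CircuitElement

/-- The list of arguments, one entry for each incoming wire. -/
def args {V : Type} : CircuitElement V → List V
  | ident a => [a]
  | binary a b => [a, b]

/-- Whether the element is binary. -/
def isBinary {V : Type} : CircuitElement V → Bool
  | ident _ => false
  | binary _ _ => true

end CircuitElement

/-- A circuit with `N` inputs and `N` outputs.  Its elements are numbered so that every element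
takes its arguments among the inputs (`Sum.inl`) and the elements with smaller numbers
(`Sum.inr`).  Each output is read off from an input or an element. -/
structure PrefixCircuit (N : ℕ) where
  size : ℕ
  elt : (j : Fin size) → CircuitElement (Fin N ⊕ Fin j.val)
  out : Fin N → Fin N ⊕ Fin size

namespace PrefixCircuit

variable {N : ℕ}

/-- The vertices of the circuit: inputs and elements. -/
abbrev Vertex (c : PrefixCircuit N) : Type := Fin N ⊕ Fin c.size

/-- The arguments of element `j`, as vertices of the circuit. -/
def argVertices (c : PrefixCircuit N) (j : Fin c.size) : List c.Vertex :=
  (c.elt j).args.map (Sum.map id (Fin.castLE j.isLt.le))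

/-- The value computed by element `j` when the inputs are `x`, in the semigroup `S`. -/
def eltValue (c : PrefixCircuit N) {S : Type} [Semigroup S] (x : Fin N → S)
    (j : Fin c.size) : S :=
  match c.elt j with
  | .ident a => a.elim x (fun i => c.eltValue x ⟨i.val, i.isLt.trans j.isLt⟩)
  | .binary a b =>
      a.elim x (fun i => c.eltValue x ⟨i.val, i.isLt.trans j.isLt⟩) *
        b.elim x (fun i => c.eltValue x ⟨i.val, i.isLt.trans j.isLt⟩)
termination_by j.val
decreasing_by all_goals exact i.isLt

/-- The value computed at a vertex. -/
def value (c : PrefixCircuit N) {S : Type} [Semigroup S] (x : Fin N → S) : c.Vertex → S :=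
  Sum.elim x (c.eltValue x)

/-- The depth of element `j`: the maximal number of elements (of both kinds) on a path from an
input to `j`, with `j` itself counted. -/
def eltDepth (c : PrefixCircuit N) (j : Fin c.size) : ℕ :=
  match c.elt j with
  | .ident a => a.elim (fun _ => 0) (fun i => c.eltDepth ⟨i.val, i.isLt.trans j.isLt⟩) + 1
  | .binary a b =>
      max (a.elim (fun _ => 0) (fun i => c.eltDepth ⟨i.val, i.isLt.trans j.isLt⟩))
        (b.elim (fun _ => 0) (fun i => c.eltDepth ⟨i.val, i.isLt.trans j.isLt⟩)) + 1
termination_by j.val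
decreasing_by all_goals exact i.isLt

/-- The depth of a vertex; inputs have depth `0`. -/
def vertexDepth (c : PrefixCircuit N) : c.Vertex → ℕ :=
  Sum.elim (fun _ => 0) c.eltDepth

/-- The depth of the circuit: the maximal number of elements (of both kinds) on a path from an
input to an output. -/
def depth (c : PrefixCircuit N) : ℕ :=
  Finset.univ.sup (fun i : Fin N => c.vertexDepth (c.out i))

/-- The complexity of the circuit: the number of its binary elements. -/
def complexity (c : PrefixCircuit N) : ℕ :=
  (Finset.univ.filter (fun j : Fin c.size => (c.elt j).isBinary = true)).card

/-- The fan-out of a vertex: the number of wires leaving it, which lead to arguments of elements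
and to outputs of the circuit. -/
def fanOut (c : PrefixCircuit N) (v : c.Vertex) : ℕ :=
  (∑ j : Fin c.size, (c.argVertices j).count v) +
    (Finset.univ.filter (fun i : Fin N => c.out i = v)).card

/-- The prefix sum `x₀ ∘ x₁ ∘ ⋯ ∘ xᵢ` in a semigroup (indices start from `0`). -/
def prefixSum {S : Type} [Semigroup S] (x : Fin N → S) : (i : ℕ) → i < N → S
  | 0, h => x ⟨0, h⟩
  | i + 1, h => prefixSum x i (Nat.lt_of_succ_lt h) * x ⟨i + 1, h⟩

/-- The circuit is a (universal) prefix circuit: over every semigroup, its outputs are the prefix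
sums of its inputs. -/
def ComputesPrefixSums (c : PrefixCircuit N) : Prop :=
  ∀ (S : Type) [Semigroup S] (x : Fin N → S) (i : Fin N),
    c.value x (c.out i) = prefixSum x i.val i.isLt

/-- Optimal (zero-deficiency) prefix circuits: `C + D = 2 N - 2`. -/
def IsOptimal (c : PrefixCircuit N) : Prop :=
  c.ComputesPrefixSums ∧ c.complexity + c.depth + 2 = 2 * N

/-- Every element has fan-out at most `k`. -/
def FanOutAtMost (c : PrefixCircuit N) (k : ℕ) : Prop :=
  ∀ j : Fin c.size, c.fanOut (Sum.inr j) ≤ k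

end PrefixCircuit

/-- The depths of the optimal prefix circuits on `N` inputs whose elements have fan-out at
most `k`. -/
def optimalDepths (N k : ℕ) : Set ℕ :=
  {d | ∃ c : PrefixCircuit N, c.IsOptimal ∧ c.FanOutAtMost k ∧ c.depth = d}

/-- `D(N, k)`: the minimal depth of an optimal prefix circuit on `N` inputs whose elements have
fan-out at most `k`. -/
noncomputable def minOptimalDepth (N k : ℕ) : ℕ :=
  sInf (optimalDepths N k)

/-- The polynomial `2 + x + x² + ⋯ + x^(k-2) - x^k` (for `k ≥ 2`; the sum `x + ⋯ + x^(k-2)` is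
empty for `k = 2`). -/
noncomputable def widthPolynomial (k : ℕ) : Polynomial ℝ :=
  2 + ∑ i ∈ Finset.Icc 1 (k - 2), Polynomial.X ^ i - Polynomial.X ^ k

/-! Write κ = k - 1. Unfold the last output into a formula. It contains N - 1 binary elements, one
for each position at which the sum is split. Another N - 1 binary elements are those of which the
outputs are copies. An element of both kinds computes a prefix sum inside the formula; these
elements form the spine, are nested, and have distinct depths, so there are at most D of them. Hence
C + D ≥ 2N - 2 (`le_complexity_add_depth`). Equality forces a rigid shape (`IsOptimal.structure`):
every binary element lies in the formula or computes a prefix sum, no prefix sum is computed by two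
binary elements, and the spine has exactly one element at each depth 1, …, D.

Upper bound for N. The prefix sums computed off the spine (the heads) form a forest in which a head
receives a shorter prefix sum, possibly through identity elements. Label a position by one less than
the depth of the element that splits the formula there. A head can extend a prefix only across
positions with labels smaller than its own, so the labels that matter to a carrier are records.
Fan-out κ + 1 limits how fast they can be served: a carrier that leads to an output spends one wire
on that and has κ others. `served_unfoldMin_le` shows that no schedule beats the greedy one, which
serves the largest label first; `CarrierForest.bounds` turns this into fewer than `capacity κ (t +
1) (D - t)` heads below the spine element of depth t, and summation over t gives `width_le`.

Lower bound for N. `exists_branch` realizes a matching scheme recursively: a block is split in two,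
the sum of its left half serves both the total and the prefix sum at the split, and that prefix sum
carries the right half, while the old carrier, or a copy of it once its wires run short, carries the
left half. `exists_trunk` strings such blocks along a spine, and `exists_optimal` reaches every
width from D + 1 to `maxWidth κ D`.

Both bounds are sums over antidiagonals. They satisfy, as an upper estimate with a linear error and
as a lower estimate, the recursion s(n+1) = s(n-1) + ⋯ + s(n-κ) + s(n-κ), whose characteristic
equation is P_k(x) = 0. So both grow like α_k^D up to constant factors, and taking logarithms proves
the theorem. -/

open Finset

/-! ### Leaf weights, capacities and the greedy schedule -/

/-- Weights whose partial sums `capacity` count the leaves of an extremal tree. -/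
def leafWeight (κ : ℕ) : ℕ → ℕ → ℕ
  | 0, h => if h = 0 then 1 else 0
  | v + 1, h => (∑ i ∈ Icc 1 κ, if i ≤ h then leafWeight κ v (h - i) else 0) +
      if κ + 1 ≤ h then leafWeight κ v (h - κ) else 0

/-- The maximal number of leaves of a tree of height `h` whose prefixes are to be computed
within time `t`, by elements of fan-out `κ + 1`. -/
def capacity (κ h t : ℕ) : ℕ :=
  ∑ u ∈ range (h + 1), ∑ v ∈ range (t + 1), leafWeight κ v u

/-- The number of elements of `g` that are at least `u`. -/
def countGE (g : Finset ℕ) (u : ℕ) : ℕ := #{i ∈ g | u ≤ i}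

/-- An upper bound for the number of prefixes that can be served when trees of heights in `g`
are waiting, `r` wires are available at time `s` and a duplicating wire is kept. -/
def served (κ L r : ℕ) (g : Finset ℕ) (s : ℕ) : ℕ :=
  ∑ u ∈ range L, ∑ v ∈ range (s + 1), leafWeight κ v u * min (r + κ * (s - v)) (countGE g u)

/-- Replace the least element of `g` by all the smaller numbers. -/
def unfoldMin (g : Finset ℕ) (h : g.Nonempty) : Finset ℕ :=
  g.erase (g.min' h) ∪ range (g.min' h)

lemma countGE_mono {g g' : Finset ℕ} (h : g ⊆ g') (u : ℕ) : countGE g u ≤ countGE g' u :=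
  card_le_card (filter_subset_filter _ h)

@[simp] lemma countGE_empty (u : ℕ) : countGE ∅ u = 0 := by simp [countGE]

lemma countGE_union {A B : Finset ℕ} (h : Disjoint A B) (u : ℕ) :
    countGE (A ∪ B) u = countGE A u + countGE B u := by
  unfold countGE
  rw [filter_union, card_union_of_disjoint (disjoint_filter_filter h)]

lemma countGE_erase {g : Finset ℕ} {a : ℕ} (ha : a ∈ g) (u : ℕ) :
    countGE (g.erase a) u + (if u ≤ a then 1 else 0) = countGE g u := by
  unfold countGE
  rw [filter_erase]
  split_ifs with h
  · rw [card_erase_add_one]; simp [ha, h]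
  · rw [erase_eq_of_notMem (by simp [h])]; rfl

@[simp] lemma countGE_range (h u : ℕ) : countGE (range h) u = h - u := by
  unfold countGE
  have : {i ∈ range h | u ≤ i} = Ico u h := by ext; simp; omega
  rw [this]; simp

lemma countGE_eq_zero {g : Finset ℕ} {u : ℕ} (h : ∀ i ∈ g, i < u) : countGE g u = 0 := by
  unfold countGE
  rw [card_eq_zero, filter_eq_empty_iff]
  intro i hi; have := h i hi; omega

lemma countGE_le_sub {g : Finset ℕ} {M : ℕ} (h : ∀ i ∈ g, i < M) (u : ℕ) :
    countGE g u ≤ M - u := by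
  rw [← countGE_range]
  exact countGE_mono (fun i hi => mem_range.2 (h i hi)) u

lemma countGE_unfoldMin {g : Finset ℕ} (hg : g.Nonempty) (u : ℕ) :
    countGE (unfoldMin g hg) u + (if u ≤ g.min' hg then 1 else 0)
      = countGE g u + (g.min' hg - u) := by
  unfold unfoldMin
  rw [countGE_union, countGE_range]
  · have := countGE_erase (min'_mem g hg) u
    omega
  · rw [disjoint_left]
    intro a ha hb
    have := min'_le g a (mem_of_mem_erase ha)
    have := mem_range.1 hb; omega

section served
variable {κ L : ℕ}

lemma served_mono {r r' s : ℕ} {g g' : Finset ℕ} (hr : r ≤ r') (hg : g ⊆ g') :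
    served κ L r g s ≤ served κ L r' g' s := by
  unfold served
  gcongr
  exact countGE_mono hg _

/-- Passing one unit of time frees κ wires, because one of the κ + 1 is kept for duplication. -/
lemma served_succ (g : Finset ℕ) (s : ℕ) : served κ L 0 g (s + 1) = served κ L κ g s := by
  unfold served
  refine sum_congr rfl fun u _ => ?_
  rw [sum_range_succ]
  simp only [le_refl, tsub_eq_zero_of_le, mul_zero, zero_add, Nat.zero_min, add_zero]
  refine sum_congr rfl fun v hv => ?_
  have : s + 1 - v = (s - v) + 1 := by simp at hv; omega
  rw [this, mul_add, mul_one, add_comm κ]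

lemma served_mono_time {s s' : ℕ} (h : s ≤ s') (g : Finset ℕ) :
    served κ L 0 g s ≤ served κ L 0 g s' := by
  refine monotone_nat_of_le_succ (fun n => ?_) h
  rw [served_succ]
  exact served_mono (Nat.zero_le _) subset_rfl

@[simp] lemma served_empty (r s : ℕ) : served κ L r ∅ s = 0 := by simp [served]

lemma sum_range_shift (f : ℕ → ℕ) (i h : ℕ) :
    (∑ u ∈ range (h + 1), if i ≤ u then f (u - i) else 0) =
      if i ≤ h then ∑ u ∈ range (h - i + 1), f u else 0 := by
  induction h with
  | zero => rcases i with _ | i <;> simp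
  | succ h ih =>
    rw [sum_range_succ, ih]
    by_cases h1 : i ≤ h
    · rw [if_pos h1, if_pos (by omega), if_pos (by omega)]
      rw [show h + 1 - i = h - i + 1 by omega, sum_range_succ]
      rw [sum_range_succ f (h - i + 1), sum_range_succ]
    · by_cases h2 : i = h + 1
      · subst h2; simp
      · rw [if_neg h1, if_neg (by omega), if_neg (by omega)]

lemma leafWeight_zero_right (v : ℕ) : leafWeight κ v 0 = if v = 0 then 1 else 0 := by
  cases v with
  | zero => simp [leafWeight]
  | succ v =>
    simp only [leafWeight]
    rw [sum_eq_zero]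
    · simp
    · intro i hi; simp at hi; rw [if_neg (by omega)]

lemma sum_leafWeight_zero_right (t : ℕ) : ∑ v ∈ range (t + 1), leafWeight κ v 0 = 1 := by
  rw [sum_range_succ']
  simp [leafWeight_zero_right]

/-- Sums the recursion of `leafWeight` over both indices. Its last term requires κ + 1 ≤ h, so it
omits height 0, whose total weight is 1; this is the correction on the left. -/
lemma capacity_succ (h t : ℕ) :
    capacity κ h (t + 1) + (if κ + 1 ≤ h then 1 else 0) =
      1 + (∑ i ∈ Icc 1 κ, if i ≤ h then capacity κ (h - i) t else 0) +
        if κ + 1 ≤ h then capacity κ (h - κ) t else 0 := by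
  have e1 : capacity κ h (t + 1) =
      1 + (∑ i ∈ Icc 1 κ, if i ≤ h then capacity κ (h - i) t else 0) +
        ∑ u ∈ range (h + 1), if κ + 1 ≤ u then
          ∑ v ∈ range (t + 1), leafWeight κ v (u - κ) else 0 := by
    unfold capacity
    have : ∀ u, ∑ v ∈ range (t + 1 + 1), leafWeight κ v u =
        (if u = 0 then 1 else 0) +
        ((∑ i ∈ Icc 1 κ, if i ≤ u then ∑ v ∈ range (t + 1), leafWeight κ v (u - i) else 0) +
        if κ + 1 ≤ u then ∑ v ∈ range (t + 1), leafWeight κ v (u - κ) else 0) := by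
      intro u
      rw [sum_range_succ', add_comm]
      congr 1
      simp only [leafWeight]
      rw [sum_add_distrib, sum_comm]
      congr 1
      · refine sum_congr rfl fun i _ => ?_
        split_ifs <;> simp
      · split_ifs <;> simp
    simp only [this]
    rw [sum_add_distrib, sum_add_distrib, sum_comm, ← add_assoc]
    congr 2
    · simp
    · refine sum_congr rfl fun i _ => ?_
      exact sum_range_shift (fun u => ∑ v ∈ range (t + 1), leafWeight κ v u) i h
  have e2 : (∑ u ∈ range (h + 1), if κ + 1 ≤ u then
          ∑ v ∈ range (t + 1), leafWeight κ v (u - κ) else 0) + (if κ + 1 ≤ h then 1 else 0) =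
      if κ + 1 ≤ h then capacity κ (h - κ) t else 0 := by
    have := sum_range_shift (fun u => ∑ v ∈ range (t + 1), leafWeight κ v (u + 1)) (κ + 1) h
    have e3 : (∑ u ∈ range (h + 1), if κ + 1 ≤ u then
          ∑ v ∈ range (t + 1), leafWeight κ v (u - κ) else 0) =
        ∑ u ∈ range (h + 1), if κ + 1 ≤ u then
          ∑ v ∈ range (t + 1), leafWeight κ v (u - (κ + 1) + 1) else 0 := by
      refine sum_congr rfl fun u _ => ?_
      split_ifs with hu
      · rw [show u - (κ + 1) + 1 = u - κ by omega]
      · rfl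
    rw [e3, this]
    split_ifs with hh
    · unfold capacity
      rw [sum_range_succ' _ (h - κ), sum_leafWeight_zero_right,
        show h - (κ + 1) + 1 = h - κ by omega]
    · rfl
  omega

lemma capacity_zero (h : ℕ) : capacity κ h 0 = 1 := by
  unfold capacity
  simp [leafWeight]

/-- A tree of height h is one leaf together with trees of all smaller heights waiting to be served.
In one unit of time the κ tallest, of heights h - 1, …, h - κ, are served and `range (h - κ)`
remains, which is the recursion `capacity_succ`. -/
lemma capacity_eq (t : ℕ) :
    ∀ h, h ≤ L → capacity κ h t = 1 + served κ L 0 (range h) t := by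
  induction t with
  | zero => intro h _; simp [capacity_zero, served]
  | succ t ih =>
    intro h hh
    have key : served κ L 0 (range h) (t + 1) =
        (∑ i ∈ Icc 1 κ, if i ≤ h then capacity κ (h - i) t else 0) +
          served κ L 0 (range (h - κ)) t := by
      rw [served_succ]
      have : ∀ i ∈ Icc 1 κ, (if i ≤ h then capacity κ (h - i) t else 0) =
          ∑ u ∈ range L, ∑ v ∈ range (t + 1), leafWeight κ v u * if u + i ≤ h then 1 else 0 := by
        intro i hi
        simp at hi
        split_ifs with hih
        · unfold capacity
          have hsub : range (h - i + 1) ⊆ range L := by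
            intro x; simp; omega
          rw [← sum_subset hsub]
          · refine sum_congr rfl fun u hu => sum_congr rfl fun v _ => ?_
            simp at hu
            rw [if_pos (by omega), mul_one]
          · intro x _ hx
            simp at hx
            apply sum_eq_zero; intro v _
            rw [if_neg (by omega), mul_zero]
        · symm
          apply sum_eq_zero; intro u _
          apply sum_eq_zero; intro v _
          rw [if_neg (by omega), mul_zero]
      rw [sum_congr rfl this, sum_comm]
      unfold served
      rw [← sum_add_distrib]
      refine sum_congr rfl fun u _ => ?_
      rw [sum_comm, ← sum_add_distrib]
      refine sum_congr rfl fun v _ => ?_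
      rw [← mul_sum, ← mul_add]
      congr 1
      -- The trees just served account for min κ (h - u) of those of height at least u; the
      -- remaining ones complete this to the minimum for κ more wires.
      have : ∑ i ∈ Icc 1 κ, (if u + i ≤ h then 1 else 0) = min κ (h - u) := by
        rw [← card_filter]
        have : {i ∈ Icc 1 κ | u + i ≤ h} = Icc 1 (min κ (h - u)) := by
          ext; simp; omega
        rw [this]; simp
      rw [this]
      simp only [countGE_range]
      omega
    have := capacity_succ (κ := κ) h t
    rw [key]
    by_cases h1 : κ + 1 ≤ h
    · rw [ih (h - κ) (by omega)] at this
      simp only [h1, if_true] at this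
      omega
    · rw [show h - κ = 0 by omega]
      simp only [h1, if_false] at this
      simp; omega

end served

/-! ### No schedule beats the greedy one -/

section served
variable {κ L : ℕ}

/-- The weights at height `M - j` of the times before `s` at which at least `j` slots are open. -/
def diagonalWeight (κ M s j : ℕ) : ℕ :=
  ∑ v ∈ range s, if j ≤ κ * (s - v) then leafWeight κ v (M - j) else 0

/-- The recursion of `leafWeight` lowers the height by i ≤ κ and the time by one. That step back in
time opens κ more slots, so the threshold j may rise to j + i. Time 0 contributes nothing because M
- j > 0. -/
lemma diagonalWeight_le_step {M s j : ℕ} (hj : j < M) :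
    diagonalWeight κ M s j ≤
      (∑ i ∈ Icc 1 κ, if j + i ≤ M then diagonalWeight κ M s (j + i) else 0) +
        if j + κ < M then diagonalWeight κ M s (j + κ) else 0 := by
  have h0 : leafWeight κ 0 (M - j) = 0 := by simp [leafWeight]; omega
  rcases s with _ | s
  · simp [diagonalWeight]
  have hterm : ∀ i ≤ κ, ∑ v ∈ range s, (if j ≤ κ * (s + 1 - (v + 1)) then
      leafWeight κ v (M - j - i) else 0) ≤ diagonalWeight κ M (s + 1) (j + i) := by
    intro i hi
    unfold diagonalWeight
    rw [sum_range_succ]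
    refine le_add_right (sum_le_sum fun v hv => ?_)
    rw [show M - (j + i) = M - j - i by omega]
    have hv' : s + 1 - v = (s + 1 - (v + 1)) + 1 := by simp at hv; omega
    by_cases hc : j ≤ κ * (s + 1 - (v + 1))
    · rw [if_pos hc, if_pos]
      rw [hv', mul_add, mul_one]; omega
    · rw [if_neg hc]; exact Nat.zero_le _
  have e : diagonalWeight κ M (s + 1) j =
      (∑ i ∈ Icc 1 κ, if j + i ≤ M then (∑ v ∈ range s, if j ≤ κ * (s + 1 - (v + 1)) then
      leafWeight κ v (M - j - i) else 0) else 0) + if j + κ < M then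
      (∑ v ∈ range s, if j ≤ κ * (s + 1 - (v + 1)) then
      leafWeight κ v (M - j - κ) else 0) else 0 := by
    rw [diagonalWeight, sum_range_succ', h0, ite_self, add_zero]
    have h1 : ∀ i, (if j + i ≤ M then (∑ v ∈ range s, if j ≤ κ * (s + 1 - (v + 1)) then
      leafWeight κ v (M - j - i) else 0) else 0) = ∑ v ∈ range s, if j ≤ κ * (s + 1 - (v + 1)) then
        (if i ≤ M - j then leafWeight κ v (M - j - i) else 0) else 0 := by
      intro i
      by_cases hi : j + i ≤ M
      · rw [if_pos hi]
        simp only [show i ≤ M - j by omega, if_true]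
      · rw [if_neg hi]
        simp only [show ¬ i ≤ M - j by omega, if_false, ite_self, sum_const_zero]
    simp only [h1]
    have h2 : (if j + κ < M then (∑ v ∈ range s, if j ≤ κ * (s + 1 - (v + 1)) then
      leafWeight κ v (M - j - κ) else 0) else 0) =
        ∑ v ∈ range s, if j ≤ κ * (s + 1 - (v + 1)) then
        (if κ + 1 ≤ M - j then leafWeight κ v (M - j - κ) else 0) else 0 := by
      by_cases hi : j + κ < M
      · rw [if_pos hi]
        simp only [show κ + 1 ≤ M - j by omega, if_true]
      · rw [if_neg hi]
        simp only [show ¬ κ + 1 ≤ M - j by omega, if_false, ite_self, sum_const_zero]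
    rw [h2, sum_comm, ← sum_add_distrib]
    refine sum_congr rfl fun v _ => ?_
    split_ifs with hc hd
    · simp [leafWeight, hd]
    · simp [leafWeight, hd]
    · simp
  rw [e]
  refine add_le_add (sum_le_sum fun i hi => ?_) ?_
  · simp at hi
    split_ifs
    · exact hterm i hi.2
    · exact le_rfl
  · split_ifs
    · exact hterm κ le_rfl
    · exact le_rfl

/-- One step covers the diagonals j + 1, …, j + κ once and leaves a second copy of j + κ, which by
induction is bounded by the diagonals beyond it. -/
lemma diagonalWeight_le_sum (hκ : 0 < κ) {M s : ℕ} : ∀ d j, M - j = d → j < M →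
    diagonalWeight κ M s j ≤ ∑ m ∈ Ioc j M, diagonalWeight κ M s m := by
  intro d
  induction d using Nat.strong_induction_on with
  | _ d ih =>
  intro j hd hj
  refine (diagonalWeight_le_step hj).trans ?_
  have e : (∑ i ∈ Icc 1 κ, if j + i ≤ M then diagonalWeight κ M s (j + i) else 0) =
      ∑ m ∈ Ioc j (min (j + κ) M), diagonalWeight κ M s m := by
    rw [← sum_filter]
    refine sum_nbij (fun i => j + i) ?_ ?_ ?_ ?_
    · intro i; simp; omega
    · intro a _ b _; simp
    · intro m hm
      simp at hm ⊢
      exact ⟨m - j, by omega, by omega⟩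
    · simp
  rw [e]
  by_cases h1 : j + κ < M
  · rw [if_pos h1, min_eq_left h1.le]
    have h2 := ih (M - (j + κ)) (by omega) (j + κ) rfl (by omega)
    have h3 : Ioc j M = Ioc j (j + κ) ∪ Ioc (j + κ) M := by ext; simp; omega
    rw [h3, sum_union (by rw [disjoint_left]; intro a; simp; omega)]
    exact add_le_add_right h2 _
  · rw [if_neg h1, add_zero, min_eq_right (by omega)]

/-- The surplus on the diagonals dominates the weight of the top height. -/
lemma diagonalWeight_zero_le (hκ : 0 < κ) {M s y : ℕ} (hy : 1 ≤ y) (hyM : y ≤ M) :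
    diagonalWeight κ M s 0 ≤
      ∑ m ∈ Ioc 0 M, (if m < y then m - 1 else y) * diagonalWeight κ M s m := by
  induction y, hy using Nat.le_induction with
  | base =>
    refine (diagonalWeight_le_sum hκ _ 0 rfl (by omega)).trans (sum_le_sum fun m hm => ?_)
    simp at hm
    rw [if_neg (by omega), one_mul]
  | succ y hy ih =>
    refine (ih (by omega)).trans ?_
    -- One unit of the coefficient y on diagonal y is traded for one more unit on every diagonal
    -- beyond y; the coefficients for y become those for y + 1.
    have h := diagonalWeight_le_sum hκ (s := s) _ y rfl (show y < M by omega)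
    have h3 : Ioc 0 M = Ioo 0 y ∪ ({y} ∪ Ioc y M) := by ext; simp; omega
    have d1 : Disjoint (Ioo 0 y) ({y} ∪ Ioc y M) := by
      rw [disjoint_left]; intro a; simp; omega
    have d2 : Disjoint ({y} : Finset ℕ) (Ioc y M) := by
      rw [disjoint_left]; intro a; simp; omega
    rw [h3, sum_union d1, sum_union d2, sum_union d1, sum_union d2, sum_singleton, sum_singleton]
    have a1 : ∑ m ∈ Ioo 0 y, (if m < y then m - 1 else y) * diagonalWeight κ M s m =
        ∑ m ∈ Ioo 0 y, (if m < y + 1 then m - 1 else y + 1) * diagonalWeight κ M s m := by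
      refine sum_congr rfl fun m hm => ?_
      simp at hm
      rw [if_pos (by omega), if_pos (by omega)]
    have a2 : ∑ m ∈ Ioc y M, (if m < y then m - 1 else y) * diagonalWeight κ M s m =
        y * ∑ m ∈ Ioc y M, diagonalWeight κ M s m := by
      rw [mul_sum]
      refine sum_congr rfl fun m hm => ?_
      simp at hm
      rw [if_neg (by omega)]
    have a3 : ∑ m ∈ Ioc y M, (if m < y + 1 then m - 1 else y + 1) * diagonalWeight κ M s m =
        (y + 1) * ∑ m ∈ Ioc y M, diagonalWeight κ M s m := by
      rw [mul_sum]
      refine sum_congr rfl fun m hm => ?_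
      simp at hm
      rw [if_neg (by omega)]
    rw [a1, a2, a3, if_neg (lt_irrefl _), if_pos (by omega)]
    obtain ⟨z, rfl⟩ : ∃ z, y = z + 1 := ⟨y - 1, by omega⟩
    simp only [Nat.add_sub_cancel, add_mul, one_mul] at *
    omega

lemma capacity_eq_sum {a : ℕ} (haL : a < L) (s : ℕ) : capacity κ a s = ∑ u ∈ range L, ∑ v ∈ range (s + 1),
    leafWeight κ v u * if u ≤ a then 1 else 0 := by
  unfold capacity
  have hsub : range (a + 1) ⊆ range L := by intro x; simp; omega
  rw [← sum_subset hsub]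
  · refine sum_congr rfl fun u hu => sum_congr rfl fun v _ => ?_
    simp at hu
    rw [if_pos (by omega), mul_one]
  · intro x _ hx
    simp at hx
    apply sum_eq_zero; intro v _
    rw [if_neg (by omega), mul_zero]

/-- This is the sense in which `served` is greedy: an additional wire goes to the largest tree. -/
lemma served_succ_left {g : Finset ℕ} {a : ℕ} (ha : a ∈ g) (hmax : ∀ i ∈ g, i ≤ a) (haL : a < L)
    (r s : ℕ) :
    served κ L (r + 1) g s = capacity κ a s + served κ L r (g.erase a) s := by
  rw [capacity_eq_sum haL]
  unfold served
  rw [← sum_add_distrib]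
  refine sum_congr rfl fun u _ => ?_
  rw [← sum_add_distrib]
  refine sum_congr rfl fun v _ => ?_
  rw [← mul_add]
  congr 1
  have h1 := countGE_erase ha u
  split_ifs with hu
  · rw [if_pos hu] at h1
    omega
  · rw [countGE_eq_zero, countGE_eq_zero]
    · simp
    · intro i hi
      have := hmax i (mem_of_mem_erase hi)
      omega
    · intro i hi
      have := hmax i hi
      omega

lemma capacity_add_served_le {g : Finset ℕ} {a : ℕ} (ha : a ∈ g) (haL : a < L)
    (r s : ℕ) :
    capacity κ a s + served κ L r (g.erase a) s ≤ served κ L (r + 1) g s := by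
  rw [capacity_eq_sum haL]
  unfold served
  rw [← sum_add_distrib]
  refine sum_le_sum fun u _ => ?_
  rw [← sum_add_distrib]
  refine sum_le_sum fun v _ => ?_
  rw [← mul_add]
  refine Nat.mul_le_mul_left _ ?_
  have h1 := countGE_erase ha u
  split_ifs with hu
  · rw [if_pos hu] at h1
    omega
  · rw [if_neg hu] at h1
    omega

/-- The pointwise comparison behind `served_unfoldMin_le`. -/
lemma min_add_min_le {n α β Γ M b u : ℕ} (hb : b < M)
    (hΓ : α + β + (if u ≤ b then 1 else 0) = Γ + (b - u)) (hγ : Γ ≤ M + 1 - u)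
    (hM : u ≤ M → 1 ≤ Γ) (hα : u ≤ b → α + 1 ≤ Γ) :
    min n α + min n β + (if 1 ≤ M - u ∧ M - u ≤ n then
      (if M - u < M - b then M - u - 1 else M - b) else 0) ≤
    min n (M - u) + min n (Γ - if u ≤ M then 1 else 0) + if u = M ∧ 1 ≤ n then 1 else 0 := by
  split_ifs at * <;> omega

/-- Reindexes by the distance m = M - u from the top height; the time v = s drops out because no
slot is open then. -/
lemma sum_surplus {M s : ℕ} (hML : M < L) (f : ℕ → ℕ) :
    ∑ u ∈ range L, ∑ v ∈ range (s + 1), leafWeight κ v u *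
      (if 1 ≤ M - u ∧ M - u ≤ κ * (s - v) then f (M - u) else 0) =
    ∑ m ∈ Ioc 0 M, f m * diagonalWeight κ M s m := by
  have hsub : range M ⊆ range L := by intro x; simp; omega
  rw [← sum_subset hsub]
  · refine sum_nbij' (fun u => M - u) (fun m => M - m) ?_ ?_ ?_ ?_ ?_
    · intro u; simp
    · intro m; simp; omega
    · intro u; simp; omega
    · intro m; simp; omega
    · intro u hu
      simp at hu
      unfold diagonalWeight
      rw [sum_range_succ, mul_sum]
      simp only [le_refl, tsub_eq_zero_of_le, mul_zero]
      rw [if_neg (by omega), mul_zero, add_zero]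
      refine sum_congr rfl fun v _ => ?_
      rw [show M - (M - u) = u by omega]
      simp only [show 1 ≤ M - u by omega, true_and]
      split_ifs <;> simp [mul_comm]
  · intro u _ hu
    simp at hu
    apply sum_eq_zero; intro v _
    rw [if_neg (by omega), mul_zero]

lemma sum_deficit (hκ : 0 < κ) {M s : ℕ} (hML : M < L) :
    ∑ u ∈ range L, ∑ v ∈ range (s + 1), leafWeight κ v u *
      (if u = M ∧ 1 ≤ κ * (s - v) then 1 else 0) = diagonalWeight κ M s 0 := by
  rw [sum_eq_single M]
  · unfold diagonalWeight
    rw [sum_range_succ]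
    simp only [le_refl, tsub_eq_zero_of_le, mul_zero]
    rw [if_neg (by omega), mul_zero, add_zero]
    refine sum_congr rfl fun v hv => ?_
    simp at hv
    have : 1 ≤ κ * (s - v) := Nat.mul_pos hκ (by omega)
    simp [this]
  · intro u _ hu
    apply sum_eq_zero; intro v _
    rw [if_neg (by omega), mul_zero]
  · intro h; simp at h; omega

/-- Serving one more group of trees from one more wire does not beat the greedy schedule. -/
lemma served_unfoldMin_le_one (hκ : 0 < κ) {A B : Finset ℕ} (hAB : Disjoint A B)
    (hB : B.Nonempty) (hA : A ⊆ range L) (hBL : B ⊆ range L) (s : ℕ) :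
    served κ L 0 A s + (1 + served κ L 0 (unfoldMin B hB) s) ≤ served κ L 1 (A ∪ B) s := by
  classical
  set G := A ∪ B with hG
  have hGne : G.Nonempty := hB.mono subset_union_right
  set M := G.max' hGne with hM
  have hMG : M ∈ G := max'_mem _ _
  have hmax : ∀ i ∈ G, i ≤ M := fun i hi => le_max' _ _ hi
  have hGL : G ⊆ range L := union_subset hA hBL
  have hML : M < L := mem_range.1 (hGL hMG)
  set b := B.min' hB with hb
  have hbB : b ∈ B := min'_mem _ _
  have hbM : b ≤ M := hmax b (subset_union_right hbB)
  rw [show (1 : ℕ) = 0 + 1 from rfl, served_succ_left hMG hmax hML, zero_add]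
  -- If the least element of `B` is the maximum of everything, then `B = {M}` and the two schedules
  -- coincide.
  rcases hbM.eq_or_lt with hbM | hbM
  · have hBs : B = {M} := by
      refine eq_singleton_iff_unique_mem.2 ⟨hbM ▸ hbB, fun x hx => ?_⟩
      have h1 := min'_le B x hx
      have h2 := hmax x (subset_union_right hx)
      omega
    have hMA : M ∉ A := by
      intro h; exact disjoint_left.1 hAB h (hbM ▸ hbB)
    have e1 : unfoldMin B hB = range M := by
      unfold unfoldMin
      rw [← hb, hbM, hBs]; simp
    have e2 : G.erase M = A := by
      rw [hG, hBs, union_comm, ← insert_eq, erase_insert hMA]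
    rw [e1, e2, capacity_eq (L := L) s M hML.le]
    omega
  · rw [capacity_eq (L := L) s M hML.le]
    -- Compared height by height, the greedy side can lose only at height M, by at most one per time
    -- with open slots, and has a surplus at lower heights. `diagonalWeight_zero_le` with y = M - b
    -- says that the surplus pays for the loss.
    have main : served κ L 0 A s + served κ L 0 (unfoldMin B hB) s +
        ∑ m ∈ Ioc 0 M, (if m < M - b then m - 1 else M - b) * diagonalWeight κ M s m ≤
        served κ L 0 (range M) s + served κ L 0 (G.erase M) s + diagonalWeight κ M s 0 := by
      rw [← sum_surplus hML (fun m => if m < M - b then m - 1 else M - b),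
        ← sum_deficit hκ hML]
      unfold served
      simp only [← sum_add_distrib, ← mul_add]
      refine sum_le_sum fun u _ => sum_le_sum fun v _ => Nat.mul_le_mul_left _ ?_
      simp only [zero_add, countGE_range]
      have h1 := countGE_unfoldMin hB u
      have h2 := countGE_union hAB u
      rw [← hG] at h2
      have h3 := countGE_erase hMG u
      rw [show countGE (G.erase M) u = countGE G u - if u ≤ M then 1 else 0 by omega]
      apply min_add_min_le hbM
      · rw [← hb] at h1
        omega
      · have := countGE_le_sub (g := G) (M := M + 1) (fun i hi => by have := hmax i hi; omega) u
        exact this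
      · intro hu; rw [if_pos hu] at h3; omega
      · intro hu
        have : 0 < countGE B u := by
          unfold countGE
          exact card_pos.2 ⟨b, by simp [hbB, hu]⟩
        omega
    have := diagonalWeight_zero_le hκ (s := s) (show 1 ≤ M - b by omega) (Nat.sub_le M b)
    omega

/-- The r wires of `A` are peeled off one at a time, each with the current maximum of `A`. Giving a
wire to that maximum inside `A ∪ B` is at most greedy, so the case of one wire suffices. -/
lemma served_unfoldMin_le (hκ : 0 < κ) {B : Finset ℕ} (hB : B.Nonempty) (hBL : B ⊆ range L)
    (s r : ℕ) : ∀ A : Finset ℕ, Disjoint A B → A ⊆ range L →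
    served κ L r A s + (1 + served κ L 0 (unfoldMin B hB) s) ≤ served κ L (r + 1) (A ∪ B) s := by
  induction r with
  | zero => intro A hAB hA; exact served_unfoldMin_le_one hκ hAB hB hA hBL s
  | succ r ih =>
    intro A hAB hA
    rcases A.eq_empty_or_nonempty with rfl | hne
    · have := served_unfoldMin_le_one hκ hAB hB hA hBL s
      rw [served_empty] at *
      exact this.trans (served_mono (by omega) subset_rfl)
    · set a := A.max' hne with ha
      have haA : a ∈ A := max'_mem _ _
      have haB : a ∉ B := disjoint_left.1 hAB haA
      have haL : a < L := mem_range.1 (hA haA)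
      rw [served_succ_left haA (fun i hi => le_max' _ _ hi) haL]
      have h1 := ih (A.erase a) (hAB.mono_left (erase_subset _ _)) ((erase_subset _ _).trans hA)
      have h2 := capacity_add_served_le (κ := κ) (g := A ∪ B) (mem_union_left B haA) haL (r + 1) s
      rw [erase_union_distrib, erase_eq_of_notMem haB] at h2
      omega
end served

/-! ### Forests of carriers and the number of their heads -/

/-- A forest of carriers of prefix sums.  `hi c` is the number of inputs in the prefix sum carried
by `c`, `head c` says that `c` computes it from a shorter one, `final c` that `c` leads to
an output through duplications only, and `η` labels the positions. -/
structure CarrierForest (n κ D L : ℕ) where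
  par : Fin n → Option (Fin n)
  head : Fin n → Prop
  final : Fin n → Prop
  hi : Fin n → ℕ
  dep : Fin n → ℕ
  outputs : Fin n → ℕ
  η : ℕ → ℕ
  κ_pos : 0 < κ
  par_lt : ∀ {c e}, par c = some e → e < c
  dep_lt : ∀ {c e}, par c = some e → dep e < dep c
  dep_le : ∀ {c}, head c → dep c ≤ D
  hi_eq : ∀ {c e}, par c = some e → ¬ head c → hi c = hi e
  hi_lt : ∀ {c e}, par c = some e → head c → hi e < hi c
  record : ∀ {c e}, par c = some e → head c → ∀ m, hi e < m → m < hi c → η m < η (hi c)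
  separated : ∀ {c c'}, head c → head c' → hi c < hi c' → η (hi c') = η (hi c) →
    ∃ m, hi c < m ∧ m < hi c' ∧ η (hi c) ≤ η m
  hi_inj : ∀ {c c'}, head c → head c' → hi c = hi c' → c = c'
  fanOut_le : ∀ e, #{c | par c = some e} + outputs e ≤ κ + 1
  final_step : ∀ {e}, final e → 1 ≤ outputs e ∨ ∃ d, par d = some e ∧ ¬ head d ∧ final d
  final_of_head : ∀ {c}, head c → final c
  label_lt : ∀ {c}, head c → η (hi c) < L

namespace CarrierForest

variable {n κ D L : ℕ} (F : CarrierForest n κ D L)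

/-- The parent relation. -/
def Rel (e c : Fin n) : Prop := F.par c = some e

open Classical in
/-- The children of a carrier. -/
noncomputable def children (e : Fin n) : Finset (Fin n) := {c | F.par c = some e}

open Classical in
/-- The heads that descend from `c`, with `c` itself. -/
noncomputable def headsFrom (c : Fin n) : Finset (Fin n) :=
  {x | F.head x ∧ Relation.ReflTransGen F.Rel c x}

open Classical in
/-- The heads that properly descend from `c`. -/
noncomputable def headsBelow (c : Fin n) : Finset (Fin n) :=
  {x | F.head x ∧ Relation.TransGen F.Rel c x}

open Classical in
/-- The labels of the elements of `s` that are records from position `i` on. -/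
noncomputable def recordLabels (i : ℕ) (s : Finset (Fin n)) : Finset ℕ :=
  {x ∈ s | ∀ m, i < m → m < F.hi x → F.η m < F.η (F.hi x)}.image fun x => F.η (F.hi x)

variable {F}

lemma mem_recordLabels {i : ℕ} {s : Finset (Fin n)} {l : ℕ} :
    l ∈ F.recordLabels i s ↔ ∃ x ∈ s, (∀ m, i < m → m < F.hi x → F.η m < F.η (F.hi x)) ∧
      F.η (F.hi x) = l := by
  simp [recordLabels, and_assoc]

lemma mem_headsFrom {c x : Fin n} :
    x ∈ F.headsFrom c ↔ F.head x ∧ Relation.ReflTransGen F.Rel c x := by simp [headsFrom]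

lemma mem_headsBelow {c x : Fin n} :
    x ∈ F.headsBelow c ↔ F.head x ∧ Relation.TransGen F.Rel c x := by simp [headsBelow]

lemma mem_children {e c : Fin n} : c ∈ F.children e ↔ F.par c = some e := by simp [children]

lemma recordLabels_mono {i : ℕ} {s t : Finset (Fin n)} (h : s ⊆ t) :
    F.recordLabels i s ⊆ F.recordLabels i t := by
  intro l
  simp only [mem_recordLabels]
  rintro ⟨x, hx, h2⟩
  exact ⟨x, h hx, h2⟩

lemma hi_le {e c : Fin n} (h : Relation.ReflTransGen F.Rel e c) : F.hi e ≤ F.hi c := by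
  induction h with
  | refl => exact le_rfl
  | tail _ h ih =>
    rename_i b c _
    by_cases hc : F.head c
    · exact ih.trans (F.hi_lt h hc).le
    · exact ih.trans (F.hi_eq h hc).ge

lemma lt_of_transGen {e c : Fin n} (h : Relation.TransGen F.Rel e c) : e < c := by
  induction h with
  | single h => exact F.par_lt h
  | tail _ h ih => exact ih.trans (F.par_lt h)

lemma dep_lt_of_transGen {e c : Fin n} (h : Relation.TransGen F.Rel e c) :
    F.dep e < F.dep c := by
  induction h with
  | single h => exact F.dep_lt h
  | tail _ h ih => exact ih.trans (F.dep_lt h)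

lemma hi_lt_of_mem {e x : Fin n} (h : x ∈ F.headsBelow e) : F.hi e < F.hi x := by
  rw [mem_headsBelow] at h
  obtain ⟨b, hb, hx⟩ := Relation.TransGen.tail'_iff.1 h.2
  exact (hi_le hb).trans_lt (F.hi_lt hx h.1)

lemma headsBelow_eq_empty {e : Fin n} (h : D ≤ F.dep e) : F.headsBelow e = ∅ := by
  refine eq_empty_of_forall_notMem fun x hx => ?_
  rw [mem_headsBelow] at hx
  have := dep_lt_of_transGen hx.2
  have := F.dep_le hx.1
  omega

lemma headsBelow_eq_biUnion (e : Fin n) :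
    F.headsBelow e = (F.children e).biUnion F.headsFrom := by
  ext x
  simp only [mem_biUnion, mem_headsBelow, mem_headsFrom, mem_children]
  rw [Relation.TransGen.head'_iff]
  constructor
  · rintro ⟨h, c, hc, hx⟩; exact ⟨c, hc, h, hx⟩
  · rintro ⟨c, hc, h, hx⟩; exact ⟨h, c, hc, hx⟩

lemma headsFrom_of_not_head {c : Fin n} (h : ¬ F.head c) : F.headsFrom c = F.headsBelow c := by
  ext x
  rw [mem_headsFrom, mem_headsBelow, Relation.reflTransGen_iff_eq_or_transGen]
  constructor
  · rintro ⟨h1, rfl | h2⟩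
    · exact absurd h1 h
    · exact ⟨h1, h2⟩
  · rintro ⟨h1, h2⟩; exact ⟨h1, Or.inr h2⟩

lemma headsFrom_of_head {c : Fin n} (h : F.head c) :
    F.headsFrom c = insert c (F.headsBelow c) := by
  ext x
  rw [mem_headsFrom, mem_insert, mem_headsBelow, Relation.reflTransGen_iff_eq_or_transGen]
  constructor
  · rintro ⟨h1, rfl | h2⟩
    · exact Or.inl rfl
    · exact Or.inr ⟨h1, h2⟩
  · rintro (rfl | ⟨h1, h2⟩)
    · exact ⟨h, Or.inl rfl⟩
    · exact ⟨h1, Or.inr h2⟩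

lemma notMem_headsBelow (c : Fin n) : c ∉ F.headsBelow c := by
  rw [mem_headsBelow]
  exact fun h => lt_irrefl _ (lt_of_transGen h.2)

lemma headsFrom_subset {e c : Fin n} (h : c ∈ F.children e) :
    F.headsFrom c ⊆ F.headsBelow e := by
  rw [headsBelow_eq_biUnion]
  exact subset_biUnion_of_mem _ h

/-- Ancestors of a carrier are comparable. -/
lemma comparable {a b x : Fin n} (ha : Relation.ReflTransGen F.Rel a x)
    (hb : Relation.ReflTransGen F.Rel b x) :
    Relation.ReflTransGen F.Rel a b ∨ Relation.ReflTransGen F.Rel b a := by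
  induction ha with
  | refl => exact Or.inr hb
  | tail ha h ih =>
    rename_i y x
    rcases Relation.ReflTransGen.cases_tail hb with rfl | ⟨z, hz, hzx⟩
    · exact Or.inl (ha.tail h)
    · have : z = y := by
        have h1 : F.par x = some y := h
        have h2 : F.par x = some z := hzx
        rw [h1] at h2; exact (Option.some.inj h2).symm
      subst this
      exact ih hz

lemma headsFrom_disjoint {e c d : Fin n} (hc : c ∈ F.children e) (hd : d ∈ F.children e)
    (hcd : c ≠ d) : Disjoint (F.headsFrom c) (F.headsFrom d) := by
  have key : ∀ c d : Fin n, c ∈ F.children e → d ∈ F.children e → c ≠ d →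
      ¬ Relation.ReflTransGen F.Rel c d := by
    intro c d hc hd hcd h
    rcases Relation.ReflTransGen.cases_tail h with h | ⟨z, hz, hzd⟩
    · exact hcd h.symm
    · rw [mem_children] at hc hd
      have h2 : F.par d = some z := hzd
      rw [hd] at h2
      obtain rfl := Option.some.inj h2
      have h3 := F.par_lt hc
      rcases Relation.reflTransGen_iff_eq_or_transGen.1 hz with h | h
      · exact absurd h3 (by rw [h]; exact lt_irrefl _)
      · exact absurd h3 (lt_of_transGen h).asymm
  rw [disjoint_left]
  intro x hx hx'
  rw [mem_headsFrom] at hx hx'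
  rcases comparable hx.2 hx'.2 with h | h
  · exact key c d hc hd hcd h
  · exact key d c hd hc hcd.symm h

/-- Of two records counted from the same position the later one has the strictly larger label, so
equal labels mean the same position, and `hi_inj` gives the same head. -/
lemma recordLabels_disjoint {i : ℕ} {s t : Finset (Fin n)} (hst : Disjoint s t)
    (hs : ∀ x ∈ s, F.head x ∧ i < F.hi x) (ht : ∀ x ∈ t, F.head x ∧ i < F.hi x) :
    Disjoint (F.recordLabels i s) (F.recordLabels i t) := by
  rw [disjoint_left]
  intro l hl hl'
  rw [mem_recordLabels] at hl hl'
  obtain ⟨x, hx, hrx, rfl⟩ := hl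
  obtain ⟨y, hy, hry, he⟩ := hl'
  rcases lt_trichotomy (F.hi x) (F.hi y) with h | h | h
  · have := hry _ (hs x hx).2 h; omega
  · have := F.hi_inj (hs x hx).1 (ht y hy).1 h
    subst this
    exact disjoint_left.1 hst hx hy
  · have := hrx _ (ht y hy).2 h; omega

lemma mem_headsFrom_spec {e c x : Fin n} (hc : c ∈ F.children e) (hx : x ∈ F.headsFrom c) :
    F.head x ∧ F.hi e < F.hi x :=
  have h := headsFrom_subset hc hx
  ⟨(mem_headsBelow.1 h).1, hi_lt_of_mem h⟩

lemma recordLabels_children_disjoint {e c d : Fin n} (hc : c ∈ F.children e)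
    (hd : d ∈ F.children e) (hcd : c ≠ d) :
    Disjoint (F.recordLabels (F.hi e) (F.headsFrom c))
      (F.recordLabels (F.hi e) (F.headsFrom d)) :=
  recordLabels_disjoint (headsFrom_disjoint hc hd hcd) (fun _ h => mem_headsFrom_spec hc h)
    (fun _ h => mem_headsFrom_spec hd h)

lemma recordLabels_subset_range {i : ℕ} {s : Finset (Fin n)} (hs : ∀ x ∈ s, F.head x) :
    F.recordLabels i s ⊆ range L := by
  intro l hl
  rw [mem_recordLabels] at hl
  obtain ⟨x, hx, -, rfl⟩ := hl
  exact mem_range.2 (F.label_lt (hs x hx))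

variable (F) in
/-- The labels visible from a carrier. -/
noncomputable def visible (e : Fin n) : Finset ℕ := F.recordLabels (F.hi e) (F.headsBelow e)

lemma recordLabels_subset_visible {e c : Fin n} (hc : c ∈ F.children e) :
    F.recordLabels (F.hi e) (F.headsFrom c) ⊆ F.visible e :=
  recordLabels_mono (headsFrom_subset hc)

lemma mem_visible_iff {e : Fin n} {l : ℕ} : l ∈ F.visible e ↔
    ∃ c ∈ F.children e, l ∈ F.recordLabels (F.hi e) (F.headsFrom c) := by
  unfold visible
  rw [headsBelow_eq_biUnion]
  simp only [mem_recordLabels, mem_biUnion]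
  constructor
  · rintro ⟨x, ⟨c, hc, hx⟩, h⟩; exact ⟨c, hc, x, hx, h⟩
  · rintro ⟨c, hc, x, hx, h⟩; exact ⟨x, ⟨c, hc, hx⟩, h⟩

lemma card_headsBelow (e : Fin n) :
    #(F.headsBelow e) = ∑ c ∈ F.children e, #(F.headsFrom c) := by
  rw [headsBelow_eq_biUnion, card_biUnion]
  exact fun c hc d hd h => headsFrom_disjoint hc hd h

lemma visible_subset_range (e : Fin n) : F.visible e ⊆ range L :=
  recordLabels_subset_range fun _ h => (mem_headsBelow.1 h).1

/-- Applies `served_unfoldMin_le` once for each child in `K`: each child brings its group of record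
labels and costs one wire. The set `A` leaves room for one distinguished child, which is treated
separately. -/
lemma sum_card_headsFrom_le {e : Fin n} {s : ℕ} (K : Finset (Fin n)) (hK : K ⊆ F.children e)
    (hS : ∀ c ∈ K, (F.headsFrom c).Nonempty →
      ∃ h : (F.recordLabels (F.hi e) (F.headsFrom c)).Nonempty,
        #(F.headsFrom c) ≤ 1 + served κ L 0 (unfoldMin _ h) s) (A : Finset ℕ) (hA : A ⊆ range L)
    (hd : ∀ c ∈ K, Disjoint A (F.recordLabels (F.hi e) (F.headsFrom c))) :
    served κ L 0 A s + ∑ c ∈ K, #(F.headsFrom c) ≤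
      served κ L #K (A ∪ K.biUnion fun c => F.recordLabels (F.hi e) (F.headsFrom c)) s := by
  induction K using Finset.induction_on with
  | empty => simp
  | insert c K hc ih =>
    have ih' := ih ((subset_insert _ _).trans hK) (fun d hd => hS d (mem_insert_of_mem hd))
      (fun d hd' => hd d (mem_insert_of_mem hd'))
    rw [sum_insert hc, card_insert_of_notMem hc]
    rcases (F.headsFrom c).eq_empty_or_nonempty with h0 | h0
    · rw [h0, card_empty, zero_add]
      refine ih'.trans (served_mono (Nat.le_succ _) ?_)
      exact union_subset_union_right (biUnion_subset_biUnion_of_subset_left _ (subset_insert _ _))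
    · obtain ⟨h1, h2⟩ := hS c (mem_insert_self _ _) h0
      have hcK : c ∈ F.children e := hK (mem_insert_self _ _)
      have hr : ∀ d ∈ F.children e, F.recordLabels (F.hi e) (F.headsFrom d) ⊆ range L :=
        fun d _ => recordLabels_subset_range fun _ h => (mem_headsFrom.1 h).1
      have := served_unfoldMin_le F.κ_pos h1 (hr c hcK) s #K
        (A ∪ K.biUnion fun c => F.recordLabels (F.hi e) (F.headsFrom c)) ?_ ?_
      · rw [biUnion_insert, union_comm (F.recordLabels _ _), ← union_assoc]
        omega
      · rw [disjoint_union_left]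
        refine ⟨hd c (mem_insert_self _ _), ?_⟩
        rw [disjoint_biUnion_left]
        intro d hd
        exact recordLabels_children_disjoint (hK (mem_insert_of_mem hd)) hcK
          (fun h => hc (h ▸ hd))
      · refine union_subset hA (biUnion_subset.2 fun d hd => hr d (hK (mem_insert_of_mem hd)))

/-- The two bounds for the number of heads below a carrier. -/
def Bounds (F : CarrierForest n κ D L) (e : Fin n) : Prop :=
  (F.final e → #(F.headsBelow e) ≤ served κ L 0 (F.visible e) (D - F.dep e)) ∧
  ((F.headsBelow e).Nonempty → ∃ h : (F.visible e).Nonempty,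
    #(F.headsBelow e) ≤ 1 + served κ L 0 (unfoldMin _ h) (D - F.dep e))

/-- Translates the bounds for `c`, whose records start at `c`, into records that start at its
parent. A duplicate sees the same labels as its parent; for a head, what it sees is contained in the
unfolding of its own label, and it counts itself as the additional 1. -/
lemma child_bound {e c : Fin n} (hc : c ∈ F.children e) (hB : F.Bounds c)
    (h0 : (F.headsFrom c).Nonempty) :
    ∃ h : (F.recordLabels (F.hi e) (F.headsFrom c)).Nonempty,
        #(F.headsFrom c) ≤ 1 + served κ L 0 (unfoldMin _ h) (D - F.dep e - 1) := by
  have hpar := mem_children.1 hc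
  have hdep := F.dep_lt hpar
  by_cases hh : F.head c
  · have hrec := F.record hpar hh
    have hmem : F.η (F.hi c) ∈ F.recordLabels (F.hi e) (F.headsFrom c) :=
      mem_recordLabels.2 ⟨c, by rw [headsFrom_of_head hh]; exact mem_insert_self _ _, hrec, rfl⟩
    refine ⟨⟨_, hmem⟩, ?_⟩
    -- Records below `c` lie beyond `hi c`, hence have larger labels: the head is the least record
    -- of its own subtree.
    have hmin : (F.recordLabels (F.hi e) (F.headsFrom c)).min' ⟨_, hmem⟩ = F.η (F.hi c) := by
      refine le_antisymm (min'_le _ _ hmem) (le_min' _ _ _ ?_)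
      intro l hl
      obtain ⟨y, hy, hry, rfl⟩ := mem_recordLabels.1 hl
      rw [headsFrom_of_head hh, mem_insert] at hy
      rcases hy with rfl | hy
      · exact le_rfl
      · exact (hry _ (F.hi_lt hpar hh) (hi_lt_of_mem hy)).le
    have hcard : #(F.headsFrom c) = 1 + #(F.headsBelow c) := by
      rw [headsFrom_of_head hh, card_insert_of_notMem (notMem_headsBelow c), add_comm]
    rw [hcard]
    refine Nat.add_le_add_left ((hB.1 (F.final_of_head hh)).trans ?_) 1
    refine (served_mono_time (show D - F.dep c ≤ D - F.dep e - 1 by omega) _).trans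
      (served_mono le_rfl ?_)
    intro l hl
    obtain ⟨x, hx, hrx, rfl⟩ := mem_recordLabels.1 hl
    have hcx := hi_lt_of_mem hx
    have hxh := (mem_headsBelow.1 hx).1
    unfold unfoldMin
    rw [mem_union, mem_erase, mem_range]
    simp only [hmin]
    -- Smaller labels are in the added range, larger ones are records already as seen from `e`, and
    -- an equal label would be hidden behind the position given by `separated`.
    rcases lt_trichotomy (F.η (F.hi x)) (F.η (F.hi c)) with h | h | h
    · exact Or.inr h
    · obtain ⟨m, h1, h2, h3⟩ := F.separated hh hxh hcx h
      have := hrx m h1 h2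
      omega
    · refine Or.inl ⟨by omega, mem_recordLabels.2 ⟨x, ?_, ?_, rfl⟩⟩
      · rw [headsFrom_of_head hh]; exact mem_insert_of_mem hx
      · intro m hm1 hm2
        rcases lt_trichotomy m (F.hi c) with h' | h' | h'
        · exact (hrec m hm1 h').trans h
        · rw [h']; exact h
        · exact hrx m h' hm2
  · rw [headsFrom_of_not_head hh] at h0
    have e1 : F.recordLabels (F.hi e) (F.headsFrom c) = F.visible c := by
      rw [visible, headsFrom_of_not_head hh, F.hi_eq hpar hh]
    obtain ⟨h1, h2⟩ := hB.2 h0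
    simp only [e1]
    refine ⟨h1, ?_⟩
    have hcard : #(F.headsFrom c) = #(F.headsBelow c) := by rw [headsFrom_of_not_head hh]
    exact hcard.le.trans <| h2.trans (Nat.add_le_add_left
      (served_mono_time (show D - F.dep c ≤ D - F.dep e - 1 by omega) _) 1)

/-- Induction from the leaves of the forest. A final carrier spends one wire on its output or on a
final duplicate. Any other carrier may spend all κ + 1 wires on heads, but the child holding the
least visible label is already bounded through the unfolding of that label, so again only κ children
are charged. -/
lemma bounds (e : Fin n) : F.Bounds e := by
  induction e using WellFoundedGT.induction with
  | ind e ih =>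
  have hch : ∀ c ∈ F.children e, F.Bounds c := fun c hc => ih c (F.par_lt (mem_children.1 hc))
  have hS : ∀ c ∈ F.children e, (F.headsFrom c).Nonempty →
      ∃ h : (F.recordLabels (F.hi e) (F.headsFrom c)).Nonempty,
        #(F.headsFrom c) ≤ 1 + served κ L 0 (unfoldMin _ h) (D - F.dep e - 1) :=
    fun c hc => child_bound hc (hch c hc)
  have hfan := F.fanOut_le e
  have hfan' : #(F.children e) + F.outputs e ≤ κ + 1 := by
    convert hfan
    unfold children
    congr
  have hr : ∀ d, F.recordLabels (F.hi e) (F.headsFrom d) ⊆ range L :=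
    fun d => recordLabels_subset_range fun _ h => (mem_headsFrom.1 h).1
  by_cases hD : D ≤ F.dep e
  · have h0 := headsBelow_eq_empty hD
    constructor
    · intro _; rw [h0]; simp
    · intro h; rw [h0] at h; simp at h
  obtain ⟨s, hs⟩ : ∃ s, D - F.dep e = s + 1 := ⟨D - F.dep e - 1, by omega⟩
  rw [hs, Nat.add_sub_cancel] at hS
  have hsub : ∀ K ⊆ F.children e, (K.biUnion fun c => F.recordLabels (F.hi e) (F.headsFrom c)) ⊆
      F.visible e := fun K hK => biUnion_subset.2 fun c hc => recordLabels_subset_visible (hK hc)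
  constructor
  · intro hf
    rw [hs, served_succ, card_headsBelow]
    -- With an output at `e` at most κ children remain. Otherwise the final duplicate `d` takes the
    -- place of the reserved wire, and its visible labels play the role of the set `A`.
    rcases F.final_step hf with ho | ⟨d, hd, hdh, hdf⟩
    · have := sum_card_headsFrom_le (F.children e) subset_rfl hS ∅ (by simp) (by simp)
      rw [served_empty, zero_add, empty_union] at this
      exact this.trans (served_mono (by omega) (hsub _ subset_rfl))
    · have hdc : d ∈ F.children e := mem_children.2 hd
      have e1 : F.recordLabels (F.hi e) (F.headsFrom d) = F.visible d := by
        rw [visible, headsFrom_of_not_head hdh, F.hi_eq hd hdh]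
      have h1 := sum_card_headsFrom_le ((F.children e).erase d) (erase_subset _ _)
        (fun c hc => hS c (mem_of_mem_erase hc)) (F.visible d) (visible_subset_range d)
        (fun c hc => by
          rw [← e1]
          exact recordLabels_children_disjoint hdc (mem_of_mem_erase hc) (ne_of_mem_erase hc).symm)
      have h2 := (hch d hdc).1 hdf
      rw [← headsFrom_of_not_head hdh] at h2
      have h3 := served_mono_time (κ := κ) (L := L)
        (show D - F.dep d ≤ s by have := F.dep_lt hd; omega) (F.visible d)
      rw [← add_sum_erase _ _ hdc]
      have h4 : #((F.children e).erase d) ≤ κ := by rw [card_erase_of_mem hdc]; omega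
      have h5 : served κ L #((F.children e).erase d) (F.visible d ∪
          ((F.children e).erase d).biUnion fun c => F.recordLabels (F.hi e) (F.headsFrom c)) s ≤
          served κ L κ (F.visible e) s := by
        refine served_mono h4 (union_subset ?_ (hsub _ (erase_subset _ _)))
        rw [← e1]; exact recordLabels_subset_visible hdc
      omega
  · intro hne
    have hv : (F.visible e).Nonempty := by
      rw [headsBelow_eq_biUnion, biUnion_nonempty] at hne
      obtain ⟨c, hc, hne⟩ := hne
      obtain ⟨h, -⟩ := hS c hc hne
      exact h.mono (recordLabels_subset_visible hc)
    refine ⟨hv, ?_⟩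
    rw [hs, served_succ, card_headsBelow]
    -- The child `c` with the least visible label is distinguished: its minimum is the minimum for
    -- `e`, so both are unfolded by the same range.
    obtain ⟨c, hc, hmc⟩ := mem_visible_iff.1 (min'_mem _ hv)
    have hcne : (F.headsFrom c).Nonempty := by
      obtain ⟨x, hx, -⟩ := mem_recordLabels.1 hmc
      exact ⟨x, hx⟩
    obtain ⟨h1, h2⟩ := hS c hc hcne
    have hmin : (F.recordLabels (F.hi e) (F.headsFrom c)).min' h1 = (F.visible e).min' hv :=
      le_antisymm (min'_le _ _ hmc) (le_min' _ _ _ fun l hl =>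
        min'_le _ _ (recordLabels_subset_visible hc hl))
    have hdis : ∀ d ∈ (F.children e).erase c, Disjoint (unfoldMin _ h1)
        (F.recordLabels (F.hi e) (F.headsFrom d)) := by
      intro d hd
      have hdc := recordLabels_children_disjoint hc (mem_of_mem_erase hd) (ne_of_mem_erase hd).symm
      unfold unfoldMin
      rw [disjoint_union_left]
      refine ⟨hdc.mono_left (erase_subset _ _), ?_⟩
      rw [disjoint_left, hmin]
      intro l hl hl'
      have := min'_le _ _ (recordLabels_subset_visible (mem_of_mem_erase hd) hl')
      have := mem_range.1 hl
      omega
    have hlt : (F.visible e).min' hv < L :=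
      mem_range.1 (visible_subset_range e (min'_mem _ hv))
    have h3 := sum_card_headsFrom_le ((F.children e).erase c) (erase_subset _ _)
        (fun d hd => hS d (mem_of_mem_erase hd)) (unfoldMin _ h1) (by
          unfold unfoldMin
          refine union_subset ((erase_subset _ _).trans (hr c)) ?_
          rw [hmin]
          intro x hx
          have := mem_range.1 hx
          exact mem_range.2 (by omega)) hdis
    rw [← add_sum_erase _ _ hc]
    have h4 : #((F.children e).erase c) ≤ κ := by rw [card_erase_of_mem hc]; omega
    have h5 : served κ L #((F.children e).erase c) (unfoldMin _ h1 ∪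
          ((F.children e).erase c).biUnion fun c => F.recordLabels (F.hi e) (F.headsFrom c)) s ≤
          served κ L κ (unfoldMin _ hv) s := by
      refine served_mono h4 ?_
      intro l hl
      unfold unfoldMin at hl ⊢
      rw [hmin] at hl
      simp only [mem_union, mem_erase, mem_range, mem_biUnion] at hl ⊢
      rcases hl with (⟨ha, hb⟩ | ha) | ⟨d, ⟨hd1, hd2⟩, hd⟩
      · exact Or.inl ⟨ha, recordLabels_subset_visible hc hb⟩
      · exact Or.inr ha
      · refine Or.inl ⟨?_, recordLabels_subset_visible hd2 hd⟩
        rintro rfl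
        exact disjoint_left.1 (recordLabels_children_disjoint hc hd2 (Ne.symm hd1)) hmc hd
    omega

/-- The number of heads below a final carrier. -/
lemma card_headsBelow_le {e : Fin n} (he : F.final e) {h : ℕ} (hL : h ≤ L)
    (hlab : ∀ x ∈ F.headsBelow e, F.η (F.hi x) < h) :
    #(F.headsBelow e) < capacity κ h (D - F.dep e) := by
  rw [capacity_eq (L := L) _ h hL]
  refine Nat.lt_of_le_of_lt ((bounds e).1 he) ?_
  rw [add_comm]
  refine Nat.lt_succ_of_le (served_mono le_rfl ?_)
  intro l hl
  obtain ⟨x, hx, -, rfl⟩ := mem_recordLabels.1 hl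
  exact mem_range.2 (hlab x hx)

end CarrierForest

/-! ### Intervals as a test semigroup, and the unfolding of a circuit -/

/-- Intervals of consecutive inputs, with a junk element; the product of two intervals is
their union if the second one begins where the first one ends. -/
inductive IntervalSum : Type
  | junk : IntervalSum
  | mk (i m : ℕ) : IntervalSum

namespace IntervalSum

/-- The product of intervals. -/
def mul : IntervalSum → IntervalSum → IntervalSum
  | mk a b, mk c d => if b = c then mk a d else junk
  | _, _ => junk

lemma mul_eq_mk_iff {x y : IntervalSum} {i m : ℕ} :
    mul x y = mk i m ↔ ∃ s, x = mk i s ∧ y = mk s m := by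
  rcases x with _ | ⟨a, b⟩ <;> rcases y with _ | ⟨c, d⟩ <;> simp only [mul] <;>
    (try split_ifs) <;> simp <;> grind

lemma ext_mk {x y : IntervalSum} (h : ∀ i m, x = mk i m ↔ y = mk i m) : x = y := by
  cases x with
  | junk =>
    cases y with
    | junk => rfl
    | mk i m => exact (h i m).2 rfl
  | mk i m => exact ((h i m).1 rfl).symm

instance : Semigroup IntervalSum where
  mul := mul
  mul_assoc x y z := by
    refine ext_mk fun i m => ?_
    change mul (mul x y) z = mk i m ↔ mul x (mul y z) = mk i m
    simp only [mul_eq_mk_iff]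
    constructor
    · rintro ⟨s, ⟨r, h1, h2⟩, h3⟩; exact ⟨r, h1, s, h2, h3⟩
    · rintro ⟨r, h1, s, h2, h3⟩; exact ⟨s, ⟨r, h1, h2⟩, h3⟩

lemma mul_eq_mk {x y : IntervalSum} {i m : ℕ} :
    x * y = mk i m ↔ ∃ s, x = mk i s ∧ y = mk s m :=
  mul_eq_mk_iff

end IntervalSum

namespace CircuitElement

/-- Renaming of the arguments. -/
def map {V W : Type} (f : V → W) : CircuitElement V → CircuitElement W
  | ident a => ident (f a)
  | binary a b => binary (f a) (f b)

@[simp] lemma args_map {V W : Type} (f : V → W) (e : CircuitElement V) :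
    (e.map f).args = e.args.map f := by cases e <;> rfl

@[simp] lemma isBinary_map {V W : Type} (f : V → W) (e : CircuitElement V) :
    (e.map f).isBinary = e.isBinary := by cases e <;> rfl

end CircuitElement

namespace PrefixCircuit

variable {N : ℕ} (c : PrefixCircuit N)

/-- The element `j`, with its arguments as vertices of the circuit. -/
def elem (j : Fin c.size) : CircuitElement c.Vertex :=
  (c.elt j).map (Sum.map id (Fin.castLE j.isLt.le))

lemma argVertices_eq (j : Fin c.size) : c.argVertices j = (c.elem j).args := by
  simp [elem, argVertices]

lemma isBinary_elem (j : Fin c.size) : (c.elem j).isBinary = (c.elt j).isBinary := by simp [elem]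

/-- A rank for the induction along the circuit. -/
def rank : c.Vertex → ℕ := Sum.elim (fun _ => 0) (fun j => j.val + 1)

variable {c}

lemma rank_lift {j : Fin c.size} (a : Fin N ⊕ Fin j.val) :
    c.rank (Sum.map id (Fin.castLE j.isLt.le) a) < c.rank (Sum.inr j) := by
  rcases a with a | a
  · simp [rank]
  · simp [rank]

lemma value_lift {S : Type} [Semigroup S] (x : Fin N → S) {j : Fin c.size}
    (a : Fin N ⊕ Fin j.val) :
    a.elim x (fun i => c.eltValue x ⟨i.val, i.isLt.trans j.isLt⟩) =
      c.value x (Sum.map id (Fin.castLE j.isLt.le) a) := by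
  rcases a with a | a <;> rfl

lemma vertexDepth_lift {j : Fin c.size} (a : Fin N ⊕ Fin j.val) :
    a.elim (fun _ => 0) (fun i => c.eltDepth ⟨i.val, i.isLt.trans j.isLt⟩) =
      c.vertexDepth (Sum.map id (Fin.castLE j.isLt.le) a) := by
  rcases a with a | a <;> rfl

lemma exists_of_elem_ident {j : Fin c.size} {a : c.Vertex} (h : c.elem j = .ident a) :
    ∃ a', c.elt j = .ident a' ∧ a = Sum.map id (Fin.castLE j.isLt.le) a' := by
  unfold elem at h
  cases h' : c.elt j with
  | ident a' => rw [h'] at h; simp only [CircuitElement.map, CircuitElement.ident.injEq] at h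
                exact ⟨a', rfl, h.symm⟩
  | binary p q => rw [h'] at h; simp [CircuitElement.map] at h

lemma exists_of_elem_binary {j : Fin c.size} {p q : c.Vertex} (h : c.elem j = .binary p q) :
    ∃ p' q', c.elt j = .binary p' q' ∧ p = Sum.map id (Fin.castLE j.isLt.le) p' ∧
      q = Sum.map id (Fin.castLE j.isLt.le) q' := by
  unfold elem at h
  cases h' : c.elt j with
  | ident a' => rw [h'] at h; simp [CircuitElement.map] at h
  | binary p' q' =>
    rw [h'] at h; simp only [CircuitElement.map, CircuitElement.binary.injEq] at h
    exact ⟨p', q', rfl, h.1.symm, h.2.symm⟩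

lemma rank_ident {j : Fin c.size} {a : c.Vertex} (h : c.elem j = .ident a) :
    c.rank a < c.rank (Sum.inr j) := by
  obtain ⟨a', -, rfl⟩ := exists_of_elem_ident h
  exact rank_lift a'

lemma rank_left {j : Fin c.size} {p q : c.Vertex} (h : c.elem j = .binary p q) :
    c.rank p < c.rank (Sum.inr j) := by
  obtain ⟨p', q', -, rfl, rfl⟩ := exists_of_elem_binary h
  exact rank_lift p'

lemma rank_right {j : Fin c.size} {p q : c.Vertex} (h : c.elem j = .binary p q) :
    c.rank q < c.rank (Sum.inr j) := by
  obtain ⟨p', q', -, rfl, rfl⟩ := exists_of_elem_binary h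
  exact rank_lift q'

lemma value_ident {S : Type} [Semigroup S] (x : Fin N → S) {j : Fin c.size} {a : c.Vertex}
    (h : c.elem j = .ident a) : c.value x (Sum.inr j) = c.value x a := by
  obtain ⟨a', h', rfl⟩ := exists_of_elem_ident h
  change c.eltValue x j = _
  rw [eltValue, h', ← value_lift]

lemma value_binary {S : Type} [Semigroup S] (x : Fin N → S) {j : Fin c.size} {p q : c.Vertex}
    (h : c.elem j = .binary p q) : c.value x (Sum.inr j) = c.value x p * c.value x q := by
  obtain ⟨p', q', h', rfl, rfl⟩ := exists_of_elem_binary h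
  change c.eltValue x j = _
  rw [eltValue, h', ← value_lift, ← value_lift]

lemma vertexDepth_ident {j : Fin c.size} {a : c.Vertex} (h : c.elem j = .ident a) :
    c.vertexDepth (Sum.inr j) = c.vertexDepth a + 1 := by
  obtain ⟨a', h', rfl⟩ := exists_of_elem_ident h
  change c.eltDepth j = _
  rw [eltDepth, h', ← vertexDepth_lift]

lemma vertexDepth_binary {j : Fin c.size} {p q : c.Vertex} (h : c.elem j = .binary p q) :
    c.vertexDepth (Sum.inr j) = max (c.vertexDepth p) (c.vertexDepth q) + 1 := by
  obtain ⟨p', q', h', rfl, rfl⟩ := exists_of_elem_binary h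
  change c.eltDepth j = _
  rw [eltDepth, h', ← vertexDepth_lift, ← vertexDepth_lift]

/-- The vertex computes the product of the inputs `i, …, m - 1`. -/
def Covers (c : PrefixCircuit N) (v : c.Vertex) (i m : ℕ) : Prop :=
  c.value (S := IntervalSum) (fun a => .mk a.val (a.val + 1)) v = .mk i m

lemma Covers.unique {v : c.Vertex} {i m i' m' : ℕ} (h : c.Covers v i m) (h' : c.Covers v i' m') :
    i = i' ∧ m = m' := by
  simpa using h.symm.trans h'

lemma covers_inl {a : Fin N} {i m : ℕ} :
    c.Covers (Sum.inl a) i m ↔ i = a ∧ m = a + 1 := by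
  constructor
  · intro h
    have h' : IntervalSum.mk a.val (a.val + 1) = .mk i m := h
    simp only [IntervalSum.mk.injEq] at h'
    omega
  · rintro ⟨rfl, rfl⟩; rfl

lemma covers_ident {j : Fin c.size} {a : c.Vertex} (h : c.elem j = .ident a) {i m : ℕ} :
    c.Covers (Sum.inr j) i m ↔ c.Covers a i m := by
  unfold Covers; rw [value_ident _ h]

lemma covers_binary {j : Fin c.size} {p q : c.Vertex} (h : c.elem j = .binary p q) {i m : ℕ} :
    c.Covers (Sum.inr j) i m ↔ ∃ s, c.Covers p i s ∧ c.Covers q s m := by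
  unfold Covers; rw [value_binary _ h, IntervalSum.mul_eq_mk]

/-- Induction on the vertices of a circuit. -/
lemma vertex_induction {motive : c.Vertex → Prop} (inl : ∀ a, motive (Sum.inl a))
    (ident : ∀ j a, c.elem j = .ident a → motive a → motive (Sum.inr j))
    (binary : ∀ j p q, c.elem j = .binary p q → motive p → motive q → motive (Sum.inr j))
    (v : c.Vertex) : motive v := by
  induction hv : c.rank v using Nat.strong_induction_on generalizing v with
  | _ n ih =>
  rcases v with a | j
  · exact inl a
  · cases h : c.elem j with
    | ident a => exact ident j a h (ih _ (hv ▸ rank_ident h) _ rfl)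
    | binary p q =>
      exact binary j p q h (ih _ (hv ▸ rank_left h) _ rfl) (ih _ (hv ▸ rank_right h) _ rfl)

lemma Covers.lt {v : c.Vertex} : ∀ {i m : ℕ}, c.Covers v i m → i < m := by
  induction v using vertex_induction with
  | inl a => intro i m h; rw [covers_inl] at h; omega
  | ident j a h ih => intro i m h'; rw [covers_ident h] at h'; exact ih h'
  | binary j p q h ih1 ih2 =>
    intro i m h'
    rw [covers_binary h] at h'
    obtain ⟨s, h1, h2⟩ := h'
    exact (ih1 h1).trans (ih2 h2)

lemma Covers.le {v : c.Vertex} : ∀ {i m : ℕ}, c.Covers v i m → m ≤ N := by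
  induction v using vertex_induction with
  | inl a => intro i m h; rw [covers_inl] at h; omega
  | ident j a h ih => intro i m h'; rw [covers_ident h] at h'; exact ih h'
  | binary j p q h ih1 ih2 =>
    intro i m h'
    rw [covers_binary h] at h'
    obtain ⟨s, h1, h2⟩ := h'
    exact ih2 h2

lemma prefixSum_interval (i : ℕ) (hi : i < N) :
    prefixSum (S := IntervalSum) (fun a : Fin N => .mk a.val (a.val + 1)) i hi =
      .mk 0 (i + 1) := by
  induction i with
  | zero => rfl
  | succ i ih =>
    rw [prefixSum, ih, IntervalSum.mul_eq_mk]
    exact ⟨_, rfl, rfl⟩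

lemma ComputesPrefixSums.covers_out (hc : c.ComputesPrefixSums) (i : Fin N) :
    c.Covers (c.out i) 0 (i + 1) := by
  unfold Covers
  rw [hc IntervalSum, prefixSum_interval]

variable (c) in
/-- `c.SplitAt v b x`: in the formula obtained by unfolding `v`, the binary element `x` is the
one whose left argument ends, and whose right argument begins, at the position `b`. -/
inductive SplitAt : c.Vertex → ℕ → Fin c.size → Prop
  | here {j p q i b m} : c.elem j = .binary p q → c.Covers p i b → c.Covers q b m →
      SplitAt (Sum.inr j) b j
  | ident {j a b x} : c.elem j = .ident a → SplitAt a b x → SplitAt (Sum.inr j) b x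
  | left {j p q i s m b x} : c.elem j = .binary p q → c.Covers p i s → c.Covers q s m →
      b < s → SplitAt p b x → SplitAt (Sum.inr j) b x
  | right {j p q i s m b x} : c.elem j = .binary p q → c.Covers p i s → c.Covers q s m →
      s < b → SplitAt q b x → SplitAt (Sum.inr j) b x

namespace SplitAt

variable {v : c.Vertex} {b b' i m lo hi : ℕ} {x y : Fin c.size}

lemma exists_of_covers (h : c.Covers v lo hi) (h1 : lo < b) (h2 : b < hi) :
    ∃ x, c.SplitAt v b x := by
  induction v using vertex_induction generalizing lo hi with
  | inl a => rw [covers_inl] at h; omega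
  | ident j a hj ih =>
    obtain ⟨x, hx⟩ := ih ((covers_ident hj).1 h) h1 h2
    exact ⟨x, .ident hj hx⟩
  | binary j p q hj ih1 ih2 =>
    obtain ⟨s, hp, hq⟩ := (covers_binary hj).1 h
    rcases lt_trichotomy b s with h' | rfl | h'
    · obtain ⟨x, hx⟩ := ih1 hp h1 h'
      exact ⟨x, .left hj hp hq h' hx⟩
    · exact ⟨j, .here hj hp hq⟩
    · obtain ⟨x, hx⟩ := ih2 hq h' h2
      exact ⟨x, .right hj hp hq h' hx⟩

lemma ident_iff {j : Fin c.size} {a : c.Vertex} (hj : c.elem j = .ident a) :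
    c.SplitAt (Sum.inr j) b x ↔ c.SplitAt a b x := by
  constructor
  · intro h
    cases h with
    | here h => rw [hj] at h; cases h
    | ident h h' => rw [hj] at h; cases h; exact h'
    | left h => rw [hj] at h; cases h
    | right h => rw [hj] at h; cases h
  · exact .ident hj

lemma binary_iff {j : Fin c.size} {p q : c.Vertex} {s : ℕ} (hj : c.elem j = .binary p q)
    (hp : c.Covers p i s) (hq : c.Covers q s m) :
    c.SplitAt (Sum.inr j) b x ↔ (b = s ∧ x = j) ∨ (b < s ∧ c.SplitAt p b x) ∨
      (s < b ∧ c.SplitAt q b x) := by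
  constructor
  · intro h
    cases h with
    | here h h1 h2 => rw [hj] at h; cases h; exact Or.inl ⟨(h1.unique hp).2, rfl⟩
    | ident h h' => rw [hj] at h; cases h
    | left h h1 h2 h3 h4 =>
      rw [hj] at h; cases h
      obtain ⟨-, rfl⟩ := h1.unique hp
      exact Or.inr (Or.inl ⟨h3, h4⟩)
    | right h h1 h2 h3 h4 =>
      rw [hj] at h; cases h
      obtain ⟨-, rfl⟩ := h1.unique hp
      exact Or.inr (Or.inr ⟨h3, h4⟩)
  · rintro (⟨rfl, rfl⟩ | ⟨h1, h2⟩ | ⟨h1, h2⟩)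
    · exact .here hj hp hq
    · exact .left hj hp hq h1 h2
    · exact .right hj hp hq h1 h2

lemma unique (h : c.SplitAt v b x) (h' : c.SplitAt v b y) : x = y := by
  induction h with
  | here hj hp hq => rcases (binary_iff hj hp hq).1 h' with h | h | h <;> [exact h.2.symm; omega; omega]
  | ident hj _ ih => exact ih ((ident_iff hj).1 h')
  | left hj hp hq hb _ ih =>
    rcases (binary_iff hj hp hq).1 h' with h | h | h <;> [omega; exact ih h.2; omega]
  | right hj hp hq hb _ ih =>
    rcases (binary_iff hj hp hq).1 h' with h | h | h <;> [omega; omega; exact ih h.2]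

lemma spec (h : c.SplitAt v b x) :
    ∃ p q i m, c.elem x = .binary p q ∧ c.Covers p i b ∧ c.Covers q b m := by
  induction h with
  | here hj hp hq => exact ⟨_, _, _, _, hj, hp, hq⟩
  | ident _ _ ih => exact ih
  | left _ _ _ _ _ ih => exact ih
  | right _ _ _ _ _ ih => exact ih

lemma exists_covers (h : c.SplitAt v b x) :
    ∃ i m, c.Covers (Sum.inr x) i m ∧ i < b ∧ b < m := by
  obtain ⟨p, q, i, m, hx, hp, hq⟩ := h.spec
  exact ⟨i, m, (covers_binary hx).2 ⟨b, hp, hq⟩, hp.lt, hq.lt⟩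

lemma between (h : c.SplitAt v b x) (hx : c.Covers (Sum.inr x) i m) : i < b ∧ b < m := by
  obtain ⟨i', m', hx', h1⟩ := h.exists_covers
  obtain ⟨rfl, rfl⟩ := hx.unique hx'
  exact h1

lemma split_unique {w : c.Vertex} (h : c.SplitAt v b x) (h' : c.SplitAt w b' x) : b = b' := by
  obtain ⟨p, q, i, m, hx, hp, hq⟩ := h.spec
  obtain ⟨p', q', i', m', hx', hp', hq'⟩ := h'.spec
  rw [hx] at hx'; cases hx'
  exact (hp.unique hp').2

lemma covers_subset (h : c.SplitAt v b x) (hv : c.Covers v lo hi)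
    (hx : c.Covers (Sum.inr x) i m) : lo ≤ i ∧ m ≤ hi := by
  induction h generalizing lo hi with
  | here hj hp hq => obtain ⟨rfl, rfl⟩ := hv.unique hx; exact ⟨le_rfl, le_rfl⟩
  | ident hj _ ih => exact ih ((covers_ident hj).1 hv) hx
  | left hj hp hq hb _ ih =>
    obtain ⟨rfl, rfl⟩ := hv.unique ((covers_binary hj).2 ⟨_, hp, hq⟩)
    have := ih hp hx
    exact ⟨this.1, this.2.trans hq.lt.le⟩
  | right hj hp hq hb _ ih =>
    obtain ⟨rfl, rfl⟩ := hv.unique ((covers_binary hj).2 ⟨_, hp, hq⟩)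
    have := ih hq hx
    exact ⟨hp.lt.le.trans this.1, this.2⟩

lemma depth_le (h : c.SplitAt v b x) : c.vertexDepth (Sum.inr x) ≤ c.vertexDepth v := by
  induction h with
  | here => exact le_rfl
  | ident hj _ ih => rw [vertexDepth_ident hj]; omega
  | left hj _ _ _ _ ih => rw [vertexDepth_binary hj]; omega
  | right hj _ _ _ _ ih => rw [vertexDepth_binary hj]; omega

lemma depth_lt_of_ne (h : c.SplitAt (Sum.inr y) b x) (hxy : x ≠ y) :
    c.vertexDepth (Sum.inr x) < c.vertexDepth (Sum.inr y) := by
  cases h with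
  | here => exact absurd rfl hxy
  | ident hj h => rw [vertexDepth_ident hj]; have := h.depth_le; omega
  | left hj _ _ _ h => rw [vertexDepth_binary hj]; have := h.depth_le; omega
  | right hj _ _ _ h => rw [vertexDepth_binary hj]; have := h.depth_le; omega

/-- The unfolding of an element of the unfolding of `v` is a part of the latter. -/
lemma restrict (h : c.SplitAt v b x) (hx : c.Covers (Sum.inr x) i m) (h1 : i < b') (h2 : b' < m)
    (hy : c.SplitAt v b' y) : c.SplitAt (Sum.inr x) b' y := by
  induction h with
  | here => exact hy
  | ident hj _ ih => exact ih hx ((ident_iff hj).1 hy)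
  | left hj hp hq hb h ih =>
    have := h.covers_subset hp hx
    rcases (binary_iff hj hp hq).1 hy with h | h | h <;> [omega; exact ih hx h.2; omega]
  | right hj hp hq hb h ih =>
    have := h.covers_subset hq hx
    rcases (binary_iff hj hp hq).1 hy with h | h | h <;> [omega; omega; exact ih hx h.2]

lemma depth_le_of_covers (h : c.SplitAt v b x) (hx : c.Covers (Sum.inr x) i m) (h1 : i < b')
    (h2 : b' < m) (hy : c.SplitAt v b' y) :
    c.vertexDepth (Sum.inr y) ≤ c.vertexDepth (Sum.inr x) :=
  (h.restrict hx h1 h2 hy).depth_le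

lemma depth_lt_of_covers (h : c.SplitAt v b x) (hx : c.Covers (Sum.inr x) i m) (h1 : i < b')
    (h2 : b' < m) (hb : b' ≠ b) (hy : c.SplitAt v b' y) :
    c.vertexDepth (Sum.inr y) < c.vertexDepth (Sum.inr x) :=
  (h.restrict hx h1 h2 hy).depth_lt_of_ne fun e => hb (by subst e; exact hy.split_unique h)

/-- The end of the interval of `x` is split by a binary element whose left argument has `x` at its
right edge, hence by a deeper one. -/
lemma depth_lt_of_end (h : c.SplitAt v b x) (hx : c.Covers (Sum.inr x) i m)
    (hv : c.Covers v lo hi) (hm : m < hi) (hy : c.SplitAt v m y) :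
    c.vertexDepth (Sum.inr x) < c.vertexDepth (Sum.inr y) := by
  induction h generalizing lo hi with
  | here => have := hv.unique hx; omega
  | ident hj _ ih => exact ih hx ((covers_ident hj).1 hv) hm ((ident_iff hj).1 hy)
  | left hj hp hq hb h ih =>
    have h1 := h.covers_subset hp hx
    rcases (binary_iff hj hp hq).1 hy with h2 | h2 | h2
    · obtain ⟨-, rfl⟩ := h2
      rw [vertexDepth_binary hj]
      have := h.depth_le
      omega
    · exact ih hx hp h2.1 h2.2
    · omega
  | right hj hp hq hb h ih =>
    have h1 := h.covers_subset hq hx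
    have h3 := h.between hx
    obtain ⟨rfl, rfl⟩ := hv.unique ((covers_binary hj).2 ⟨_, hp, hq⟩)
    rcases (binary_iff hj hp hq).1 hy with h2 | h2 | h2 <;> [omega; omega; exact ih hx hq hm h2.2]

/-- Elements of the unfolding that begin at the same position are nested. -/
lemma chain {i m m' : ℕ} (h : c.SplitAt v b x) (h' : c.SplitAt v b' y)
    (hx : c.Covers (Sum.inr x) i m) (hy : c.Covers (Sum.inr y) i m') (hb : b < b') :
    m ≤ b' ∧ c.vertexDepth (Sum.inr x) < c.vertexDepth (Sum.inr y) := by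
  have h1 := h.between hx
  have h2 := h'.between hy
  refine ⟨?_, h'.depth_lt_of_covers hy h1.1 (hb.trans h2.2) hb.ne h⟩
  by_contra hm
  push Not at hm
  have h3 := h.restrict hx h2.1 hm h'
  obtain ⟨p, q, i', m'', hj, hp, hq⟩ := h.spec
  rcases (binary_iff hj hp hq).1 h3 with h4 | h4 | h4
  · omega
  · omega
  · have := h4.2.covers_subset hq hy
    omega

end SplitAt

/-- `v` is a copy of `w`: a chain of identity elements leads from `w` to `v`. -/
def IsCopy (c : PrefixCircuit N) : c.Vertex → c.Vertex → Prop :=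
  Relation.ReflTransGen fun v w => ∃ j, v = Sum.inr j ∧ c.elem j = .ident w

lemma IsCopy.covers_iff {v w : c.Vertex} (h : c.IsCopy v w) {i m : ℕ} :
    c.Covers v i m ↔ c.Covers w i m := by
  induction h with
  | refl => rfl
  | tail _ h ih =>
    obtain ⟨j, rfl, hj⟩ := h
    rw [ih, covers_ident hj]

lemma IsCopy.depth_le {v w : c.Vertex} (h : c.IsCopy v w) :
    c.vertexDepth w ≤ c.vertexDepth v := by
  induction h with
  | refl => rfl
  | tail _ h ih =>
    obtain ⟨j, rfl, hj⟩ := h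
    rw [vertexDepth_ident hj] at ih
    omega

lemma IsCopy.splitAt {v w : c.Vertex} (h : c.IsCopy v w) {b : ℕ} {x : Fin c.size}
    (hx : c.SplitAt w b x) : c.SplitAt v b x := by
  induction h with
  | refl => exact hx
  | tail _ h ih =>
    obtain ⟨j, rfl, hj⟩ := h
    exact ih (.ident hj hx)

lemma exists_isCopy {v : c.Vertex} {i m : ℕ} (hv : c.Covers v i m) (hm : i + 1 < m) :
    ∃ j s, c.IsCopy v (Sum.inr j) ∧ c.SplitAt (Sum.inr j) s j := by
  induction v using vertex_induction with
  | inl a => rw [covers_inl] at hv; omega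
  | ident j a hj ih =>
    obtain ⟨x, s, h1, h2⟩ := ih ((covers_ident hj).1 hv)
    exact ⟨x, s, .head ⟨j, rfl, hj⟩ h1, h2⟩
  | binary j p q hj ih1 ih2 =>
    obtain ⟨s, hp, hq⟩ := (covers_binary hj).1 hv
    exact ⟨j, s, .refl, .here hj hp hq⟩

lemma vertexDepth_out_le (i : Fin N) : c.vertexDepth (c.out i) ≤ c.depth :=
  le_sup (f := fun i => c.vertexDepth (c.out i)) (mem_univ i)

end PrefixCircuit

/-! ### Snir's inequality and the shape of optimal circuits -/

namespace PrefixCircuit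

variable {N : ℕ} {c : PrefixCircuit N}

/-- The element is binary. -/
def Binary (c : PrefixCircuit N) (x : Fin c.size) : Prop := ∃ p q, c.elem x = .binary p q

lemma binary_iff_isBinary {x : Fin c.size} : c.Binary x ↔ (c.elt x).isBinary = true := by
  rw [← isBinary_elem]
  unfold Binary
  cases c.elem x <;> simp [CircuitElement.isBinary]

lemma SplitAt.binary {v : c.Vertex} {b : ℕ} {x : Fin c.size} (h : c.SplitAt v b x) :
    c.Binary x := by
  obtain ⟨p, q, i, m, hx, -⟩ := h.spec
  exact ⟨p, q, hx⟩

lemma Binary.depth_pos {x : Fin c.size} (h : c.Binary x) : 1 ≤ c.vertexDepth (Sum.inr x) := by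
  obtain ⟨p, q, hx⟩ := h
  rw [vertexDepth_binary hx]; omega

/-- The element occurs in the formula obtained by unfolding `v`. -/
def Occurs (c : PrefixCircuit N) (v : c.Vertex) (x : Fin c.size) : Prop := ∃ b, c.SplitAt v b x

open Classical in
/-- The binary elements of the unfolding of `v`. -/
noncomputable def occurring (c : PrefixCircuit N) (v : c.Vertex) : Finset (Fin c.size) :=
  {x | c.Occurs v x}

open Classical in
/-- The binary elements of the unfolding of `v` that compute prefix sums. -/
noncomputable def spine (c : PrefixCircuit N) (v : c.Vertex) : Finset (Fin c.size) :=
  {x | c.Occurs v x ∧ ∃ m, c.Covers (Sum.inr x) 0 m}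

lemma mem_occurring {v : c.Vertex} {x : Fin c.size} : x ∈ c.occurring v ↔ c.Occurs v x := by
  simp [occurring]

lemma mem_spine {v : c.Vertex} {x : Fin c.size} :
    x ∈ c.spine v ↔ c.Occurs v x ∧ ∃ m, c.Covers (Sum.inr x) 0 m := by
  simp [spine]

/-- Every interior position is split by exactly one element, and an element occurs with only one
split position, so the occurring elements correspond to the m - 1 interior positions. -/
lemma card_occurring {v : c.Vertex} {m : ℕ} (hv : c.Covers v 0 m) :
    #(c.occurring v) = m - 1 := by
  have hex : ∀ b ∈ Ico 1 m, ∃ x, c.SplitAt v b x := fun b hb => by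
    rw [mem_Ico] at hb
    exact SplitAt.exists_of_covers hv (by omega) (by omega)
  choose g hg using hex
  have : c.occurring v = (Ico 1 m).attach.image fun b => g b.1 b.2 := by
    ext x
    simp only [mem_occurring, mem_image, mem_attach, true_and, Subtype.exists]
    constructor
    · rintro ⟨b, hb⟩
      obtain ⟨i, s, hx, h1⟩ := hb.exists_covers
      have := hb.covers_subset hv hx
      have hbm : b ∈ Ico 1 m := by rw [mem_Ico]; omega
      exact ⟨b, hbm, (hg b hbm).unique hb⟩
    · rintro ⟨b, hb, rfl⟩
      exact ⟨b, hg b hb⟩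
  rw [this, card_image_of_injective, card_attach, Nat.card_Ico]
  rintro ⟨b, hb⟩ ⟨b', hb'⟩ h
  simp only at h
  have h1 := hg b hb
  rw [h] at h1
  exact Subtype.ext (h1.split_unique (hg b' hb'))

/-- Elements of the spine are ordered by depth as by the prefix sums that they compute. -/
lemma spine_lt {v : c.Vertex} {x y : Fin c.size} {m m' : ℕ} (hx : c.Occurs v x)
    (hy : c.Occurs v y) (hxm : c.Covers (Sum.inr x) 0 m) (hym : c.Covers (Sum.inr y) 0 m')
    (h : c.vertexDepth (Sum.inr x) < c.vertexDepth (Sum.inr y)) : m < m' := by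
  obtain ⟨b, hb⟩ := hx
  obtain ⟨b', hb'⟩ := hy
  rcases lt_trichotomy b b' with h' | rfl | h'
  · have := (hb.chain hb' hxm hym h').1
    have := hb'.between hym
    omega
  · rw [hb.unique hb'] at h; omega
  · have := (hb'.chain hb hym hxm h').2
    omega

/-- Elements of one formula that begin at the first input are nested by `SplitAt.chain`, so distinct
ones have different depths. -/
lemma spine_injOn (v : c.Vertex) :
    Set.InjOn (fun x => c.vertexDepth (Sum.inr x)) (c.spine v : Set (Fin c.size)) := by
  intro x hx y hy h
  obtain ⟨⟨b, hb⟩, m, hxm⟩ := mem_spine.1 hx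
  obtain ⟨⟨b', hb'⟩, m', hym⟩ := mem_spine.1 hy
  simp only at h
  rcases lt_trichotomy b b' with h' | rfl | h'
  · have := (hb.chain hb' hxm hym h').2; omega
  · exact hb.unique hb'
  · have := (hb'.chain hb hym hxm h').2; omega

lemma spine_mapsTo (i : Fin N) :
    (c.spine (c.out i)).image (fun x => c.vertexDepth (Sum.inr x)) ⊆ Icc 1 c.depth := by
  intro t ht
  rw [mem_image] at ht
  obtain ⟨x, hx, rfl⟩ := ht
  obtain ⟨⟨b, hb⟩, m, hxm⟩ := mem_spine.1 hx
  exact mem_Icc.2 ⟨hb.binary.depth_pos, hb.depth_le.trans (vertexDepth_out_le i)⟩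

lemma card_spine_le (i : Fin N) : #(c.spine (c.out i)) ≤ c.depth := by
  rw [← card_image_of_injOn (spine_injOn (c.out i))]
  exact (card_le_card (spine_mapsTo i)).trans (by simp)

/-- Binary elements of which the outputs with at least two summands are copies. -/
lemma ComputesPrefixSums.exists_copied (hc : c.ComputesPrefixSums) :
    ∃ B : Finset (Fin c.size), #B = N - 1 ∧ ∀ x ∈ B, c.Binary x ∧
      ∃ i : Fin N, c.IsCopy (c.out i) (Sum.inr x) ∧ c.Covers (Sum.inr x) 0 (i + 1) := by
  have hex : ∀ j : Fin (N - 1), ∃ x, c.Binary x ∧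
      ∃ h : j.val + 1 < N, c.IsCopy (c.out ⟨j.val + 1, h⟩) (Sum.inr x) := fun j => by
    have h : j.val + 1 < N := by omega
    obtain ⟨x, s, h1, h2⟩ := exists_isCopy (hc.covers_out ⟨j.val + 1, h⟩) (by simp)
    exact ⟨x, h2.binary, h, h1⟩
  choose β hβ h hcopy using hex
  have hcov : ∀ j, c.Covers (Sum.inr (β j)) 0 (j.val + 2) := fun j =>
    (hcopy j).covers_iff.1 (hc.covers_out _)
  refine ⟨univ.image β, ?_, ?_⟩
  · rw [card_image_of_injective, card_univ, Fintype.card_fin]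
    intro j j' hj
    have h1 := hcov j
    rw [hj] at h1
    have := (h1.unique (hcov j')).2
    exact Fin.ext (by omega)
  · intro x hx
    rw [mem_image] at hx
    obtain ⟨j, -, rfl⟩ := hx
    exact ⟨hβ j, ⟨j.val + 1, h j⟩, hcopy j, hcov j⟩

lemma complexity_eq (c : PrefixCircuit N) [DecidablePred c.Binary] :
    c.complexity = #{x | c.Binary x} := by
  unfold complexity
  congr 1
  ext x
  simp [binary_iff_isBinary]

/-- **Snir's inequality**: prefix circuits satisfy `C + D ≥ 2 N - 2`. -/
lemma ComputesPrefixSums.le_complexity_add_depth (hc : c.ComputesPrefixSums) :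
    2 * N ≤ c.complexity + c.depth + 2 := by
  classical
  rcases Nat.eq_zero_or_pos N with h0 | h0
  · omega
  let l : Fin N := ⟨N - 1, by omega⟩
  have hl := hc.covers_out l
  obtain ⟨B, hB, hBx⟩ := hc.exists_copied
  have h1 := card_occurring hl
  have h2 := card_spine_le (c := c) l
  -- The doubly counted elements compute prefix sums within the formula, so there are at most as
  -- many as the depth.
  have h3 : c.occurring (c.out l) ∩ B ⊆ c.spine (c.out l) := by
    intro x hx
    rw [mem_inter, mem_occurring] at hx
    obtain ⟨-, i, -, hi⟩ := hBx x hx.2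
    exact mem_spine.2 ⟨hx.1, _, hi⟩
  have h4 : c.occurring (c.out l) ∪ B ⊆ ({x | c.Binary x} : Finset (Fin c.size)) := by
    intro x hx
    rw [mem_union, mem_occurring] at hx
    rw [mem_filter]
    rcases hx with ⟨b, hb⟩ | hx
    · exact ⟨mem_univ _, hb.binary⟩
    · exact ⟨mem_univ _, (hBx x hx).1⟩
  have h5 := card_union_add_card_inter (c.occurring (c.out l)) B
  have h6 := card_le_card h3
  have h7 := card_le_card h4
  rw [← complexity_eq] at h7
  have : l.val = N - 1 := rfl
  omega

/-- The structure of optimal prefix circuits. -/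
lemma IsOptimal.structure (hc : c.IsOptimal) (l : Fin N) (hl : l.val + 1 = N) :
    (∀ x, c.Binary x → c.Occurs (c.out l) x ∨ ∃ m, c.Covers (Sum.inr x) 0 m) ∧
    (∀ x, c.Binary x → ∀ i : Fin N, c.Covers (Sum.inr x) 0 (i + 1) →
      c.IsCopy (c.out i) (Sum.inr x)) ∧
    (∀ x y m, c.Binary x → c.Binary y → c.Covers (Sum.inr x) 0 m → c.Covers (Sum.inr y) 0 m →
      x = y) ∧
    (∀ t, 1 ≤ t → t ≤ c.depth → ∃ x ∈ c.spine (c.out l), c.vertexDepth (Sum.inr x) = t) ∧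
    #(c.spine (c.out l)) = c.depth := by
  classical
  have hcov := hc.1.covers_out l
  obtain ⟨B, hB, hBx⟩ := hc.1.exists_copied
  have h1 := card_occurring hcov
  have h2 := card_spine_le (c := c) l
  have h3 : c.occurring (c.out l) ∩ B ⊆ c.spine (c.out l) := by
    intro x hx
    rw [mem_inter, mem_occurring] at hx
    obtain ⟨-, i, -, hi⟩ := hBx x hx.2
    exact mem_spine.2 ⟨hx.1, _, hi⟩
  have h4 : c.occurring (c.out l) ∪ B ⊆ ({x | c.Binary x} : Finset (Fin c.size)) := by
    intro x hx
    rw [mem_union, mem_occurring] at hx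
    rw [mem_filter]
    rcases hx with ⟨b, hb⟩ | hx
    · exact ⟨mem_univ _, hb.binary⟩
    · exact ⟨mem_univ _, (hBx x hx).1⟩
  have h5 := card_union_add_card_inter (c.occurring (c.out l)) B
  have h6 := card_le_card h3
  have h7 := card_le_card h4
  have hopt := hc.2
  rw [complexity_eq] at hopt
  -- Optimality leaves no slack in the count, so both inclusions in Snir's argument are equalities.
  have e1 := eq_of_subset_of_card_le h3 (by omega)
  have e2 := eq_of_subset_of_card_le h4 (by omega)
  have hmem : ∀ x, c.Binary x → x ∈ c.occurring (c.out l) ∨ x ∈ B := fun x hx => by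
    rw [← mem_union, e2, mem_filter]; exact ⟨mem_univ _, hx⟩
  have hB' : ∀ x, c.Binary x → ∀ m, c.Covers (Sum.inr x) 0 m → x ∈ B := fun x hx m hm => by
    rcases hmem x hx with h | h
    · have : x ∈ c.spine (c.out l) := mem_spine.2 ⟨mem_occurring.1 h, m, hm⟩
      rw [← e1] at this
      exact (mem_inter.1 this).2
    · exact h
  have hBi : ∀ x, c.Binary x → ∀ i : Fin N, c.Covers (Sum.inr x) 0 (i + 1) →
      c.IsCopy (c.out i) (Sum.inr x) := fun x hx i hi => by
    obtain ⟨-, j, hj, hj'⟩ := hBx x (hB' x hx _ hi)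
    have := (hi.unique hj').2
    obtain rfl : i = j := Fin.ext (by omega)
    exact hj
  have hS : #(c.spine (c.out l)) = c.depth := by omega
  refine ⟨fun x hx => ?_, hBi, fun x y m hx hy hxm hym => ?_, fun t h1 h2 => ?_, hS⟩
  · rcases hmem x hx with h | h
    · exact Or.inl (mem_occurring.1 h)
    · obtain ⟨-, j, -, hj⟩ := hBx x h
      exact Or.inr ⟨_, hj⟩
  · have hm := hxm.lt
    have hm' := hxm.le
    let i : Fin N := ⟨m - 1, by omega⟩
    have hi : i.val + 1 = m := by change m - 1 + 1 = m; omega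
    rw [← hi] at hxm hym
    have h1 := hBi x hx i hxm
    have h2 := hBi y hy i hym
    obtain ⟨p, q, hx⟩ := hx
    obtain ⟨p', q', hy⟩ := hy
    have key : ∀ {x y : Fin c.size} {p q : c.Vertex}, c.elem x = .binary p q →
        c.IsCopy (Sum.inr x) (Sum.inr y) → x = y := by
      intro x y p q hx h
      rcases Relation.ReflTransGen.cases_head h with h | ⟨w, ⟨j, hj, hw⟩, -⟩
      · exact Sum.inr_injective h
      · obtain rfl := Sum.inr_injective hj
        rw [hx] at hw; cases hw
    -- Both elements are reached from one output by following identity elements backwards, a unique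
    -- path. It stops at the first binary element, so they agree.
    rcases Relation.ReflTransGen.total_of_right_unique (fun v w w' h h' => by
      obtain ⟨j, rfl, hj⟩ := h
      obtain ⟨j', hj', hj''⟩ := h'
      obtain rfl := Sum.inr_injective hj'
      rw [hj] at hj''; cases hj''; rfl) h1 h2 with h | h
    · exact key hx h
    · exact (key hy h).symm
  · have h3 : (c.spine (c.out l)).image (fun x => c.vertexDepth (Sum.inr x)) = Icc 1 c.depth := by
      refine eq_of_subset_of_card_le (spine_mapsTo l) ?_
      rw [card_image_of_injOn (spine_injOn _), hS]; simp
    have h4 : t ∈ Icc 1 c.depth := mem_Icc.2 ⟨h1, h2⟩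
    rw [← h3, mem_image] at h4
    exact h4

end PrefixCircuit

/-- Links the Boolean equality used by `List.count` in `fanOut` with genuine equality. -/
lemma Sum.lawfulBEq {α β : Type} [BEq α] [BEq β] [LawfulBEq α] [LawfulBEq β] :
    LawfulBEq (α ⊕ β) where
  eq_of_beq {a b} h := by
    rcases a with a | a <;> rcases b with b | b
    · exact congrArg _ (eq_of_beq (α := α) h)
    · cases h
    · cases h
    · exact congrArg _ (eq_of_beq (α := β) h)
  rfl {a} := by
    rcases a with a | a
    · exact BEq.refl (α := α) a
    · exact BEq.refl (α := β) a

/-! ### The carrier forest of an optimal circuit -/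

namespace PrefixCircuit

variable {N : ℕ} {c : PrefixCircuit N}

lemma exists_covers_of_structure {v : c.Vertex}
    (h : ∀ x, c.Binary x → ∃ i m, c.Covers (Sum.inr x) i m) : ∃ i m, c.Covers v i m := by
  induction v using vertex_induction with
  | inl a => exact ⟨_, _, covers_inl.2 ⟨rfl, rfl⟩⟩
  | ident j a hj ih =>
    obtain ⟨i, m, hi⟩ := ih
    exact ⟨i, m, (covers_ident hj).2 hi⟩
  | binary j p q hj _ _ => exact h j ⟨p, q, hj⟩

/-- The element `e` carries the prefix argument of `x`: either `x` is an identity element, or it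
computes a prefix sum and is not on the spine. -/
def Feeds (c : PrefixCircuit N) (v : c.Vertex) (e x : Fin c.size) : Prop :=
  c.elem x = .ident (Sum.inr e) ∨
    (x ∉ c.spine v ∧ ∃ q m, c.elem x = .binary (Sum.inr e) q ∧ c.Covers (Sum.inr x) 0 m)

lemma Feeds.unique {v : c.Vertex} {e e' x : Fin c.size} (h : c.Feeds v e x)
    (h' : c.Feeds v e' x) : e = e' := by
  rcases h with h | ⟨-, q, m, h, -⟩ <;> rcases h' with h' | ⟨-, q', m', h', -⟩ <;>
    simp_all

open Classical in
/-- The carrier of the prefix argument of `x`. -/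
noncomputable def parent (c : PrefixCircuit N) (v : c.Vertex) (x : Fin c.size) :
    Option (Fin c.size) :=
  if h : ∃ e, c.Feeds v e x then some h.choose else none

lemma parent_eq_some {v : c.Vertex} {e x : Fin c.size} :
    c.parent v x = some e ↔ c.Feeds v e x := by
  unfold parent
  split_ifs with h
  · rw [Option.some.injEq]
    exact ⟨fun h' => h' ▸ h.choose_spec, fun h' => h.choose_spec.unique h'⟩
  · simp only [false_iff]
    exact fun h' => h ⟨e, h'⟩

lemma Feeds.lt {v : c.Vertex} {e x : Fin c.size} (h : c.Feeds v e x) : e < x := by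
  have : c.rank (Sum.inr e) < c.rank (Sum.inr x) := by
    rcases h with h | ⟨-, q, m, h, -⟩
    · exact rank_ident h
    · exact rank_left h
  simp only [rank, Sum.elim_inr] at this
  exact Fin.lt_def.2 (by omega)

lemma Feeds.depth_lt {v : c.Vertex} {e x : Fin c.size} (h : c.Feeds v e x) :
    c.vertexDepth (Sum.inr e) < c.vertexDepth (Sum.inr x) := by
  rcases h with h | ⟨-, q, m, h, -⟩
  · rw [vertexDepth_ident h]; omega
  · rw [vertexDepth_binary h]; omega

lemma Feeds.mem_args {v : c.Vertex} {e x : Fin c.size} (h : c.Feeds v e x) :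
    Sum.inr e ∈ c.argVertices x := by
  rw [argVertices_eq]
  rcases h with h | ⟨-, q, m, h, -⟩ <;> simp [h, CircuitElement.args]

open Classical in
lemma card_feeds_add_le (v : c.Vertex) (e : Fin c.size) :
    #{x | c.parent v x = some e} + #{i | c.out i = Sum.inr e} ≤ c.fanOut (Sum.inr e) := by
  unfold fanOut
  have : #{x | c.parent v x = some e} ≤ ∑ x, (c.argVertices x).count (Sum.inr e) := by
    rw [card_filter]
    refine sum_le_sum fun x _ => ?_
    split_ifs with h
    · have := Sum.lawfulBEq (α := Fin N) (β := Fin c.size)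
      exact List.count_pos_iff.2 (parent_eq_some.1 h).mem_args
    · exact Nat.zero_le _
  convert Nat.add_le_add_right this _

open Classical in
/-- One less than the depth of the element which splits the formula `v` at the position `m`. -/
noncomputable def label (c : PrefixCircuit N) (v : c.Vertex) (m : ℕ) : ℕ :=
  if h : ∃ x, c.SplitAt v m x then c.vertexDepth (Sum.inr h.choose) - 1 else 0

lemma SplitAt.label_eq {v : c.Vertex} {m : ℕ} {x : Fin c.size} (h : c.SplitAt v m x) :
    c.label v m + 1 = c.vertexDepth (Sum.inr x) := by
  have h' : ∃ x, c.SplitAt v m x := ⟨x, h⟩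
  unfold label
  rw [dif_pos h', h'.choose_spec.unique h]
  have := h.binary.depth_pos
  omega

open Classical in
/-- The end of the interval computed by a vertex. -/
noncomputable def coverEnd (c : PrefixCircuit N) (v : c.Vertex) : ℕ :=
  if h : ∃ m i, c.Covers v i m then h.choose else 0

lemma Covers.coverEnd_eq {v : c.Vertex} {i m : ℕ} (h : c.Covers v i m) : c.coverEnd v = m := by
  have h' : ∃ m i, c.Covers v i m := ⟨m, i, h⟩
  unfold coverEnd
  rw [dif_pos h']
  obtain ⟨i', hi⟩ := h'.choose_spec
  exact (hi.unique h).2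

/-- The binary elements that compute prefix sums and are not on the spine. -/
def IsHead (c : PrefixCircuit N) (v : c.Vertex) (x : Fin c.size) : Prop :=
  c.Binary x ∧ x ∉ c.spine v ∧ ∃ m, c.Covers (Sum.inr x) 0 m

/-- Elements of which an output is a copy. -/
def IsFinal (c : PrefixCircuit N) (x : Fin c.size) : Prop := ∃ i, c.IsCopy (c.out i) (Sum.inr x)

lemma IsFinal.depth_le {x : Fin c.size} (hx : c.IsFinal x) : c.vertexDepth (Sum.inr x) ≤ c.depth := by
  obtain ⟨i, hi⟩ := hx
  exact hi.depth_le.trans (vertexDepth_out_le i)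

namespace IsOptimal

lemma covers_last (hc : c.IsOptimal) {l : Fin N} (hl : l.val + 1 = N)
    : c.Covers (c.out l) 0 N := by
  have := hc.1.covers_out l
  rwa [hl] at this

lemma exists_covers (hc : c.IsOptimal) {l : Fin N} (hl : l.val + 1 = N)
    (v : c.Vertex) : ∃ i m, c.Covers v i m := by
  refine exists_covers_of_structure fun x hx => ?_
  rcases (hc.structure l hl).1 x hx with ⟨b, hb⟩ | ⟨m, hm⟩
  · obtain ⟨i, m, h, -⟩ := hb.exists_covers
    exact ⟨i, m, h⟩
  · exact ⟨0, m, hm⟩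

lemma unique_binary (hc : c.IsOptimal) {l : Fin N} (hl : l.val + 1 = N)
    {x y : Fin c.size} {m : ℕ} (hx : c.Binary x) (hy : c.Binary y)
    (hxm : c.Covers (Sum.inr x) 0 m) (hym : c.Covers (Sum.inr y) 0 m) : x = y :=
  (hc.structure l hl).2.2.1 x y m hx hy hxm hym

lemma isFinal (hc : c.IsOptimal) {l : Fin N} (hl : l.val + 1 = N)
    {x : Fin c.size} {m : ℕ} (hx : c.Binary x) (hxm : c.Covers (Sum.inr x) 0 m) :
    c.IsFinal x := by
  have h1 := hxm.lt
  have h2 := hxm.le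
  have h3 : m - 1 + 1 = m := by omega
  exact ⟨⟨m - 1, by omega⟩, (hc.structure l hl).2.1 x hx _ (by simpa [h3] using hxm)⟩

/-- An element that does not begin at the first input computes no prefix sum, so optimality leaves
it only a place in the formula of the last output. This is how labels come to control the second
arguments of heads. -/
lemma occurs_of_covers_pos (hc : c.IsOptimal) {l : Fin N} (hl : l.val + 1 = N)
    {x : Fin c.size} {i m : ℕ} (hx : c.Binary x)
    (hxm : c.Covers (Sum.inr x) i m) (hi : 0 < i) : c.Occurs (c.out l) x := by
  rcases (hc.structure l hl).1 x hx with h | ⟨m', hm⟩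
  · exact h
  · have := (hxm.unique hm).1; omega

lemma exists_top (hc : c.IsOptimal) {l : Fin N} (hl : l.val + 1 = N)
    (hN : 2 ≤ N) : ∃ x ∈ c.spine (c.out l), c.Covers (Sum.inr x) 0 N := by
  have h := hc.covers_last hl
  obtain ⟨x, s, h1, h2⟩ := exists_isCopy h (by omega)
  have h3 := h1.covers_iff.1 h
  exact ⟨x, mem_spine.2 ⟨⟨s, h1.splitAt h2⟩, N, h3⟩, h3⟩

/-- The full sum is computed on the spine, and by only one binary element, so no head computes it.
-/
lemma coverEnd_lt (hc : c.IsOptimal) {l : Fin N} (hl : l.val + 1 = N)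
    {x : Fin c.size} {m : ℕ} (hx : c.IsHead (c.out l) x)
    (hxm : c.Covers (Sum.inr x) 0 m) : 2 ≤ m ∧ m < N := by
  obtain ⟨⟨p, q, hpq⟩, hs, -⟩ := hx
  obtain ⟨s, hp, hq⟩ := (covers_binary hpq).1 hxm
  have h1 := hp.lt
  have h2 := hq.lt
  have h3 := hxm.le
  refine ⟨by omega, lt_of_le_of_ne h3 ?_⟩
  rintro rfl
  obtain ⟨y, hy, hyN⟩ := hc.exists_top hl (by omega)
  obtain ⟨⟨b, hb⟩, -⟩ := mem_spine.1 hy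
  have := hc.unique_binary hl ⟨p, q, hpq⟩ hb.binary hxm hyN
  exact hs (this ▸ hy)

lemma exists_split (hc : c.IsOptimal) {l : Fin N} (hl : l.val + 1 = N)
    {m : ℕ} (h1 : 1 ≤ m) (h2 : m < N) : ∃ x, c.SplitAt (c.out l) m x :=
  SplitAt.exists_of_covers (hc.covers_last hl) h1 h2

/-- Positions inside the second argument have smaller labels. -/
lemma label_lt_of_covers (hc : c.IsOptimal) {l : Fin N} (hl : l.val + 1 = N)
    {q : c.Vertex} {i m m' : ℕ} (hq : c.Covers q i m) (hi : 0 < i)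
    (hm : m < N) (h1 : i < m') (h2 : m' < m) :
    c.label (c.out l) m' < c.label (c.out l) m := by
  -- The binary element `z` behind `q` lies in the formula of the last output; interior positions
  -- are split within `z`, the end of its interval strictly above `z`.
  obtain ⟨z, s, hz, hzs⟩ := exists_isCopy hq (by omega)
  have hzc := hz.covers_iff.1 hq
  obtain ⟨b, hb⟩ := hc.occurs_of_covers_pos hl hzs.binary hzc hi
  obtain ⟨y, hy⟩ := hc.exists_split hl (m := m') (by omega) (by omega)
  obtain ⟨y', hy'⟩ := hc.exists_split hl (m := m) (by omega) (by omega)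
  have h3 := hb.depth_le_of_covers hzc h1 h2 hy
  have h4 := hb.depth_lt_of_end hzc (hc.covers_last hl) hm hy'
  have h5 := hy.label_eq
  have h6 := hy'.label_eq
  omega

/-- The positions passed over by a head are interior to its second argument, which does not begin at
the first input; `label_lt_of_covers` applies. -/
lemma record (hc : c.IsOptimal) {l : Fin N} (hl : l.val + 1 = N)
    {e x : Fin c.size} {m' : ℕ} (h : c.Feeds (c.out l) e x)
    (hx : c.IsHead (c.out l) x) (h1 : c.coverEnd (Sum.inr e) < m')
    (h2 : m' < c.coverEnd (Sum.inr x)) :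
    c.label (c.out l) m' < c.label (c.out l) (c.coverEnd (Sum.inr x)) := by
  obtain ⟨m, hm⟩ := hx.2.2
  obtain ⟨p, q, hpq⟩ := hx.1
  rcases h with h | ⟨-, q', m'', h, -⟩
  · rw [hpq] at h; cases h
  · rw [hpq] at h; cases h
    obtain ⟨s, hp, hq⟩ := (covers_binary hpq).1 hm
    rw [hp.coverEnd_eq] at h1
    rw [hm.coverEnd_eq] at h2 ⊢
    exact hc.label_lt_of_covers hl hq hp.lt (hc.coverEnd_lt hl hx hm).2 h1 h2

/-- Let b be the end of the interval of the element that splits at m. Positions of the interval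
beyond m have smaller labels and b a larger one, so equality puts m' beyond b, and b separates the
two. -/
lemma separated (hc : c.IsOptimal) {l : Fin N} (hl : l.val + 1 = N)
    {m m' : ℕ} (h0 : 1 ≤ m) (h : m < m') (hm : m' < N)
    (he : c.label (c.out l) m' = c.label (c.out l) m) :
    ∃ s, m < s ∧ s < m' ∧ c.label (c.out l) m ≤ c.label (c.out l) s := by
  obtain ⟨x, hx⟩ := hc.exists_split hl (m := m) h0 (by omega)
  obtain ⟨x', hx'⟩ := hc.exists_split hl (m := m') (by omega) hm
  obtain ⟨i, b, hxb, h1, h2⟩ := hx.exists_covers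
  have h5 := hx.label_eq
  have h6 := hx'.label_eq
  rcases lt_trichotomy m' b with h' | rfl | h'
  · have := hx.depth_lt_of_covers hxb (by omega) h' (by omega) hx'
    omega
  · have := hx.depth_lt_of_end hxb (hc.covers_last hl) hm hx'
    omega
  · obtain ⟨y, hy⟩ := hc.exists_split hl (m := b) (by omega) (by omega)
    have := hx.depth_lt_of_end hxb (hc.covers_last hl) (by omega) hy
    have := hy.label_eq
    exact ⟨b, h2, h', by omega⟩

open Classical in
/-- The forest of carriers of an optimal prefix circuit. -/
noncomputable def forest (hc : c.IsOptimal) {l : Fin N} (hl : l.val + 1 = N)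
    {κ : ℕ} (hκ : 0 < κ) (hk : c.FanOutAtMost (κ + 1)) :
    CarrierForest c.size κ c.depth (c.depth + 1) where
  par := c.parent (c.out l)
  head := c.IsHead (c.out l)
  final := c.IsFinal
  hi x := c.coverEnd (Sum.inr x)
  dep x := c.vertexDepth (Sum.inr x)
  outputs e := #{i | c.out i = Sum.inr e}
  η := c.label (c.out l)
  κ_pos := hκ
  par_lt h := (parent_eq_some.1 h).lt
  dep_lt h := (parent_eq_some.1 h).depth_lt
  dep_le h := by
    obtain ⟨m, hm⟩ := h.2.2
    exact (hc.isFinal hl h.1 hm).depth_le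
  hi_eq {x e} h hx := by
    rcases parent_eq_some.1 h with h | ⟨hs, q, m, h, hm⟩
    · obtain ⟨i, m, hm⟩ := hc.exists_covers hl (Sum.inr x)
      rw [hm.coverEnd_eq, ((covers_ident h).1 hm).coverEnd_eq]
    · exact absurd ⟨⟨_, _, h⟩, hs, m, hm⟩ hx
  hi_lt {x e} h hx := by
    rcases parent_eq_some.1 h with h | ⟨hs, q, m, h, hm⟩
    · obtain ⟨p, q, hpq⟩ := hx.1
      rw [hpq] at h; cases h
    · obtain ⟨s, hp, hq⟩ := (covers_binary h).1 hm
      rw [hm.coverEnd_eq, hp.coverEnd_eq]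
      exact hq.lt
  record h hx m' h1 h2 := hc.record hl (parent_eq_some.1 h) hx h1 h2
  separated {x y} hx hy h he := by
    obtain ⟨m, hm⟩ := hx.2.2
    obtain ⟨m', hm'⟩ := hy.2.2
    simp only [hm.coverEnd_eq, hm'.coverEnd_eq] at h he ⊢
    exact hc.separated hl hm.lt h (hc.coverEnd_lt hl hy hm').2 he
  hi_inj {x y} hx hy h := by
    obtain ⟨m, hm⟩ := hx.2.2
    obtain ⟨m', hm'⟩ := hy.2.2
    rw [hm.coverEnd_eq, hm'.coverEnd_eq] at h
    subst h
    exact hc.unique_binary hl hx.1 hy.1 hm hm'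
  fanOut_le e := by
    refine le_trans ?_ (hk e)
    convert card_feeds_add_le (c.out l) e
  final_step {e} he := by
    obtain ⟨i, hi⟩ := he
    rcases Relation.ReflTransGen.cases_tail hi with h | ⟨w, hw, d, rfl, hd⟩
    · exact Or.inl (card_pos.2 ⟨i, by simp [h]⟩)
    · refine Or.inr ⟨d, parent_eq_some.2 (Or.inl hd), ?_, i, hw⟩
      rintro ⟨⟨p, q, hpq⟩, -⟩
      rw [hpq] at hd; cases hd
  final_of_head {x} hx := by
    obtain ⟨m, hm⟩ := hx.2.2
    exact hc.isFinal hl hx.1 hm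
  label_lt {x} hx := by
    obtain ⟨m, hm⟩ := hx.2.2
    rw [hm.coverEnd_eq]
    have h1 := hc.coverEnd_lt hl hx hm
    obtain ⟨y, hy⟩ := hc.exists_split hl (m := m) (by omega) h1.2
    have h2 := hy.label_eq
    have h3 := hy.depth_le
    have h4 := vertexDepth_out_le (c := c) l
    omega

end IsOptimal

end PrefixCircuit

/-! ### Heads between consecutive spine elements; the upper bound for the width -/

namespace PrefixCircuit

variable {N : ℕ} {c : PrefixCircuit N}

namespace IsOptimal

/-- Every head lies between two consecutive elements of the spine. -/
lemma exists_window (hc : c.IsOptimal) {l : Fin N} (hl : l.val + 1 = N) {x : Fin c.size} {m : ℕ}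
    (hx : c.IsHead (c.out l) x) (hm : c.Covers (Sum.inr x) 0 m) :
    ∃ r ∈ c.spine (c.out l), ∃ r' ∈ c.spine (c.out l), ∃ h h', c.Covers (Sum.inr r) 0 h ∧
      c.Covers (Sum.inr r') 0 h' ∧ h < m ∧ m < h' ∧
      c.vertexDepth (Sum.inr r') = c.vertexDepth (Sum.inr r) + 1 := by
  classical
  have hmN := hc.coverEnd_lt hl hx hm
  obtain ⟨-, -, -, hdep, -⟩ := hc.structure l hl
  have hne : ∀ r ∈ c.spine (c.out l), ∀ h, c.Covers (Sum.inr r) 0 h → h ≠ m := by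
    rintro r hr h hrh rfl
    obtain ⟨⟨b, hb⟩, -⟩ := mem_spine.1 hr
    exact hx.2.1 (hc.unique_binary hl hx.1 hb.binary hm hrh ▸ hr)
  obtain ⟨y, hy, hyN⟩ := hc.exists_top hl (by omega)
  have hyd : c.vertexDepth (Sum.inr y) ≤ c.depth :=
    (hc.isFinal hl (mem_spine.1 hy).1.choose_spec.binary hyN).depth_le
  -- The spine element of depth 1 sums the first two inputs, so every head has a spine element
  -- before it.
  obtain ⟨y₁, hy₁, hd₁⟩ := hdep 1 le_rfl
    ((mem_spine.1 hy).1.choose_spec.binary.depth_pos.trans hyd)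
  have hcov₁ : c.Covers (Sum.inr y₁) 0 2 := by
    obtain ⟨⟨b, hb⟩, m₁, hm₁⟩ := mem_spine.1 hy₁
    obtain ⟨p, q, hpq⟩ := hb.binary
    rw [vertexDepth_binary hpq] at hd₁
    obtain ⟨s, hp, hq⟩ := (covers_binary hpq).1 hm₁
    have key : ∀ {v : c.Vertex} {i j : ℕ}, c.vertexDepth v = 0 → c.Covers v i j → j = i + 1 := by
      intro v i j hv hij
      rcases v with a | a
      · rw [covers_inl] at hij; omega
      · cases ha : c.elem a with
        | ident a' => rw [vertexDepth_ident ha] at hv; omega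
        | binary a' b' => rw [vertexDepth_binary ha] at hv; omega
    have h1 := key (by omega) hp
    have h2 := key (by omega) hq
    have : m₁ = 2 := by omega
    exact this ▸ hm₁
  have h2m := hne y₁ hy₁ 2 hcov₁
  let S := (c.spine (c.out l)).filter fun r => ∃ h, c.Covers (Sum.inr r) 0 h ∧ h < m
  have hS : S.Nonempty := ⟨y₁, mem_filter.2 ⟨hy₁, 2, hcov₁, by omega⟩⟩
  obtain ⟨r, hrS, hmax⟩ := S.exists_max_image (fun r => c.vertexDepth (Sum.inr r)) hS
  obtain ⟨hr, h, hrh, hhm⟩ := mem_filter.1 hrS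
  have hry : c.vertexDepth (Sum.inr r) < c.vertexDepth (Sum.inr y) := by
    by_contra hcon
    rcases Nat.lt_or_eq_of_le (not_lt.1 hcon) with h' | h'
    · have := spine_lt (mem_spine.1 hy).1 (mem_spine.1 hr).1 hyN hrh h'
      omega
    · have := spine_injOn (c.out l) hy hr h'
      subst this
      have := (hyN.unique hrh).2
      omega
  obtain ⟨r', hr', hdr'⟩ := hdep (c.vertexDepth (Sum.inr r) + 1) (by omega) (by omega)
  obtain ⟨-, h', hrh'⟩ := mem_spine.1 hr'
  refine ⟨r, hr, r', hr', h, h', hrh, hrh', hhm, ?_, hdr'⟩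
  have h1 := hne r' hr' h' hrh'
  by_contra h2
  have := hmax r' (mem_filter.2 ⟨hr', h', hrh', by omega⟩)
  omega

/-- Labels between two consecutive elements of the spine. -/
lemma label_le_of_window (hc : c.IsOptimal) {l : Fin N} (hl : l.val + 1 = N) {r' : Fin c.size}
    {m h' : ℕ} (hr' : r' ∈ c.spine (c.out l)) (hrh' : c.Covers (Sum.inr r') 0 h') (h0 : 0 < m)
    (hm : m < h') : c.label (c.out l) m + 1 ≤ c.vertexDepth (Sum.inr r') := by
  obtain ⟨⟨b, hb⟩, -⟩ := mem_spine.1 hr'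
  obtain ⟨y, hy⟩ := hc.exists_split hl h0 (hm.trans_le hrh'.le)
  have h1 := hy.label_eq
  have h2 := hb.depth_le_of_covers hrh' h0 hm hy
  omega

/-- Carriers between two consecutive elements of the spine descend from the first one. -/
lemma descends (hc : c.IsOptimal) {l : Fin N} (hl : l.val + 1 = N) {κ : ℕ} (hκ : 0 < κ)
    (hk : c.FanOutAtMost (κ + 1)) {r r' : Fin c.size} {h h' : ℕ} (hr : r ∈ c.spine (c.out l))
    (hr' : r' ∈ c.spine (c.out l)) (hrh : c.Covers (Sum.inr r) 0 h)
    (hrh' : c.Covers (Sum.inr r') 0 h')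
    (hd : c.vertexDepth (Sum.inr r') = c.vertexDepth (Sum.inr r) + 1) (e : Fin c.size) :
    ∀ i, c.Covers (Sum.inr e) 0 i → h ≤ i → i < h' →
      Relation.ReflTransGen (hc.forest hl hκ hk).Rel r e := by
  obtain ⟨⟨b, hb⟩, -⟩ := mem_spine.1 hr
  have h2 : 2 ≤ h := by have := hb.between hrh; omega
  induction e using WellFoundedLT.induction with
  | ind e ih =>
  intro i hi h1i hi2
  cases he : c.elem e with
  | ident a =>
    have ha := (covers_ident he).1 hi
    rcases a with a | a
    · rw [covers_inl] at ha; omega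
    · have hf : c.Feeds (c.out l) a e := Or.inl he
      exact (ih a hf.lt i ha h1i hi2).tail (parent_eq_some.2 hf)
  | binary p q =>
    rcases h1i.eq_or_lt with rfl | h1i
    · rw [hc.unique_binary hl ⟨p, q, he⟩ hb.binary hi hrh]
    have hs : e ∉ c.spine (c.out l) := by
      intro hs
      rcases lt_trichotomy (c.vertexDepth (Sum.inr e)) (c.vertexDepth (Sum.inr r)) with h3 | h3 | h3
      · have := spine_lt (mem_spine.1 hs).1 (mem_spine.1 hr).1 hi hrh h3
        omega
      · have := spine_injOn (c.out l) hs hr h3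
        subst this
        have := (hi.unique hrh).2
        omega
      · rcases (Nat.succ_le_of_lt h3).eq_or_lt with h4 | h4
        · have := spine_injOn (c.out l) hr' hs (hd.trans h4)
          subst this
          have := (hi.unique hrh').2
          omega
        · have := spine_lt (mem_spine.1 hr').1 (mem_spine.1 hs).1 hrh' hi (by omega)
          omega
    obtain ⟨s, hp, hq⟩ := (covers_binary he).1 hi
    have hiN : i < N := hi2.trans_le hrh'.le
    -- Reaching back past h would make the label at i larger than that at h, which is at least the
    -- depth of `r`; but the labels in the window are at most that depth.
    have hsh : h ≤ s := by
      by_contra hsh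
      have h3 := hc.label_lt_of_covers hl hq hp.lt hiN (not_le.1 hsh) h1i
      have h4 := hc.label_le_of_window hl hr' hrh' (m := i) (by omega) hi2
      obtain ⟨y, hy⟩ := hc.exists_split hl (m := h) (by omega) (by omega)
      have h5 := hb.depth_lt_of_end hrh (hc.covers_last hl) (by omega) hy
      have h6 := hy.label_eq
      omega
    rcases p with a | a
    · rw [covers_inl] at hp; omega
    · have hf : c.Feeds (c.out l) a e := Or.inr ⟨hs, q, i, he, hi⟩
      exact (ih a hf.lt s hp hsh (hq.lt.trans hi2)).tail (parent_eq_some.2 hf)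

/-- `Feeds` gives spine elements no parent, so they are roots of the forest. -/
lemma eq_of_reflTransGen_spine (hc : c.IsOptimal) {l : Fin N} (hl : l.val + 1 = N) {κ : ℕ}
    (hκ : 0 < κ) (hk : c.FanOutAtMost (κ + 1)) {r e : Fin c.size} (hr : r ∈ c.spine (c.out l))
    (h : Relation.ReflTransGen (hc.forest hl hκ hk).Rel e r) : r = e := by
  rcases Relation.ReflTransGen.cases_tail h with h | ⟨z, -, hz⟩
  · exact h
  · have hz : c.parent (c.out l) r = some z := hz
    rcases parent_eq_some.1 hz with h | h
    · obtain ⟨p, q, hpq⟩ := (mem_spine.1 hr).1.choose_spec.binary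
      rw [hpq] at h; cases h
    · exact absurd hr h.1

/-- Every head descends from an element of the spine, and its label is bounded. -/
lemma exists_root (hc : c.IsOptimal) {l : Fin N} (hl : l.val + 1 = N) {κ : ℕ} (hκ : 0 < κ)
    (hk : c.FanOutAtMost (κ + 1)) {x : Fin c.size} (hx : c.IsHead (c.out l) x) :
    ∃ r ∈ c.spine (c.out l), x ∈ (hc.forest hl hκ hk).headsBelow r ∧
      c.label (c.out l) (c.coverEnd (Sum.inr x)) < c.vertexDepth (Sum.inr r) + 1 := by
  obtain ⟨m, hm⟩ := hx.2.2
  obtain ⟨r, hr, r', hr', h, h', hrh, hrh', h1, h2, hd⟩ := hc.exists_window hl hx hm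
  refine ⟨r, hr, CarrierForest.mem_headsBelow.2 ⟨hx, ?_⟩, ?_⟩
  · rcases Relation.reflTransGen_iff_eq_or_transGen.1
      (hc.descends hl hκ hk hr hr' hrh hrh' hd x m hm h1.le h2) with h3 | h3
    · exact absurd (h3 ▸ hr) hx.2.1
    · exact h3
  · rw [hm.coverEnd_eq]
    have := hc.label_le_of_window hl hr' hrh' hm.lt h2
    omega

lemma card_headsBelow_lt (hc : c.IsOptimal) {l : Fin N} (hl : l.val + 1 = N) {κ : ℕ} (hκ : 0 < κ)
    (hk : c.FanOutAtMost (κ + 1)) {r : Fin c.size} (hr : r ∈ c.spine (c.out l)) :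
    #((hc.forest hl hκ hk).headsBelow r) < capacity κ (c.vertexDepth (Sum.inr r) + 1)
      (c.depth - c.vertexDepth (Sum.inr r)) := by
  obtain ⟨⟨b, hb⟩, m, hm⟩ := mem_spine.1 hr
  have hf := hc.isFinal hl hb.binary hm
  refine (hc.forest hl hκ hk).card_headsBelow_le hf (Nat.succ_le_succ hf.depth_le) ?_
  intro x hx
  obtain ⟨hxh, hrx⟩ := CarrierForest.mem_headsBelow.1 hx
  obtain ⟨r₁, hr₁, hx₁, hlab⟩ := hc.exists_root hl hκ hk hxh
  have h1 := (CarrierForest.mem_headsBelow.1 hx₁).2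
  -- Ancestors of `x` are comparable and roots have no proper ancestors, so the label bound of
  -- `exists_root` concerns this very root.
  have : r = r₁ := by
    rcases CarrierForest.comparable hrx.to_reflTransGen h1.to_reflTransGen with h | h
    · exact (hc.eq_of_reflTransGen_spine hl hκ hk hr₁ h).symm
    · exact hc.eq_of_reflTransGen_spine hl hκ hk hr h
  rw [this]
  exact hlab

/-- Optimal prefix circuits of bounded fan-out have bounded width. -/
theorem width_le (hc : c.IsOptimal) {κ : ℕ} (hκ : 0 < κ) (hk : c.FanOutAtMost (κ + 1)) :
    N ≤ 1 + ∑ t ∈ Icc 1 c.depth, capacity κ (t + 1) (c.depth - t) := by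
  classical
  rcases Nat.eq_zero_or_pos N with h0 | h0
  · omega
  let l : Fin N := ⟨N - 1, by omega⟩
  have hl : l.val + 1 = N := by change N - 1 + 1 = N; omega
  obtain ⟨B, hB, hBx⟩ := hc.1.exists_copied
  obtain ⟨-, -, -, hdep, hS⟩ := hc.structure l hl
  have h1 : B ⊆ (c.spine (c.out l)) ∪
      (c.spine (c.out l)).biUnion (hc.forest hl hκ hk).headsBelow := by
    intro x hx
    obtain ⟨hb, i, -, hi⟩ := hBx x hx
    by_cases hs : x ∈ c.spine (c.out l)
    · exact mem_union_left _ hs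
    · obtain ⟨r, hr, hrx, -⟩ := hc.exists_root hl hκ hk ⟨hb, hs, _, hi⟩
      exact mem_union_right _ (mem_biUnion.2 ⟨r, hr, hrx⟩)
  have h2 : (c.spine (c.out l)).image (fun x => c.vertexDepth (Sum.inr x)) = Icc 1 c.depth := by
    refine eq_of_subset_of_card_le (spine_mapsTo l) ?_
    rw [card_image_of_injOn (spine_injOn _), hS]; simp
  have h3 : ∑ r ∈ c.spine (c.out l), (#((hc.forest hl hκ hk).headsBelow r) + 1) ≤
      ∑ t ∈ Icc 1 c.depth, capacity κ (t + 1) (c.depth - t) := by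
    rw [← h2, sum_image (spine_injOn _)]
    exact sum_le_sum fun r hr => hc.card_headsBelow_lt hl hκ hk hr
  rw [sum_add_distrib, sum_const, smul_eq_mul, mul_one] at h3
  have h4 := card_le_card h1
  have h5 := card_union_le (c.spine (c.out l))
    ((c.spine (c.out l)).biUnion (hc.forest hl hκ hk).headsBelow)
  have h6 := card_biUnion_le (s := c.spine (c.out l)) (t := (hc.forest hl hκ hk).headsBelow)
  omega

end IsOptimal

end PrefixCircuit

/-! ### Numbering the elements and certifying correctness -/

namespace CircuitElement

/-- The number of wires from `v` to the element. -/
def argCount {V : Type} [DecidableEq V] (v : V) : CircuitElement V → ℕ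
  | ident a => if a = v then 1 else 0
  | binary a b => (if a = v then 1 else 0) + if b = v then 1 else 0

/-- The element computes the interval from `L` to `H` at depth at most `d`, if its arguments
compute the intervals from `lo` to `hi` at depths at most `dep`. -/
def Fits {V : Type} (lo hi dep : V → ℕ) (L H d : ℕ) : CircuitElement V → Prop
  | ident a => lo a = L ∧ hi a = H ∧ dep a < d
  | binary a b => lo a = L ∧ hi a = lo b ∧ hi b = H ∧ dep a < d ∧ dep b < d

lemma Fits.congr {V : Type} [DecidableEq V] {lo hi dep lo' hi' dep' : V → ℕ} {L H d : ℕ}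
    {e : CircuitElement V} (h : e.Fits lo hi dep L H d)
    (h' : ∀ v, 0 < e.argCount v → lo v = lo' v ∧ hi v = hi' v ∧ dep v = dep' v) :
    e.Fits lo' hi' dep' L H d := by
  cases e with
  | ident a =>
    obtain ⟨h1, h2, h3⟩ := h' a (by simp [argCount])
    simpa only [Fits, h1, h2, h3] using h
  | binary a b =>
    obtain ⟨h1, h2, h3⟩ := h' a (by simp [argCount])
    obtain ⟨h4, h5, h6⟩ := h' b (by simp [argCount])
    simpa only [Fits, h1, h2, h3, h4, h5, h6] using h

lemma fits_map {V W : Type} (f : V → W) {lo hi dep : W → ℕ} {L H d : ℕ} {e : CircuitElement V} :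
    (e.map f).Fits lo hi dep L H d ↔ e.Fits (lo ∘ f) (hi ∘ f) (dep ∘ f) L H d := by
  cases e <;> rfl

lemma argCount_map {V W : Type} [DecidableEq V] [DecidableEq W] (f : V → W) {v : V}
    {e : CircuitElement V} (h : ∀ a, 0 < e.argCount a → (f a = f v ↔ a = v)) :
    (e.map f).argCount (f v) = e.argCount v := by
  cases e with
  | ident a =>
    have h1 := h a (by simp [argCount])
    simp only [map, argCount, h1]
  | binary a b =>
    have h1 := h a (by simp [argCount])
    have h2 := h b (by simp [argCount])
    simp only [map, argCount, h1, h2]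

lemma map_congr {V W : Type} [DecidableEq V] {f g : V → W} {e : CircuitElement V}
    (h : ∀ a, 0 < e.argCount a → f a = g a) : e.map f = e.map g := by
  cases e with
  | ident a => simp only [map, h a (by simp [argCount])]
  | binary a b => simp only [map, h a (by simp [argCount]), h b (by simp [argCount])]

lemma map_map {U V W : Type} (f : U → V) (g : V → W) (e : CircuitElement U) :
    (e.map f).map g = e.map (g ∘ f) := by cases e <;> rfl

end CircuitElement

namespace PrefixCircuit

variable {N : ℕ}

lemma fanOut_eq (c : PrefixCircuit N) (v : c.Vertex) :
    c.fanOut v = ∑ j, (c.elem j).argCount v + #{i | c.out i = v} := by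
  unfold fanOut
  congr 1
  refine sum_congr rfl fun j _ => ?_
  have := Sum.lawfulBEq (α := Fin N) (β := Fin c.size)
  rw [argVertices_eq]
  cases c.elem j <;> simp [CircuitElement.args, CircuitElement.argCount, List.count_cons]
  omega

/-- A circuit whose elements form an arbitrary finite type, with a function that increases along
the wires, can be numbered. -/
lemma exists_numbering [NeZero N] {V : Type} [Fintype V] [DecidableEq V]
    (elt : V → CircuitElement (Fin N ⊕ V)) (dep : V → ℕ)
    (hdep : ∀ v w, 0 < (elt v).argCount (Sum.inr w) → dep w < dep v) (out : Fin N → Fin N ⊕ V) :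
    ∃ (c : PrefixCircuit N) (e : V ≃ Fin c.size),
      (∀ v, c.elem (e v) = (elt v).map (Sum.map id e)) ∧ ∀ i, c.out i = Sum.map id e (out i) := by
  let e₀ := Fintype.equivFin V
  let p := Tuple.sort (dep ∘ e₀.symm)
  let σ : V ≃ Fin (Fintype.card V) := e₀.trans p.symm
  have hσ : ∀ v w, dep v < dep w → σ v < σ w := by
    intro v w h
    by_contra hcon
    have := Tuple.monotone_sort (dep ∘ e₀.symm) (not_lt.1 hcon)
    simp only [Function.comp_apply] at this
    have e1 : ∀ u, e₀.symm (p (σ u)) = u := fun u => by simp [σ]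
    change dep (e₀.symm (p (σ w))) ≤ dep (e₀.symm (p (σ v))) at this
    rw [e1, e1] at this
    omega
  -- The default `Sum.inl 0` is never taken for an actual argument, since arguments precede their
  -- element in the order sorted by `dep`.
  let lower (j : Fin (Fintype.card V)) : Fin N ⊕ V → Fin N ⊕ Fin j.val :=
    Sum.elim Sum.inl fun v => if h : σ v < j then Sum.inr ⟨σ v, h⟩ else Sum.inl 0
  refine ⟨⟨Fintype.card V, fun j => (elt (σ.symm j)).map (lower j),
    fun i => Sum.map id σ (out i)⟩, σ, fun v => ?_, fun i => rfl⟩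
  change ((elt (σ.symm (σ v))).map (lower (σ v))).map (Sum.map id (Fin.castLE _)) = _
  rw [Equiv.symm_apply_apply, CircuitElement.map_map]
  refine CircuitElement.map_congr fun a ha => ?_
  rcases a with a | w
  · rfl
  · have := hσ w v (hdep v w ha)
    simp only [Function.comp_apply, lower, Sum.elim_inr, dif_pos this]
    rfl

/-- The product of `n + 1` consecutive inputs, from position `i` on. -/
def segment {S : Type} [Semigroup S] (x : ℕ → S) (i : ℕ) : ℕ → S
  | 0 => x i
  | n + 1 => segment x i n * x (i + n + 1)

lemma segment_mul {S : Type} [Semigroup S] (x : ℕ → S) (i n m : ℕ) :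
    segment x i n * segment x (i + n + 1) m = segment x i (n + m + 1) := by
  induction m with
  | zero => rfl
  | succ m ih =>
    rw [segment, ← mul_assoc, ih, ← add_assoc, segment]
    congr 2
    omega

/-- A certificate for the correctness of a circuit. -/
lemma computes_of_certificate [NeZero N] {c : PrefixCircuit N} {lo hi dep : c.Vertex → ℕ}
    (hlo : ∀ i : Fin N, lo (Sum.inl i) = i) (hhi : ∀ i : Fin N, hi (Sum.inl i) = i + 1)
    (h : ∀ j, (c.elem j).Fits lo hi dep (lo (Sum.inr j)) (hi (Sum.inr j)) (dep (Sum.inr j)))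
    (hout : ∀ i : Fin N, lo (c.out i) = 0 ∧ hi (c.out i) = i + 1) : c.ComputesPrefixSums := by
  intro S _ x i
  let y : ℕ → S := fun i => if h : i < N then x ⟨i, h⟩ else x 0
  have key : ∀ v : c.Vertex, ∃ n, hi v = lo v + n + 1 ∧ c.value x v = segment y (lo v) n := by
    intro v
    induction v using vertex_induction with
    | inl a =>
      refine ⟨0, by rw [hlo, hhi], ?_⟩
      rw [hlo]
      simp [segment, y, value]
    | ident j a hj ih =>
      obtain ⟨n, h1, h2⟩ := ih
      have := h j
      rw [hj] at this
      obtain ⟨h3, h4, -⟩ := this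
      exact ⟨n, by omega, by rw [value_ident _ hj, h2, h3]⟩
    | binary j p q hj ih1 ih2 =>
      obtain ⟨n, h1, h2⟩ := ih1
      obtain ⟨m, h3, h4⟩ := ih2
      have := h j
      rw [hj] at this
      obtain ⟨h5, h6, h7, -⟩ := this
      refine ⟨n + m + 1, by omega, ?_⟩
      rw [value_binary _ hj, h2, h4, ← h6, h1, segment_mul, h5]
  have key' : ∀ i (hi : i < N), segment y 0 i = prefixSum x i hi := by
    intro i hi
    induction i with
    | zero => simp [segment, y, prefixSum, hi]
    | succ i ih =>
      rw [segment, prefixSum, ih (Nat.lt_of_succ_lt hi)]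
      simp [y, hi]
  obtain ⟨n, h1, h2⟩ := key (c.out i)
  obtain ⟨h3, h4⟩ := hout i
  have : n = i := by omega
  rw [h2, h3, this, key']

lemma vertexDepth_le_of_certificate {c : PrefixCircuit N} {lo hi dep : c.Vertex → ℕ}
    (h : ∀ j, (c.elem j).Fits lo hi dep (lo (Sum.inr j)) (hi (Sum.inr j)) (dep (Sum.inr j)))
    (v : c.Vertex) : c.vertexDepth v ≤ dep v := by
  induction v using vertex_induction with
  | inl a => exact Nat.zero_le _
  | ident j a hj ih =>
    have := h j
    rw [hj] at this
    obtain ⟨-, -, h1⟩ := this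
    rw [vertexDepth_ident hj]
    omega
  | binary j p q hj ih1 ih2 =>
    have := h j
    rw [hj] at this
    obtain ⟨-, -, -, h1, h2⟩ := this
    rw [vertexDepth_binary hj]
    omega

end PrefixCircuit

/-! ### Parts of circuits and how to join them -/

/-- Names of the elements of the circuits constructed below: at each position there is an element
`0` that computes a sum of consecutive inputs, an element `1` that computes a prefix sum, and an
element `2` that copies a prefix sum. -/
abbrev Gate : Type := Fin 3 × ℕ

/-- Inputs and elements. -/
abbrev Node : Type := ℕ ⊕ Gate

/-- An element, the beginning and the end of the interval that it computes, and a bound for its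
depth. -/
structure GateSpec where
  elem : CircuitElement Node
  lo : ℕ
  hi : ℕ
  dep : ℕ

namespace GateSpec

/-- The beginning of the interval computed at a node. -/
def nodeLo (F : Gate → GateSpec) : Node → ℕ := Sum.elim id fun g => (F g).lo

/-- The end of the interval computed at a node. -/
def nodeHi (F : Gate → GateSpec) : Node → ℕ := Sum.elim (· + 1) fun g => (F g).hi

/-- The depth of a node. -/
def nodeDep (F : Gate → GateSpec) : Node → ℕ := Sum.elim (fun _ => 0) fun g => (F g).dep

/-- The data of the gate `g` are consistent with those of its arguments. -/
def Valid (F : Gate → GateSpec) (g : Gate) : Prop :=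
  (F g).elem.Fits (nodeLo F) (nodeHi F) (nodeDep F) (F g).lo (F g).hi (F g).dep

/-- The number of wires from `v` to gates at positions `p ≤ m < b` and to outputs at positions
`q ≤ i < b`. -/
def uses (F : Gate → GateSpec) (out : ℕ → Node) (p q b : ℕ) (v : Node) : ℕ :=
  ∑ m ∈ Ico p b, ∑ i : Fin 3, (F (i, m)).elem.argCount v +
    ∑ i ∈ Ico q b, if out i = v then 1 else 0

/-- Two families of gates, with gates at the position `s` between them. -/
def join (s : ℕ) (F : Gate → GateSpec) (G : Fin 3 → GateSpec) (F' : Gate → GateSpec) :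
    Gate → GateSpec :=
  fun g => if g.2 < s then F g else if g.2 = s then G g.1 else F' g

/-- Two families of outputs, before and after the position `s`. -/
def joinOut (s : ℕ) (out out' : ℕ → Node) (i : ℕ) : Node := if i < s then out i else out' i

variable {F F' : Gate → GateSpec} {G : Fin 3 → GateSpec} {out out' : ℕ → Node} {p q s b : ℕ}

lemma join_of_lt {i : Fin 3} {m : ℕ} (h : m < s) : join s F G F' (i, m) = F (i, m) := if_pos h

lemma join_self {i : Fin 3} : join s F G F' (i, s) = G i := by simp [join]

lemma join_of_gt {i : Fin 3} {m : ℕ} (h : s < m) : join s F G F' (i, m) = F' (i, m) := by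
  simp [join, h.not_gt, h.ne']

lemma uses_join (hp : p ≤ s) (hq : q ≤ s) (hb : s < b) (v : Node) :
    uses (join s F G F') (joinOut s out out') p q b v =
      uses F out p q s v + ∑ i, (G i).elem.argCount v + uses F' out' (s + 1) s b v := by
  unfold uses
  rw [← sum_Ico_consecutive _ hp hb.le, ← sum_Ico_consecutive _ hq hb.le,
    sum_eq_sum_Ico_succ_bot hb]
  have h1 : ∀ m ∈ Ico p s, ∑ i : Fin 3, (join s F G F' (i, m)).elem.argCount v =
      ∑ i : Fin 3, (F (i, m)).elem.argCount v := fun m hm => by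
    simp only [join_of_lt (mem_Ico.1 hm).2]
  have h2 : ∀ m ∈ Ico (s + 1) b, ∑ i : Fin 3, (join s F G F' (i, m)).elem.argCount v =
      ∑ i : Fin 3, (F' (i, m)).elem.argCount v := fun m hm => by
    simp only [join_of_gt (mem_Ico.1 hm).1]
  have h3 : ∀ i ∈ Ico q s, (if joinOut s out out' i = v then 1 else 0) =
      if out i = v then 1 else 0 := fun i hi => by
    simp only [joinOut, if_pos (mem_Ico.1 hi).2]
  have h4 : ∀ i ∈ Ico s b, (if joinOut s out out' i = v then 1 else 0) =
      if out' i = v then 1 else 0 := fun i hi => by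
    simp only [joinOut, if_neg (mem_Ico.1 hi).1.not_gt]
  rw [sum_congr rfl h1, sum_congr rfl h2, sum_congr rfl h3, sum_congr rfl h4]
  simp only [join_self]
  omega

/-- A node is an input before `b`, a gate at one of the positions `p ≤ m < b`, or the carrier. -/
def Local (c : Option Gate) (p b : ℕ) (x : Node) : Prop :=
  (∃ i < b, x = Sum.inl i) ∨ (∃ i m, p ≤ m ∧ m < b ∧ x = Sum.inr (i, m)) ∨
    ∃ g ∈ c, x = Sum.inr g

lemma Local.of_gate {c : Option Gate} {i : Fin 3} {m : ℕ}
    (h : Local c p b (Sum.inr (i, m))) : p ≤ m ∧ m < b ∨ (i, m) ∈ c := by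
  rcases h with ⟨j, -, h⟩ | ⟨i', m', h1, h2, h⟩ | ⟨g, hg, h⟩
  · cases h
  · cases h; exact Or.inl ⟨h1, h2⟩
  · cases h; exact Or.inr hg

lemma Local.mono {c c' : Option Gate} {p' b' : ℕ} {x : Node} (h : Local c p b x) (hp : p' ≤ p)
    (hb : b ≤ b') (hc : ∀ g ∈ c, Local c' p' b' (Sum.inr g)) : Local c' p' b' x := by
  rcases h with ⟨j, hj, rfl⟩ | ⟨i', m', h1, h2, rfl⟩ | ⟨g, hg, rfl⟩
  · exact Or.inl ⟨j, hj.trans_le hb, rfl⟩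
  · exact Or.inr (Or.inl ⟨i', m', hp.trans h1, h2.trans_le hb, rfl⟩)
  · exact hc g hg

/-- A part of a circuit with gates at the positions `p ≤ m < b`, outputs at the positions
`q ≤ i < b`, and a root, all of whose wires come from inputs, from the part itself, or from the
carrier `c`.  Gates are used at most `k` times. -/
structure Wired (k : ℕ) (c : Option Gate) (p q a b : ℕ) (F : Gate → GateSpec) (out : ℕ → Node)
    (root : Node) : Prop where
  arg_local : ∀ i m, p ≤ m → m < b → ∀ x, 0 < (F (i, m)).elem.argCount x → Local c p b x
  out_local : ∀ i, q ≤ i → i < b → Local c p b (out i)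
  root_eq : root = Sum.inl a ∨ ∃ s, p ≤ s ∧ s < b ∧ root = Sum.inr (0, s)
  root_uses : ∀ g, root = Sum.inr g → uses F out p q b root = 0
  uses_le : ∀ i m, p ≤ m → m < b → uses F out p q b (Sum.inr (i, m)) ≤ k
  copy : ∀ m, p ≤ m → m < b → (F (2, m)).elem.isBinary = false

namespace Wired

variable {k a : ℕ} {c : Option Gate} {root : Node}

lemma uses_eq_zero (h : Wired k c p q a b F out root) {i : Fin 3} {m : ℕ}
    (h1 : ¬ (p ≤ m ∧ m < b)) (h2 : (i, m) ∉ c) : uses F out p q b (Sum.inr (i, m)) = 0 := by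
  unfold uses
  rw [add_eq_zero, sum_eq_zero_iff, sum_eq_zero_iff]
  constructor
  · intro m' hm'
    rw [mem_Ico] at hm'
    rw [sum_eq_zero_iff]
    intro i' _
    by_contra hne
    rcases (h.arg_local i' m' hm'.1 hm'.2 _ (Nat.pos_of_ne_zero hne)).of_gate with h | h
    · exact h1 h
    · exact h2 h
  · intro i' hi'
    rw [mem_Ico] at hi'
    rw [if_neg]
    intro ho
    have := h.out_local i' hi'.1 hi'.2
    rw [ho] at this
    rcases this.of_gate with h | h
    · exact h1 h
    · exact h2 h

lemma local_root (h : Wired k c p q a b F out root) (ha : a < b) : Local c p b root := by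
  rcases h.root_eq with h | ⟨s, h1, h2, h⟩
  · exact Or.inl ⟨a, ha, h⟩
  · exact Or.inr (Or.inl ⟨0, s, h1, h2, h⟩)

/-- The root is not a gate outside. -/
lemma root_ne (h : Wired k c p q a b F out root) {i : Fin 3} {m : ℕ}
    (h1 : ¬ (p ≤ m ∧ m < b)) : root ≠ Sum.inr (i, m) := by
  rcases h.root_eq with h | ⟨s, h2, h3, h⟩
  · rw [h]; simp
  · rw [h]
    intro h'
    cases h'
    exact h1 ⟨h2, h3⟩

end Wired

/-- The certificates of a part of a circuit, for any completion of it that feeds the prefix sum of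
the first `a` inputs into the carrier `c`, at depth at most `d`. -/
def Certified (c : Option Gate) (p q a b h d D : ℕ) (F : Gate → GateSpec) (out : ℕ → Node)
    (root : Node) : Prop :=
  ∀ F' : Gate → GateSpec, (∀ i m, p ≤ m → m < b → F' (i, m) = F (i, m)) →
    (∀ g ∈ c, (F' g).lo = 0 ∧ (F' g).hi = a ∧ (F' g).dep ≤ d) →
    (nodeLo F' root = a ∧ nodeHi F' root = b ∧ nodeDep F' root ≤ h) ∧
    (∀ i, q ≤ i → i < b → nodeLo F' (out i) = 0 ∧ nodeHi F' (out i) = i ∧ nodeDep F' (out i) ≤ D) ∧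
    ∀ i m, p ≤ m → m < b → Valid F' (i, m)

/-- Wires out of a half lead back into it, except that its root is used by the new gates: the left
root at most twice, the right root once. Roots are unused inside their halves, so `2 ≤ k` suffices
for them; the gates at `s` serve only as carriers. -/
lemma Wired.join {k a : ℕ} {c cl : Option Gate} {ir : Fin 3} {rl rr : Node}
    (Hl : Wired k cl p q a s F out rl) (Hr : Wired k (some (ir, s)) (s + 1) s s b F' out' rr)
    (hk : 2 ≤ k) (hp : p ≤ s) (hq : q ≤ s) (ha : a < s) (hb : s < b)
    (hc : ∀ g ∈ c, ¬ (p ≤ g.2 ∧ g.2 < b)) (hcl : ∀ g ∈ cl, g ∈ c ∨ g.2 = s)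
    (hcr : (ir, s) ∉ cl) (hir : ir ≠ 0) (h0 : (0, s) ∉ cl)
    (hul : ∀ g ∈ cl, uses F out p q s (Sum.inr g) ≤ k)
    (hur : uses F' out' (s + 1) s b (Sum.inr (ir, s)) ≤ k)
    (hG₀ : (G 0).elem = .binary rl rr)
    (hG : ∀ g ∉ c, (G 1).elem.argCount (Sum.inr g) + (G 2).elem.argCount (Sum.inr g) ≤
      if rl = Sum.inr g then 1 else 0)
    (hG' : ∀ i ≠ 0, ∀ x, 0 < (G i).elem.argCount x → Local c p b x)
    (hG₂ : (G 2).elem.isBinary = false) :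
    Wired k c p q a b (join s F G F') (joinOut s out out') (Sum.inr (0, s)) := by
  have hl : ∀ x, Local cl p s x → Local c p b x := fun x hx =>
    hx.mono le_rfl hb.le fun g hg => by
      rcases hcl g hg with h | h
      · exact Or.inr (Or.inr ⟨g, h, rfl⟩)
      · exact Or.inr (Or.inl ⟨g.1, g.2, by omega, by omega, rfl⟩)
  have hr : ∀ x, Local (some (ir, s)) (s + 1) b x → Local c p b x := fun x hx =>
    hx.mono (by omega) le_rfl fun g hg => by
      cases hg
      exact Or.inr (Or.inl ⟨ir, s, hp, hb, rfl⟩)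
  have hsum : ∀ v, ∑ i, (G i).elem.argCount v = ((if rl = v then 1 else 0) +
      if rr = v then 1 else 0) + ((G 1).elem.argCount v + (G 2).elem.argCount v) := fun v => by
    rw [Fin.sum_univ_three, hG₀, CircuitElement.argCount]
    omega
  have hnotc : ∀ i m, p ≤ m → m < b → (i, m) ∉ c := fun i m h1 h2 h => hc _ h ⟨h1, h2⟩
  refine ⟨fun i m h1 h2 x hx => ?_, fun i h1 h2 => ?_, Or.inr ⟨s, hp, hb, rfl⟩, fun g hg => ?_,
    fun i m h1 h2 => ?_, fun m h1 h2 => ?_⟩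
  · rcases lt_trichotomy m s with h | rfl | h
    · rw [join_of_lt h] at hx
      exact hl x (Hl.arg_local i m h1 h x hx)
    · rw [join_self] at hx
      by_cases hi : i = 0
      · subst hi
        rw [hG₀, CircuitElement.argCount] at hx
        by_cases h3 : rl = x
        · exact h3 ▸ hl _ (Hl.local_root ha)
        · by_cases h4 : rr = x
          · exact h4 ▸ hr _ (Hr.local_root hb)
          · simp [h3, h4] at hx
      · exact hG' i hi x hx
    · rw [join_of_gt h] at hx
      exact hr x (Hr.arg_local i m h h2 x hx)
  · unfold joinOut
    split_ifs with h
    · exact hl _ (Hl.out_local i h1 h)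
    · exact hr _ (Hr.out_local i (not_lt.1 h) h2)
  · rw [uses_join hp hq hb, hsum, Hl.uses_eq_zero (by omega) h0,
      Hr.uses_eq_zero (by omega) (by simpa using hir),
      if_neg (Hl.root_ne (by omega)), if_neg (Hr.root_ne (by omega))]
    have := hG (0, s) (hnotc _ _ hp hb)
    rw [if_neg (Hl.root_ne (by omega))] at this
    omega
  · rw [uses_join hp hq hb, hsum]
    have h3 := hG (i, m) (hnotc _ _ h1 h2)
    rcases lt_trichotomy m s with h | rfl | h
    · rw [if_neg (Hr.root_ne (by omega)), Hr.uses_eq_zero (by omega) (by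
        intro h'; cases h'; omega)]
      have h4 := Hl.uses_le i m h1 h
      by_cases h5 : rl = Sum.inr (i, m)
      · have h6 := Hl.root_uses _ h5
        rw [h5] at h6
        rw [if_pos h5] at h3 ⊢
        omega
      · rw [if_neg h5] at h3 ⊢
        omega
    · have h4 : rl ≠ Sum.inr (i, m) := Hl.root_ne (by omega)
      rw [if_neg h4] at h3 ⊢
      rw [if_neg (Hr.root_ne (by omega))]
      by_cases h5 : (i, m) ∈ cl
      · have h6 := hul _ h5
        rw [Hr.uses_eq_zero (by omega) (by intro h'; cases h'; exact hcr h5)]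
        omega
      · rw [Hl.uses_eq_zero (by omega) h5]
        by_cases h6 : i = ir
        · subst h6; omega
        · rw [Hr.uses_eq_zero (by omega) (by intro h'; cases h'; exact h6 rfl)]
          omega
    · have h4 : rl ≠ Sum.inr (i, m) := Hl.root_ne (by omega)
      rw [if_neg h4] at h3 ⊢
      rw [Hl.uses_eq_zero (by omega) (by
        intro h'
        rcases hcl _ h' with h' | h'
        · exact hnotc _ _ h1 h2 h'
        · exact h.ne' h')]
      have h5 := Hr.uses_le i m h h2
      by_cases h6 : rr = Sum.inr (i, m)
      · have h7 := Hr.root_uses _ h6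
        rw [h6] at h7
        rw [if_pos h6]
        omega
      · rw [if_neg h6]
        omega
  · rcases lt_trichotomy m s with h | rfl | h
    · rw [join_of_lt h]; exact Hl.copy m h1 h
    · rw [join_self]; exact hG₂
    · rw [join_of_gt h]; exact Hr.copy m h h2

/-- Because `Certified` speaks of arbitrary completions, both halves can be instantiated with the
same joined family; only the gates at `s` remain to be checked. -/
lemma Certified.join {a h d D hl dl hr dr : ℕ} {c cl : Option Gate} {ir : Fin 3} {rl rr : Node}
    (Hl : Certified cl p q a s hl dl D F out rl)
    (Hr : Certified (some (ir, s)) (s + 1) s s b hr dr D F' out' rr)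
    (hp : p ≤ s) (hb : s < b)
    (hcl : ∀ g ∈ cl, g ∈ c ∧ d ≤ dl ∨
      g.2 = s ∧ (G g.1).lo = 0 ∧ (G g.1).hi = a ∧ (G g.1).dep ≤ dl)
    (hcr : (G ir).lo = 0 ∧ (G ir).hi = s ∧ (G ir).dep ≤ dr)
    (h0 : (G 0).lo = a ∧ (G 0).hi = b ∧ (G 0).dep ≤ h)
    (hG : ∀ F₁ : Gate → GateSpec, (∀ i, F₁ (i, s) = G i) →
      (∀ g ∈ c, (F₁ g).lo = 0 ∧ (F₁ g).hi = a ∧ (F₁ g).dep ≤ d) →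
      (nodeLo F₁ rl = a ∧ nodeHi F₁ rl = s ∧ nodeDep F₁ rl ≤ hl) →
      (nodeLo F₁ rr = s ∧ nodeHi F₁ rr = b ∧ nodeDep F₁ rr ≤ hr) → ∀ i, Valid F₁ (i, s)) :
    Certified c p q a b h d D (join s F G F') (joinOut s out out') (Sum.inr (0, s)) := by
  intro F₁ hF hc
  have hs : ∀ i, F₁ (i, s) = G i := fun i => by rw [hF i s hp hb, join_self]
  obtain ⟨l1, l2, l3⟩ := Hl F₁ (fun i m h1 h2 => by rw [hF i m h1 (by omega), join_of_lt h2])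
    (fun g hg => by
      rcases hcl g hg with ⟨h1, h2⟩ | ⟨h1, h2⟩
      · obtain ⟨h3, h4, h5⟩ := hc g h1
        exact ⟨h3, h4, h5.trans h2⟩
      · have : g = (g.1, s) := by rw [← h1]
        rw [this, hs]
        exact h2)
  obtain ⟨r1, r2, r3⟩ := Hr F₁ (fun i m h1 h2 => by
      rw [hF i m (by omega) h2, join_of_gt (show s < m by omega)])
    (fun g hg => by cases hg; rw [hs]; exact hcr)
  refine ⟨?_, fun i h1 h2 => ?_, fun i m h1 h2 => ?_⟩
  · simp only [nodeLo, nodeHi, nodeDep, Sum.elim_inr, hs]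
    exact h0
  · unfold joinOut
    split_ifs with h
    · exact l2 i h1 h
    · exact r2 i (not_lt.1 h) h2
  · rcases lt_trichotomy m s with h | rfl | h
    · exact l3 i m h1 h
    · exact hG F₁ hs hc l1 r1 i
    · exact r3 i m h h2

end GateSpec

/-! ### The extremal construction: branches and trunk -/

open GateSpec

/-- The width of a part with a carrier, for gates of fan-out `κ + 1`: `h` is the depth that is
available for sums, `τ` the additional depth that is available for prefix sums, and `j` the
number of wires from the carrier that are used already. -/
def branchWidth (κ : ℕ) : ℕ → ℕ → ℕ → ℕ
  | 0, _, _ => 1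
  | _ + 1, 0, _ => 1
  | h + 1, τ + 1, j => branchWidth κ h τ 0 +
      if j + 1 < κ then branchWidth κ h (τ + 1) (j + 1) else branchWidth κ h τ 0

lemma branchWidth_pos (κ h τ j : ℕ) : 1 ≤ branchWidth κ h τ j := by
  induction h generalizing τ j with
  | zero => exact le_rfl
  | succ h ih =>
    cases τ with
    | zero => exact le_rfl
    | succ τ => rw [branchWidth]; exact (ih τ 0).trans (Nat.le_add_right _ _)

/-- Parts with a carrier of any width up to `branchWidth`. -/
lemma exists_branch {κ : ℕ} (hκ : 0 < κ) (h : ℕ) : ∀ τ j a w d (c : Gate), j < κ → 1 ≤ w →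
    w ≤ branchWidth κ h τ j → h ≤ d → (c.2 ≤ a ∨ a + w ≤ c.2) →
    ∃ F out root, Wired (κ + 1) (some c) (a + 1) a a (a + w) F out root ∧
      Certified (some c) (a + 1) a a (a + w) h d (d + τ) F out root ∧
      uses F out (a + 1) a (a + w) (Sum.inr c) ≤ κ + 1 - j ∧
      ∀ m, a + 1 ≤ m → m < a + w → (F (0, m)).elem.isBinary = true ∧
        (F (1, m)).elem.isBinary = true := by
  -- A single input has an empty range of gate positions, so the family of gates is a dummy; the one
  -- output is read from the carrier.
  have leaf : ∀ h τ j a d (c : Gate), j < κ →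
      ∃ F out root, Wired (κ + 1) (some c) (a + 1) a a (a + 1) F out root ∧
      Certified (some c) (a + 1) a a (a + 1) h d (d + τ) F out root ∧
      uses F out (a + 1) a (a + 1) (Sum.inr c) ≤ κ + 1 - j ∧
      ∀ m, a + 1 ≤ m → m < a + 1 → (F (0, m)).elem.isBinary = true ∧
        (F (1, m)).elem.isBinary = true := by
    intro h τ j a d c hj
    refine ⟨fun _ => ⟨.ident (Sum.inl 0), 0, 1, 1⟩, fun _ => Sum.inr c, Sum.inl a, ?_, ?_, ?_, ?_⟩
    · refine ⟨fun i m h1 h2 => by omega, fun i h1 h2 => Or.inr (Or.inr ⟨c, rfl, rfl⟩),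
        Or.inl rfl, fun g hg => absurd hg Sum.inl_ne_inr, fun i m h1 h2 => by omega, fun m h1 h2 => by omega⟩
    · intro F' _ hc
      refine ⟨⟨rfl, rfl, Nat.zero_le _⟩, fun i h1 h2 => ?_, fun i m h1 h2 => by omega⟩
      obtain ⟨h3, h4, h5⟩ := hc c rfl
      have : i = a := by omega
      exact ⟨h3, this ▸ h4, h5.trans (Nat.le_add_right _ _)⟩
    · simp [uses]
      omega
    · intro m h1 h2; omega
  induction h with
  | zero =>
    intro τ j a w d c hj h1 hw hd hc
    have : w = 1 := le_antisymm hw h1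
    subst this
    exact leaf 0 τ j a d c hj
  | succ h ih =>
    intro τ j a w d c hj h1 hw hd hc
    rcases h1.eq_or_lt with rfl | h1
    · exact leaf (h + 1) τ j a d c hj
    cases τ with
    | zero => rw [branchWidth] at hw; omega
    | succ τ =>
    rw [branchWidth] at hw
    obtain ⟨w₁, w₂, rfl, hw₁, hw₂, hw₁', hw₂'⟩ : ∃ w₁ w₂, w = w₁ + w₂ ∧ 1 ≤ w₁ ∧ 1 ≤ w₂ ∧
        w₁ ≤ (if j + 1 < κ then branchWidth κ h (τ + 1) (j + 1) else branchWidth κ h τ 0) ∧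
        w₂ ≤ branchWidth κ h τ 0 := by
      have hp := branchWidth_pos κ h τ 0
      have hp' : 1 ≤ if j + 1 < κ then branchWidth κ h (τ + 1) (j + 1)
          else branchWidth κ h τ 0 := by
        split_ifs
        · exact branchWidth_pos _ _ _ _
        · exact hp
      refine ⟨w - min (w - 1) (branchWidth κ h τ 0), min (w - 1) (branchWidth κ h τ 0), ?_⟩
      omega
    set s := a + w₁ with hs
    rw [← add_assoc, ← hs]
    -- `E` is the gate `(2, s)`. While j + 1 < κ the left half keeps the carrier `c`, and `E` is a
    -- dummy; otherwise the last two wires of `c` go to the gate `(1, s)` and to a fresh copy `E`,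
    -- which costs one unit of depth.
    obtain ⟨E, cl, jl, τl, dl, hE, hjl, hwl, hdl, hcl⟩ : ∃ (E : GateSpec) (cl : Gate)
        (jl τl dl : ℕ), ((E = ⟨.ident (Sum.inl 0), 0, 1, 1⟩ ∧ cl = c ∧ jl = j + 1 ∧ dl = d) ∨
          (E = ⟨.ident (Sum.inr c), 0, a, d + 1⟩ ∧ cl = (2, s) ∧ jl = 0 ∧ dl = d + 1)) ∧
        jl < κ ∧ w₁ ≤ branchWidth κ h τl jl ∧ dl + τl = d + (τ + 1) ∧
        (cl.2 ≤ a ∨ s ≤ cl.2) := by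
      split_ifs at hw₁' with hj'
      · exact ⟨_, c, j + 1, τ + 1, d, Or.inl ⟨rfl, rfl, rfl, rfl⟩, hj', hw₁', rfl, by omega⟩
      · exact ⟨_, (2, s), 0, τ, d + 1, Or.inr ⟨rfl, rfl, rfl, rfl⟩, hκ, hw₁', by omega,
          Or.inr le_rfl⟩
    have hdl' : h ≤ dl := by rcases hE with h' | h' <;> omega
    obtain ⟨Fl, ol, rl, Wl, Cl, Ul, Bl⟩ := ih τl jl a w₁ dl cl hjl hw₁ hwl hdl' hcl
    obtain ⟨Fr, or, rr, Wr, Cr, Ur, Br⟩ := ih τ 0 s w₂ (d + 1) (1, s) hκ hw₂ hw₂' (by omega)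
      (Or.inl le_rfl)
    rw [← hs] at Wl Cl Ul Bl
    -- Gate 0 is the sum of the whole block; gate 1 is the prefix sum at the split, which carries
    -- the right half.
    let G : Fin 3 → GateSpec := ![⟨.binary rl rr, a, s + w₂, h + 1⟩,
      ⟨.binary (Sum.inr c) rl, 0, s, d + 1⟩, E]
    have has : a < s := by omega
    have hsb : s < s + w₂ := by omega
    have hc1 : c.2 ≠ s := by omega
    have hcab : ¬ (a + 1 ≤ c.2 ∧ c.2 < s + w₂) := by omega
    have hrlc : rl ≠ Sum.inr c := Wl.root_ne (by omega)
    have hrrc : rr ≠ Sum.inr c := Wr.root_ne (by omega)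
    have hlrl : Local (some c) (a + 1) (s + w₂) rl := by
      rcases Wl.root_eq with h' | ⟨s', h1, h2, h'⟩
      · exact Or.inl ⟨a, by omega, h'⟩
      · exact Or.inr (Or.inl ⟨0, s', h1, by omega, h'⟩)
    have hEc : E.elem.isBinary = false ∧ (∀ g, g ≠ c → E.elem.argCount (Sum.inr g) = 0) ∧
        ∀ x, 0 < E.elem.argCount x → Local (some c) (a + 1) (s + w₂) x := by
      rcases hE with ⟨rfl, -⟩ | ⟨rfl, -⟩
      · refine ⟨rfl, fun g _ => by simp [CircuitElement.argCount], fun x hx => ?_⟩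
        by_cases h' : Sum.inl 0 = x
        · exact Or.inl ⟨0, by omega, h'.symm⟩
        · simp [CircuitElement.argCount, h'] at hx
      · refine ⟨rfl, fun g hg => by simp [CircuitElement.argCount, hg.symm], fun x hx => ?_⟩
        by_cases h' : Sum.inr c = x
        · exact Or.inr (Or.inr ⟨c, rfl, h'.symm⟩)
        · simp [CircuitElement.argCount, h'] at hx
    refine ⟨join s Fl G Fr, joinOut s ol or, Sum.inr (0, s), ?_, ?_, ?_, ?_⟩
    · refine Wl.join Wr (by omega) (by omega) has.le has hsb ?_ ?_ ?_ (by decide) ?_ ?_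
        (Ur.trans (by omega)) rfl ?_ ?_ hEc.1
      · intro g hg; cases hg; exact hcab
      · intro g hg; cases hg
        rcases hE with ⟨-, rfl, -⟩ | ⟨-, rfl, -⟩
        · exact Or.inl rfl
        · exact Or.inr rfl
      · intro hg; cases hg
        rcases hE with ⟨-, h', -⟩ | ⟨-, h', -⟩
        · rw [← h'] at hc1; exact hc1 rfl
        · cases h'
      · intro hg; cases hg
        rcases hE with ⟨-, h', -⟩ | ⟨-, h', -⟩
        · rw [← h'] at hc1; exact hc1 rfl
        · cases h'
      · intro g hg; cases hg
        exact Ul.trans (by omega)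
      · intro g hg
        have hgc : g ≠ c := fun h' => hg (by rw [h']; rfl)
        change CircuitElement.argCount _ (.binary (Sum.inr c) rl) + E.elem.argCount _ ≤ _
        rw [hEc.2.1 g hgc, CircuitElement.argCount, if_neg (by simpa using hgc.symm)]
        omega
      · intro i hi x hx
        fin_cases i
        · exact absurd rfl hi
        · change 0 < CircuitElement.argCount x (.binary (Sum.inr c) rl) at hx
          rw [CircuitElement.argCount] at hx
          by_cases h1 : Sum.inr c = x
          · exact Or.inr (Or.inr ⟨c, rfl, h1.symm⟩)
          · by_cases h2 : rl = x
            · exact h2 ▸ hlrl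
            · simp [h1, h2] at hx
        · exact hEc.2.2 x hx
    · rw [← hdl]
      have e1 : d + 1 + τ = dl + τl := by omega
      rw [e1] at Cr
      refine Cl.join Cr (by omega) hsb ?_ ⟨rfl, rfl, le_rfl⟩ ⟨rfl, rfl, le_rfl⟩ ?_
      · intro g hg; cases hg
        rcases hE with ⟨-, rfl, -, rfl⟩ | ⟨h', rfl, -, rfl⟩
        · exact Or.inl ⟨rfl, le_rfl⟩
        · refine Or.inr ⟨rfl, ?_⟩
          change E.lo = 0 ∧ E.hi = a ∧ E.dep ≤ d + 1
          rw [h']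
          exact ⟨rfl, rfl, le_rfl⟩
      · intro F₁ hF hc' hrl hrr i
        obtain ⟨h1, h2, h3⟩ := hc' c rfl
        unfold Valid
        rw [hF]
        fin_cases i
        · exact ⟨hrl.1, hrl.2.1.trans hrr.1.symm, hrr.2.1, Nat.lt_succ_of_le hrl.2.2,
            Nat.lt_succ_of_le hrr.2.2⟩
        · exact ⟨h1, h2.trans hrl.1.symm, hrl.2.1, Nat.lt_succ_of_le h3,
            Nat.lt_succ_of_le (hrl.2.2.trans (by omega))⟩
        · change E.elem.Fits _ _ _ E.lo E.hi E.dep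
          rcases hE with ⟨rfl, -⟩ | ⟨rfl, -⟩
          · exact ⟨rfl, rfl, Nat.one_pos⟩
          · exact ⟨h1, h2, Nat.lt_succ_of_le h3⟩
    · rw [uses_join (by omega) has.le hsb, Fin.sum_univ_three,
        Wr.uses_eq_zero (by omega) (by
          exact fun h' => hc1 (congrArg Prod.snd (Option.mem_some_iff.1 h')).symm)]
      change _ + (CircuitElement.argCount _ (.binary rl rr) +
        CircuitElement.argCount _ (.binary (Sum.inr c) rl) + E.elem.argCount _) + 0 ≤ _
      rw [CircuitElement.argCount, CircuitElement.argCount, if_neg hrlc, if_neg hrrc, if_pos rfl]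
      rcases hE with ⟨rfl, rfl, rfl, -⟩ | ⟨rfl, rfl, rfl, -⟩
      · rw [CircuitElement.argCount, if_neg (by simp)]
        omega
      · rw [CircuitElement.argCount, if_pos rfl, Wl.uses_eq_zero (by omega) (by
          exact fun h' => hc1 (congrArg Prod.snd (Option.mem_some_iff.1 h')).symm)]
        omega
    · intro m h1 h2
      rcases lt_trichotomy m s with h' | rfl | h'
      · simp only [join_of_lt h']; exact Bl m h1 h'
      · simp only [join_self]; exact ⟨rfl, rfl⟩
      · simp only [join_of_gt h']; exact Br m h' h2

/-- The largest width of the optimal circuits of depth `D` that are constructed below. -/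
def maxWidth (κ D : ℕ) : ℕ := 1 + ∑ u ∈ range D, branchWidth κ u (D - 1 - u) 0

/-- The number of binary gates at the positions `p ≤ m < b`. -/
def GateSpec.binaries (F : Gate → GateSpec) (p b : ℕ) : ℕ :=
  ∑ m ∈ Ico p b, ∑ i : Fin 3, if (F (i, m)).elem.isBinary = true then 1 else 0

/-- Parts that begin at the first input, with `t` elements on the spine. -/
lemma exists_trunk {κ D : ℕ} (hκ : 0 < κ) (t : ℕ) : ∀ w, t ≤ D → t + 1 ≤ w →
    w ≤ 1 + ∑ u ∈ range t, branchWidth κ u (D - 1 - u) 0 →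
    ∃ F out root, Wired (κ + 1) none 0 1 0 w F out root ∧
      Certified none 0 1 0 w t 0 D F out root ∧ binaries F 0 w + t + 2 = 2 * w := by
  induction t with
  | zero =>
    intro w _ h1 h2
    obtain rfl : w = 1 := by simpa using le_antisymm h2 h1
    refine ⟨fun _ => ⟨.ident (Sum.inl 0), 0, 1, 1⟩, fun _ => Sum.inl 0, Sum.inl 0, ?_, ?_, ?_⟩
    · refine ⟨fun i m h1 h2 x hx => ?_, fun i h1 h2 => by omega, Or.inl rfl,
        fun g hg => absurd hg Sum.inl_ne_inr, fun i m h1 h2 => ?_, fun m _ _ => rfl⟩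
      · by_cases h' : Sum.inl 0 = x
        · exact Or.inl ⟨0, by omega, h'.symm⟩
        · simp [CircuitElement.argCount, h'] at hx
      · simp [uses, CircuitElement.argCount]
    · intro F' hF _
      refine ⟨⟨rfl, rfl, le_rfl⟩, fun i h1 h2 => by omega, fun i m h1 h2 => ?_⟩
      unfold Valid
      rw [hF i m h1 h2]
      exact ⟨rfl, rfl, Nat.one_pos⟩
    · simp [binaries, CircuitElement.isBinary]
  | succ t ih =>
    intro w htD h1 h2
    rw [sum_range_succ, ← add_assoc] at h2
    obtain ⟨s, w₂, rfl, hs, hw₂, hs', hw₂'⟩ : ∃ s w₂, w = s + w₂ ∧ t + 1 ≤ s ∧ 1 ≤ w₂ ∧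
        s ≤ 1 + ∑ u ∈ range t, branchWidth κ u (D - 1 - u) 0 ∧
        w₂ ≤ branchWidth κ t (D - 1 - t) 0 := by
      have hp := branchWidth_pos κ t (D - 1 - t) 0
      have hq : t + 1 ≤ 1 + ∑ u ∈ range t, branchWidth κ u (D - 1 - u) 0 := by
        have := sum_le_sum fun u (_ : u ∈ range t) => branchWidth_pos κ u (D - 1 - u) 0
        simp at this
        omega
      -- The left part must retain width t + 1, one split for each of its t spine elements.
      refine ⟨w - min (w - (t + 1)) (branchWidth κ t (D - 1 - t) 0),
        min (w - (t + 1)) (branchWidth κ t (D - 1 - t) 0), ?_⟩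
      omega
    obtain ⟨Fl, ol, rl, Wl, Cl, Bl⟩ := ih s (by omega) hs hs'
    obtain ⟨Fr, or, rr, Wr, Cr, Ur, Br⟩ := exists_branch hκ t (D - 1 - t) 0 s w₂ (t + 1) (2, s) hκ
      hw₂ hw₂' (by omega) (Or.inl le_rfl)
    have eD : t + 1 + (D - 1 - t) = D := by omega
    rw [eD] at Cr
    -- Gate 0 is the next spine element. The prefix sum before it is already the root `rl`, so gate
    -- 1 is a dummy and gate 2 copies `rl` as the carrier of the branch: here a position costs one
    -- binary gate, in a branch two.
    let G : Fin 3 → GateSpec := ![⟨.binary rl rr, 0, s + w₂, t + 1⟩,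
      ⟨.ident (Sum.inl 0), 0, 1, 1⟩, ⟨.ident rl, 0, s, t + 1⟩]
    have h0s : 0 < s := by omega
    have hsb : s < s + w₂ := by omega
    refine ⟨join s Fl G Fr, joinOut s ol or, Sum.inr (0, s), ?_, ?_, ?_⟩
    · refine Wl.join Wr (by omega) (by omega) (by omega) h0s hsb (fun g hg => nomatch hg)
        (fun g hg => nomatch hg) (fun hg => nomatch hg) (by decide) (fun hg => nomatch hg)
        (fun g hg => nomatch hg) (Ur.trans (by omega)) rfl ?_ ?_ rfl
      · intro g _
        change CircuitElement.argCount _ (.ident (Sum.inl 0)) +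
          CircuitElement.argCount _ (.ident rl) ≤ _
        rw [CircuitElement.argCount, CircuitElement.argCount, if_neg Sum.inl_ne_inr, zero_add]
      · intro i hi x hx
        fin_cases i
        · exact absurd rfl hi
        · change 0 < CircuitElement.argCount x (.ident (Sum.inl 0)) at hx
          rw [CircuitElement.argCount] at hx
          by_cases h' : Sum.inl 0 = x
          · exact Or.inl ⟨0, by omega, h'.symm⟩
          · simp [h'] at hx
        · change 0 < CircuitElement.argCount x (.ident rl) at hx
          rw [CircuitElement.argCount] at hx
          by_cases h' : rl = x
          · exact h' ▸ (Wl.local_root h0s).mono le_rfl hsb.le fun g hg => nomatch hg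
          · simp [h'] at hx
    · refine Cl.join Cr (by omega) hsb (fun g hg => nomatch hg) ⟨rfl, rfl, le_rfl⟩
        ⟨rfl, rfl, le_rfl⟩ ?_
      intro F₁ hF _ hrl hrr i
      unfold Valid
      rw [hF]
      fin_cases i
      · exact ⟨hrl.1, hrl.2.1.trans hrr.1.symm, hrr.2.1, Nat.lt_succ_of_le hrl.2.2,
          Nat.lt_succ_of_le hrr.2.2⟩
      · exact ⟨rfl, rfl, Nat.one_pos⟩
      · exact ⟨hrl.1, hrl.2.1, Nat.lt_succ_of_le hrl.2.2⟩
    · have e1 : binaries (join s Fl G Fr) 0 (s + w₂) =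
          binaries Fl 0 s + (1 + ∑ m ∈ Ico (s + 1) (s + w₂), 2) := by
        unfold binaries
        rw [← sum_Ico_consecutive _ (Nat.zero_le s) hsb.le, sum_eq_sum_Ico_succ_bot hsb]
        refine congrArg₂ (· + ·) (sum_congr rfl fun m hm => ?_)
          (congrArg₂ (· + ·) ?_ (sum_congr rfl fun m hm => ?_))
        · simp only [join_of_lt (mem_Ico.1 hm).2]
        · simp only [join_self]
          rfl
        · obtain ⟨h1, h2⟩ := mem_Ico.1 hm
          obtain ⟨h3, h4⟩ := Br m h1 h2
          simp only [join_of_gt (show s < m from h1), Fin.sum_univ_three, h3, h4, Wr.copy m h1 h2]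
          rfl
      rw [e1, sum_const, Nat.card_Ico, smul_eq_mul]
      omega

/-! ### Realization of the construction as an optimal circuit -/

open GateSpec

lemma CircuitElement.Fits.dep_lt {V : Type} [DecidableEq V] {lo hi dep : V → ℕ} {L H d : ℕ}
    {e : CircuitElement V} (h : e.Fits lo hi dep L H d) {a : V} (ha : 0 < e.argCount a) :
    dep a < d := by
  cases e with
  | ident b =>
    rw [argCount] at ha
    split_ifs at ha with h1
    · exact h1 ▸ h.2.2
    · omega
  | binary b b' =>
    rw [argCount] at ha
    by_cases h1 : b = a
    · exact h1 ▸ h.2.2.2.1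
    · by_cases h2 : b' = a
      · exact h2 ▸ h.2.2.2.2
      · simp [h1, h2] at ha

/-- Nodes as vertices over a finite type of gates. -/
def Node.toFin (n : ℕ) : Node → Fin (n + 1) ⊕ (Fin 3 × Fin (n + 1)) :=
  Sum.elim (fun i => Sum.inl (Fin.ofNat (n + 1) i))
    fun g => if h : g.2 < n + 1 then Sum.inr (g.1, ⟨g.2, h⟩) else Sum.inl 0

lemma Node.toFin_gate {n : ℕ} (i : Fin 3) (m : Fin (n + 1)) :
    Node.toFin n (Sum.inr (i, m.val)) = Sum.inr (i, m) :=
  dif_pos m.isLt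

lemma GateSpec.Local.toFin_eq_iff {n : ℕ} {x : Node} (h : Local none 0 (n + 1) x) (i : Fin 3)
    (m : Fin (n + 1)) : x.toFin n = Sum.inr (i, m) ↔ x = Sum.inr (i, m.val) := by
  rcases h with ⟨j, hj, rfl⟩ | ⟨i', m', -, h2, rfl⟩ | ⟨g, hg, -⟩
  · simp [Node.toFin]
  · rw [show m' = (⟨m', h2⟩ : Fin (n + 1)).val from rfl, Node.toFin_gate]
    simp [Fin.ext_iff]
  · cases hg

lemma GateSpec.Local.toFin_comp {n : ℕ} {x : Node} (h : Local none 0 (n + 1) x) {f : Node → ℕ}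
    {g : Fin (n + 1) → ℕ} (hg : ∀ i : Fin (n + 1), f (Sum.inl i.val) = g i) :
    f x = Sum.elim g (fun v : Fin 3 × Fin (n + 1) => f (Sum.inr (v.1, v.2.val))) (x.toFin n) := by
  rcases h with ⟨j, hj, rfl⟩ | ⟨i', m', -, h2, rfl⟩ | ⟨g, hg, -⟩
  · have : Fin.ofNat (n + 1) j = ⟨j, hj⟩ := Fin.ext (Nat.mod_eq_of_lt hj)
    simp only [Node.toFin, Sum.elim_inl, this]
    exact hg ⟨j, hj⟩
  · rw [show m' = (⟨m', h2⟩ : Fin (n + 1)).val from rfl, Node.toFin_gate]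
    rfl
  · cases hg

/-- Optimal prefix circuits of depth `D` and fan-out at most `κ + 1`. -/
lemma exists_optimal {κ D N : ℕ} (hκ : 0 < κ) (hDN : D + 1 ≤ N) (hN : N ≤ maxWidth κ D) :
    ∃ c : PrefixCircuit N, c.IsOptimal ∧ c.FanOutAtMost (κ + 1) ∧ c.depth = D := by
  obtain ⟨F, out, root, W, C, B⟩ := exists_trunk hκ D N le_rfl hDN hN
  obtain ⟨n, rfl⟩ : ∃ n, N = n + 1 := ⟨N - 1, by omega⟩
  obtain ⟨⟨r1, r2, r3⟩, hout, hvalid⟩ := C F (fun _ _ _ _ => rfl) (fun g hg => nomatch hg)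
  let V := Fin 3 × Fin (n + 1)
  let elt : V → CircuitElement (Fin (n + 1) ⊕ V) := fun v =>
    (F (v.1, v.2.val)).elem.map (Node.toFin n)
  let lo : Fin (n + 1) ⊕ V → ℕ := Sum.elim (·.val) fun v => (F (v.1, v.2.val)).lo
  let hi : Fin (n + 1) ⊕ V → ℕ := Sum.elim (·.val + 1) fun v => (F (v.1, v.2.val)).hi
  let dep : Fin (n + 1) ⊕ V → ℕ := Sum.elim (fun _ => 0) fun v => (F (v.1, v.2.val)).dep
  have hlo : ∀ {x}, Local none 0 (n + 1) x → nodeLo F x = lo (x.toFin n) := fun h =>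
    h.toFin_comp fun _ => rfl
  have hhi : ∀ {x}, Local none 0 (n + 1) x → nodeHi F x = hi (x.toFin n) := fun h =>
    h.toFin_comp fun _ => rfl
  have hdep : ∀ {x}, Local none 0 (n + 1) x → nodeDep F x = dep (x.toFin n) := fun h =>
    h.toFin_comp fun _ => rfl
  have hloc : ∀ (v : V) x, 0 < (F (v.1, v.2.val)).elem.argCount x → Local none 0 (n + 1) x :=
    fun v x hx => W.arg_local v.1 v.2.val (Nat.zero_le _) v.2.isLt x hx
  have hfit : ∀ v, (elt v).Fits lo hi dep (lo (Sum.inr v)) (hi (Sum.inr v)) (dep (Sum.inr v)) := by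
    intro v
    refine CircuitElement.fits_map _ |>.2 ?_
    refine (hvalid v.1 v.2.val (Nat.zero_le _) v.2.isLt).congr fun x hx => ?_
    exact ⟨hlo (hloc v x hx), hhi (hloc v x hx), hdep (hloc v x hx)⟩
  -- `out i` is the sum of the first i inputs, whereas circuit outputs count from 0, hence the
  -- shift; the full sum is the root.
  let out' : Fin (n + 1) → Node := fun i => if i.val < n then out (i.val + 1) else root
  have hout' : ∀ i, Local none 0 (n + 1) (out' i) ∧ nodeLo F (out' i) = 0 ∧
      nodeHi F (out' i) = i + 1 ∧ nodeDep F (out' i) ≤ D := by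
    intro i
    simp only [out']
    split_ifs with h
    · exact ⟨W.out_local _ (by omega) (by omega), hout _ (by omega) (by omega)⟩
    · exact ⟨W.local_root (Nat.succ_pos n), r1, by omega, r3⟩
  obtain ⟨c, e, he, hco⟩ := PrefixCircuit.exists_numbering elt (fun v => dep (Sum.inr v))
    (fun v w h => (hfit v).dep_lt h) fun i => (out' i).toFin n
  have hmap : ∀ f : Fin (n + 1) ⊕ V → ℕ, (f ∘ Sum.map id e.symm) ∘ Sum.map id e = f := by
    intro f
    funext x
    rcases x with x | x <;> simp
  have hcfit : ∀ j, (c.elem j).Fits (lo ∘ Sum.map id e.symm) (hi ∘ Sum.map id e.symm)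
      (dep ∘ Sum.map id e.symm) ((lo ∘ Sum.map id e.symm) (Sum.inr j))
      ((hi ∘ Sum.map id e.symm) (Sum.inr j)) ((dep ∘ Sum.map id e.symm) (Sum.inr j)) := by
    intro j
    obtain ⟨v, rfl⟩ := e.surjective j
    rw [he, CircuitElement.fits_map, hmap, hmap, hmap]
    simpa using hfit v
  have hcout : ∀ (f : Fin (n + 1) ⊕ V → ℕ) i, (f ∘ Sum.map id e.symm) (c.out i) =
      f ((out' i).toFin n) := by
    intro f i
    rw [hco]
    exact congrFun (hmap f) _
  have hcomp : c.ComputesPrefixSums := by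
    refine PrefixCircuit.computes_of_certificate (fun i => rfl) (fun i => rfl) hcfit fun i => ?_
    rw [hcout, hcout, ← hlo (hout' i).1, ← hhi (hout' i).1]
    exact ⟨(hout' i).2.1, (hout' i).2.2.1⟩
  have hdepth : c.depth ≤ D := by
    refine Finset.sup_le fun i _ => ?_
    refine (PrefixCircuit.vertexDepth_le_of_certificate hcfit _).trans ?_
    rw [hcout, ← hdep (hout' i).1]
    exact (hout' i).2.2.2
  have hcompl : c.complexity = binaries F 0 (n + 1) := by
    unfold PrefixCircuit.complexity binaries
    rw [card_filter, ← e.sum_comp, Fintype.sum_prod_type, sum_comm, ← range_eq_Ico, sum_range]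
    refine sum_congr rfl fun m _ => sum_congr rfl fun i _ => ?_
    rw [← PrefixCircuit.isBinary_elem, he, CircuitElement.isBinary_map]
    simp only [elt, CircuitElement.isBinary_map]
  -- The certificate bounds the depth by D only from above; Snir's inequality with the exact number
  -- of binary gates gives the reverse.
  have hsnir := hcomp.le_complexity_add_depth
  refine ⟨c, ⟨hcomp, by omega⟩, fun j => ?_, by omega⟩
  obtain ⟨⟨i, m⟩, rfl⟩ := e.surjective j
  have hnum : c.fanOut (Sum.inr (e (i, m))) = uses F out 0 1 (n + 1) (Sum.inr (i, m.val)) +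
      if root = Sum.inr (i, m.val) then 1 else 0 := by
    have hinr : (Sum.inr (e (i, m)) : c.Vertex) = Sum.map id e (Sum.inr (i, m)) := rfl
    have hinj : Function.Injective (Sum.map id e : Fin (n + 1) ⊕ V → c.Vertex) :=
      Function.injective_id.sumMap e.injective
    rw [PrefixCircuit.fanOut_eq, uses, add_assoc]
    congr 1
    · rw [← e.sum_comp, Fintype.sum_prod_type, sum_comm, ← range_eq_Ico, sum_range]
      refine sum_congr rfl fun m' _ => sum_congr rfl fun i' _ => ?_
      rw [he, hinr, CircuitElement.argCount_map _ fun a _ => hinj.eq_iff, ← Node.toFin_gate]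
      refine CircuitElement.argCount_map _ fun a ha => ?_
      rw [Node.toFin_gate]
      exact (hloc (i', m') a ha).toFin_eq_iff i m
    · have h1 : ∀ i', (c.out i' = Sum.inr (e (i, m))) ↔ out' i' = Sum.inr (i, m.val) := by
        intro i'
        rw [hco, hinr, hinj.eq_iff]
        exact (hout' i').1.toFin_eq_iff i m
      simp only [h1]
      rw [card_filter, Fin.sum_univ_castSucc, sum_Ico_eq_sum_range, Nat.add_sub_cancel, sum_range]
      simp [out', add_comm]
  rw [hnum]
  split_ifs with h
  · rw [← h, W.root_uses _ h]
    omega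
  · exact W.uses_le i m.val (Nat.zero_le _) m.isLt

/-! ### Recursions along antidiagonals and their growth rate -/

/-- The sum of the values of `f` over the antidiagonal of `n`. -/
def diagonalSum (f : ℕ → ℕ → ℕ) (n : ℕ) : ℕ := ∑ t ∈ range (n + 1), f (n - t) t

lemma sum_shift_eq (f : ℕ → ℕ → ℕ) (i n : ℕ) :
    (∑ t ∈ range (n + 1), if i ≤ n - t then f (n - t - i) t else 0) =
      if i ≤ n then diagonalSum f (n - i) else 0 := by
  split_ifs with h
  · unfold diagonalSum
    rw [← sum_subset (range_mono (show n - i + 1 ≤ n + 1 by omega))]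
    · refine sum_congr rfl fun t ht => ?_
      rw [mem_range] at ht
      rw [if_pos (by omega), show n - t - i = n - i - t by omega]
    · intro t h1 h2
      rw [mem_range] at h1 h2
      rw [if_neg (by omega)]
  · refine sum_eq_zero fun t ht => ?_
    rw [if_neg (by omega)]

lemma diagonalSum_succ (f : ℕ → ℕ → ℕ) (n : ℕ) :
    diagonalSum f (n + 1) = f (n + 1) 0 + ∑ t ∈ range (n + 1), f (n - t) (t + 1) := by
  unfold diagonalSum
  rw [sum_range_succ' _ (n + 1), add_comm]
  simp only [Nat.add_sub_add_right, Nat.sub_zero]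

lemma diagonalSum_capacity_succ_le (κ n : ℕ) :
    diagonalSum (capacity κ) (n + 1) ≤ n + 2 +
      (∑ i ∈ Icc 1 κ, if i ≤ n then diagonalSum (capacity κ) (n - i) else 0) +
      if κ ≤ n then diagonalSum (capacity κ) (n - κ) else 0 := by
  rw [diagonalSum_succ, capacity_zero]
  have h : ∑ t ∈ range (n + 1), capacity κ (n - t) (t + 1) ≤ ∑ t ∈ range (n + 1),
      (1 + (∑ i ∈ Icc 1 κ, if i ≤ n - t then capacity κ (n - t - i) t else 0) +
        if κ ≤ n - t then capacity κ (n - t - κ) t else 0) := by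
    refine sum_le_sum fun t _ => ?_
    have := capacity_succ (κ := κ) (n - t) t
    split_ifs at this ⊢ <;> omega
  rw [sum_add_distrib, sum_add_distrib, sum_comm, sum_shift_eq] at h
  simp only [sum_shift_eq] at h
  simp only [sum_const, card_range, smul_eq_mul, mul_one] at h
  omega

/-- Unrolls the recursion while n wires of the carrier are available for new right halves: each
gives one of these at one level less, and the last also gives a left half on a fresh copy, the
repeated term. -/
lemma le_branchWidth (κ h τ n : ℕ) (hn : 1 ≤ n) (hnκ : n ≤ κ) :
    ((∑ i ∈ Icc 1 n, if i ≤ h then branchWidth κ (h - i) τ 0 else 0) +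
      if n ≤ h then branchWidth κ (h - n) τ 0 else 0) ≤ branchWidth κ h (τ + 1) (κ - n) := by
  induction n, hn using Nat.le_induction generalizing h with
  | base =>
    cases h with
    | zero => simp
    | succ h =>
      rw [branchWidth, if_neg (show ¬ κ - 1 + 1 < κ by omega)]
      simp
  | succ n hn ih =>
    cases h with
    | zero =>
      refine (Nat.le_of_eq ?_).trans (Nat.zero_le _)
      rw [if_neg (by omega), sum_eq_zero]
      intro i hi
      rw [mem_Icc] at hi
      rw [if_neg (by omega)]
    | succ h =>
      rw [branchWidth, if_pos (show κ - (n + 1) + 1 < κ by omega), show κ - (n + 1) + 1 = κ - n by omega]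
      have := ih h (by omega)
      have e : (∑ i ∈ Icc 1 (n + 1), if i ≤ h + 1 then branchWidth κ (h + 1 - i) τ 0 else 0) =
          branchWidth κ h τ 0 + ∑ i ∈ Icc 1 n, if i ≤ h then branchWidth κ (h - i) τ 0 else 0 := by
        rw [← Ico_succ_right_eq_Icc, ← Ico_succ_right_eq_Icc, sum_eq_sum_Ico_succ_bot (by simp)]
        simp only [Nat.le_add_left, if_true, Nat.add_sub_cancel]
        congr 1
        simp only [Order.succ_eq_add_one]
        rw [← sum_Ico_add' _ 1 (n + 1) 1]
        refine sum_congr rfl fun i _ => ?_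
        simp only [Nat.add_le_add_iff_right, Nat.add_sub_add_right]
      rw [e]
      simp only [Nat.add_le_add_iff_right, Nat.add_sub_add_right]
      linarith

lemma le_diagonalSum_branchWidth_succ {κ : ℕ} (hκ : 0 < κ) (n : ℕ) :
    ((∑ i ∈ Icc 1 κ, if i ≤ n then diagonalSum (branchWidth κ · · 0) (n - i) else 0) +
      if κ ≤ n then diagonalSum (branchWidth κ · · 0) (n - κ) else 0) ≤
    diagonalSum (branchWidth κ · · 0) (n + 1) := by
  rw [diagonalSum_succ]
  have h : ∑ t ∈ range (n + 1),
      ((∑ i ∈ Icc 1 κ, if i ≤ n - t then branchWidth κ (n - t - i) t 0 else 0) +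
        if κ ≤ n - t then branchWidth κ (n - t - κ) t 0 else 0) ≤
      ∑ t ∈ range (n + 1), branchWidth κ (n - t) (t + 1) 0 := by
    refine sum_le_sum fun t _ => ?_
    have := le_branchWidth κ (n - t) t κ hκ le_rfl
    rwa [Nat.sub_self] at this
  rw [sum_add_distrib, sum_comm, sum_shift_eq (branchWidth κ · · 0)] at h
  simp only [sum_shift_eq (branchWidth κ · · 0)] at h
  exact h.trans (Nat.le_add_left _ _)

lemma diagonalSum_branchWidth_pos (κ n : ℕ) : 1 ≤ diagonalSum (branchWidth κ · · 0) n := by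
  have := single_le_sum (f := fun t => branchWidth κ (n - t) t 0) (fun _ _ => Nat.zero_le _)
    (mem_range.2 (Nat.succ_pos n))
  exact (branchWidth_pos _ _ _ _).trans this

/-- Growth of sequences that satisfy a linear recursion up to a linear term. -/
lemma exists_growth_le {κ : ℕ} (hκ : 0 < κ) {α : ℝ} (hα : 1 < α)
    (hroot : ∀ n, κ ≤ n → α ^ (n + 1) = ∑ i ∈ Icc 1 κ, α ^ (n - i) + α ^ (n - κ)) {s : ℕ → ℕ}
    (hs : ∀ n, κ ≤ n → s (n + 1) ≤ n + 2 + ∑ i ∈ Icc 1 κ, s (n - i) + s (n - κ)) :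
    ∃ K : ℝ, 0 < K ∧ ∀ n, (s n : ℝ) ≤ K * α ^ n := by
  -- The induction needs the stronger claim with n + B added: at least two terms on the right each
  -- carry such an addend, and their excess absorbs the linear error n + 2.
  set B : ℝ := (κ + 2) ^ 2 with hB
  set K : ℝ := 1 + ∑ n ∈ range (κ + 1), ((s n : ℝ) + n + B) with hK
  have hB0 : 0 ≤ B := by positivity
  have hK0 : 0 < K := by positivity
  refine ⟨K, hK0, ?_⟩
  have key : ∀ n, (s n : ℝ) + n + B ≤ K * α ^ n := by
    intro n
    induction n using Nat.strong_induction_on with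
    | _ n ih =>
    rcases Nat.lt_or_ge κ n with hn | hn
    · obtain ⟨n, rfl⟩ : ∃ m, n = m + 1 := ⟨n - 1, by omega⟩
      have hn' : κ ≤ n := by omega
      rw [hroot n hn', mul_add, mul_sum]
      have h1 : ∑ i ∈ Icc 1 κ, ((s (n - i) : ℝ) + (n - κ) + B) ≤
          ∑ i ∈ Icc 1 κ, K * α ^ (n - i) := by
        refine sum_le_sum fun i hi => ?_
        rw [mem_Icc] at hi
        refine le_trans ?_ (ih (n - i) (by omega))
        have : (n : ℝ) - κ ≤ ((n - i : ℕ) : ℝ) := by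
          rw [Nat.cast_sub (by omega)]
          have : (i : ℝ) ≤ κ := by exact_mod_cast hi.2
          linarith
        linarith
      have h2 := ih (n - κ) (by omega)
      rw [Nat.cast_sub hn'] at h2
      have h3 : (s (n + 1) : ℝ) ≤ n + 2 + ∑ i ∈ Icc 1 κ, (s (n - i) : ℝ) + s (n - κ) := by
        exact_mod_cast hs n hn'
      simp only [add_assoc, sum_add_distrib, sum_const, Nat.card_Icc, Nat.add_sub_cancel,
        nsmul_eq_mul] at h1
      have h4 : (1 : ℝ) ≤ κ := by exact_mod_cast hκ
      have h5 : (κ : ℝ) ≤ n := by exact_mod_cast hn'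
      push_cast
      have h6 : (κ : ℝ) * (n - κ + B) ≥ (n - κ) + κ * B := by nlinarith
      have h7 : (κ : ℝ) * B ≥ B := by nlinarith
      have h8 : B ≥ 2 * κ + 3 := by rw [hB]; nlinarith
      linarith
    · have h1 : (s n : ℝ) + n + B ≤ ∑ m ∈ range (κ + 1), ((s m : ℝ) + m + B) :=
        single_le_sum (f := fun m : ℕ => (s m : ℝ) + m + B) (fun m _ => by positivity)
          (mem_range.2 (by omega))
      have h2 : 1 ≤ α ^ n := one_le_pow₀ hα.le
      nlinarith
  intro n
  have := key n
  have : (0 : ℝ) ≤ n := Nat.cast_nonneg n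
  linarith

lemma exists_le_growth {κ : ℕ} {α : ℝ} (hα : 1 < α)
    (hroot : ∀ n, κ ≤ n → α ^ (n + 1) = ∑ i ∈ Icc 1 κ, α ^ (n - i) + α ^ (n - κ)) {s : ℕ → ℕ}
    (hs0 : ∀ n, 1 ≤ s n)
    (hs : ∀ n, κ ≤ n → ∑ i ∈ Icc 1 κ, s (n - i) + s (n - κ) ≤ s (n + 1)) (n : ℕ) :
    α ^ n ≤ α ^ κ * s n := by
  induction n using Nat.strong_induction_on with
  | _ n ih =>
  rcases Nat.lt_or_ge κ n with hn | hn
  · obtain ⟨n, rfl⟩ : ∃ m, n = m + 1 := ⟨n - 1, by omega⟩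
    have hn' : κ ≤ n := by omega
    have h1 : (∑ i ∈ Icc 1 κ, (s (n - i) : ℝ) + s (n - κ)) ≤ s (n + 1) := by
      exact_mod_cast hs n hn'
    have h2 : ∑ i ∈ Icc 1 κ, α ^ (n - i) ≤ ∑ i ∈ Icc 1 κ, α ^ κ * s (n - i) := by
      refine sum_le_sum fun i hi => ?_
      rw [mem_Icc] at hi
      exact ih _ (by omega)
    rw [hroot n hn']
    calc _ ≤ ∑ i ∈ Icc 1 κ, α ^ κ * (s (n - i) : ℝ) + α ^ κ * s (n - κ) :=
          add_le_add h2 (ih _ (by omega))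
      _ = α ^ κ * (∑ i ∈ Icc 1 κ, (s (n - i) : ℝ) + s (n - κ)) := by rw [← mul_sum, mul_add]
      _ ≤ _ := mul_le_mul_of_nonneg_left h1 (by positivity)
  · have h1 : α ^ n ≤ α ^ κ := pow_le_pow_right₀ hα.le hn
    have h2 : (1 : ℝ) ≤ s n := by exact_mod_cast hs0 n
    have h3 : 0 < α ^ κ := by positivity
    nlinarith

lemma eval_widthPolynomial (κ : ℕ) (x : ℝ) : (widthPolynomial (κ + 1)).eval x =
    2 + ∑ i ∈ Icc 1 (κ - 1), x ^ i - x ^ (κ + 1) := by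
  simp [widthPolynomial, Polynomial.eval_finsetSum]

/-- The width polynomial has a unique positive root. -/
lemma exists_root_widthPolynomial {κ : ℕ} (hκ : 0 < κ) :
    ∃ α : ℝ, 1 < α ∧ (widthPolynomial (κ + 1)).IsRoot α ∧
      ∀ β : ℝ, 0 < β → (widthPolynomial (κ + 1)).IsRoot β → β = α := by
  have huniq : ∀ x y : ℝ, 0 < x → x < y → (widthPolynomial (κ + 1)).IsRoot x →
      ¬ (widthPolynomial (κ + 1)).IsRoot y := by
    intro x y hx hxy h1 h2
    rw [Polynomial.IsRoot, eval_widthPolynomial] at h1 h2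
    -- Scaling a root by r > 1 multiplies the leading term by r^(κ+1) but every other term by less,
    -- so y is not a root.
    set r := y / x with hr
    have hr1 : 1 < r := (one_lt_div hx).2 hxy
    have hy : y = r * x := by rw [hr]; field_simp
    have h3 : ∑ i ∈ Icc 1 (κ - 1), y ^ i ≤ r ^ (κ + 1) * ∑ i ∈ Icc 1 (κ - 1), x ^ i := by
      rw [mul_sum]
      refine sum_le_sum fun i hi => ?_
      rw [mem_Icc] at hi
      rw [hy, mul_pow]
      exact mul_le_mul_of_nonneg_right (pow_le_pow_right₀ hr1.le (by omega)) (by positivity)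
    have h4 : 1 < r ^ (κ + 1) := one_lt_pow₀ hr1 (by omega)
    have h5 : y ^ (κ + 1) = r ^ (κ + 1) * x ^ (κ + 1) := by rw [hy, mul_pow]
    have h6 : x ^ (κ + 1) = 2 + ∑ i ∈ Icc 1 (κ - 1), x ^ i := by linarith
    rw [h5, h6] at h2
    nlinarith
  have h1 : 0 < (widthPolynomial (κ + 1)).eval (1 : ℝ) := by
    rw [eval_widthPolynomial]
    have : (0 : ℝ) ≤ ∑ i ∈ Icc 1 (κ - 1), (1 : ℝ) ^ i := by positivity
    rw [one_pow]
    linarith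
  have h2 : (widthPolynomial (κ + 1)).eval (2 : ℝ) < 0 := by
    rw [eval_widthPolynomial]
    -- The value at 2 is 2^κ - 2^(κ+1) < 0, so the root lies between 1 and 2.
    have e : ∀ n : ℕ, 2 + ∑ i ∈ Icc 1 n, (2 : ℝ) ^ i = 2 ^ (n + 1) := by
      intro n
      induction n with
      | zero => simp
      | succ n ih => rw [sum_Icc_succ_top (by omega), ← add_assoc, ih]; ring
    rw [e, Nat.sub_add_cancel hκ, pow_succ]
    have : (0 : ℝ) < 2 ^ κ := by positivity
    linarith
  obtain ⟨α, ⟨hα1, -⟩, hα⟩ := intermediate_value_Ioo' (show (1 : ℝ) ≤ 2 by norm_num)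
    (widthPolynomial (κ + 1)).continuous.continuousOn (show (0 : ℝ) ∈ _ from ⟨h2, h1⟩)
  refine ⟨α, hα1, hα, fun β hβ hβr => ?_⟩
  rcases lt_trichotomy β α with h | h | h
  · exact absurd hα (huniq β α hβ h hβr)
  · exact h
  · exact absurd hβr (huniq α β (by linarith) h hα)

/-- P(α) = 0 times α^(n-κ); the constant 2 supplies both the term i = κ and the extra one. -/
lemma pow_succ_eq_of_isRoot {κ : ℕ} (hκ : 0 < κ) {α : ℝ}
    (h : (widthPolynomial (κ + 1)).IsRoot α) (n : ℕ) (hn : κ ≤ n) :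
    α ^ (n + 1) = ∑ i ∈ Icc 1 κ, α ^ (n - i) + α ^ (n - κ) := by
  rw [Polynomial.IsRoot, eval_widthPolynomial] at h
  have h1 : α ^ (κ + 1) = 2 + ∑ i ∈ Icc 1 (κ - 1), α ^ i := by linarith
  have h2 : ∑ i ∈ Icc 1 κ, α ^ (κ - i) = 1 + ∑ i ∈ Icc 1 (κ - 1), α ^ i := by
    have e1 : ∑ i ∈ Icc 1 κ, α ^ (κ - i) = ∑ i ∈ range κ, α ^ i := by
      refine sum_nbij' (fun i => κ - i) (fun i => κ - i) ?_ ?_ ?_ ?_ ?_ <;>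
        simp only [mem_Icc, mem_range] <;> intros <;> first | omega | rfl | trivial
    obtain ⟨m, rfl⟩ : ∃ m, κ = m + 1 := ⟨κ - 1, by omega⟩
    rw [e1, sum_range_succ', add_comm, pow_zero, Nat.add_sub_cancel,
      ← Ico_succ_right_eq_Icc, Order.succ_eq_add_one, sum_Ico_eq_sum_range, Nat.add_sub_cancel]
    simp only [add_comm]
  have h3 : α ^ (n + 1) = α ^ (n - κ) * α ^ (κ + 1) := by rw [← pow_add]; congr 1; omega
  have h4 : ∑ i ∈ Icc 1 κ, α ^ (n - i) = α ^ (n - κ) * ∑ i ∈ Icc 1 κ, α ^ (κ - i) := by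
    rw [mul_sum]
    refine sum_congr rfl fun i hi => ?_
    rw [mem_Icc] at hi
    rw [← pow_add]; congr 1; omega
  rw [h3, h4, h2, h1]
  ring

lemma sum_capacity_le_diagonalSum (κ D : ℕ) :
    1 + ∑ t ∈ Icc 1 D, capacity κ (t + 1) (D - t) ≤ diagonalSum (capacity κ) (D + 1) := by
  unfold diagonalSum
  rw [sum_range_succ, add_comm, Nat.sub_self]
  refine Nat.add_le_add ?_ ?_
  · have : ∑ t ∈ Icc 1 D, capacity κ (t + 1) (D - t) = ∑ t ∈ range D, capacity κ (D + 1 - t) t := by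
      refine sum_nbij' (fun i => D - i) (fun i => D - i) ?_ ?_ ?_ ?_ ?_
      · simp only [mem_Icc, mem_range]; intros; omega
      · simp only [mem_Icc, mem_range]; intros; omega
      · simp only [mem_Icc]; intros; omega
      · simp only [mem_range]; intros; omega
      · simp only [mem_Icc]
        intro t ht
        rw [show D + 1 - (D - t) = t + 1 by omega]
    rw [this]
    exact sum_le_sum_of_subset (range_mono (Nat.le_succ D))
  · have := capacity_eq (κ := κ) (L := 0) (D + 1) 0 le_rfl
    omega

lemma maxWidth_succ (κ n : ℕ) :
    maxWidth κ (n + 1) = 1 + diagonalSum (branchWidth κ · · 0) n := by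
  unfold maxWidth diagonalSum
  rw [← sum_range_reflect]
  congr 1
  refine sum_congr rfl fun t ht => ?_
  rw [mem_range] at ht
  simp only [Nat.add_sub_cancel]
  rw [show n - (n - t) = t by omega]

lemma lt_maxWidth (κ D : ℕ) : D < maxWidth κ D := by
  have := sum_le_sum fun u (_ : u ∈ range D) => branchWidth_pos κ u (D - 1 - u) 0
  simp only [sum_const, card_range, smul_eq_mul, mul_one] at this
  unfold maxWidth
  omega

/-! ### The logarithmic estimate -/

theorem mainTheorem1 (k : ℕ) (hk : 2 ≤ k) :
    ∃ α : ℝ,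
      (0 < α ∧ (widthPolynomial k).IsRoot α ∧
        ∀ β : ℝ, 0 < β → (widthPolynomial k).IsRoot β → β = α) ∧
      ∃ C : ℝ, ∀ N : ℕ, 1 ≤ N →
        (optimalDepths N k).Nonempty ∧
          |(minOptimalDepth N k : ℝ) - Real.logb α (N : ℝ)| ≤ C := by
  obtain ⟨κ, rfl⟩ : ∃ κ, k = κ + 1 := ⟨k - 1, by omega⟩
  have hκ : 0 < κ := by omega
  obtain ⟨α, hα, hroot, huniq⟩ := exists_root_widthPolynomial hκ
  refine ⟨α, ⟨by linarith, hroot, huniq⟩, ?_⟩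
  have hrec := pow_succ_eq_of_isRoot hκ hroot
  have hα0 : 0 < α := by linarith
  obtain ⟨K, hK0, hK⟩ := exists_growth_le hκ hα hrec (s := diagonalSum (capacity κ)) (by
    intro n hn
    have h := diagonalSum_capacity_succ_le κ n
    rw [if_pos hn] at h
    refine h.trans (Nat.add_le_add_right (Nat.add_le_add_left (sum_le_sum fun i hi => ?_) _) _)
    rw [mem_Icc] at hi
    rw [if_pos (by omega)])
  have hlow := exists_le_growth hα hrec (diagonalSum_branchWidth_pos κ) (by
    intro n hn
    have h := le_diagonalSum_branchWidth_succ hκ n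
    rw [if_pos hn] at h
    refine le_trans (Nat.add_le_add_right (sum_le_sum fun i hi => ?_) _) h
    rw [mem_Icc] at hi
    rw [if_pos (by omega)])
  -- The first entry comes from N ≤ K α^(d+1) for the minimal depth d, the second from α^(D-2) ≤ α^κ
  -- N for the depth D that is constructed.
  refine ⟨max (Real.logb α K + 1) (κ + 2), fun N hN => ?_⟩
  have hN0 : (0 : ℝ) < N := by exact_mod_cast hN
  -- The least sufficient D: minimality yields both D + 1 ≤ N, needed for the construction, and the
  -- lower bound for N.
  obtain ⟨D, hD, hmin⟩ : ∃ D, N ≤ maxWidth κ D ∧ ∀ D' < D, maxWidth κ D' < N := by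
    have hex : ∃ D, N ≤ maxWidth κ D := ⟨N, (lt_maxWidth κ N).le⟩
    classical
    exact ⟨Nat.find hex, Nat.find_spec hex, fun D' h => not_le.1 (Nat.find_min hex h)⟩
  have hDN : D + 1 ≤ N := by
    rcases Nat.eq_zero_or_pos D with rfl | h0
    · exact hN
    · have h1 := lt_maxWidth κ (D - 1)
      have h2 := hmin (D - 1) (by omega)
      omega
  obtain ⟨c, hc, hck, hcD⟩ := exists_optimal hκ hDN hD
  have hne : (optimalDepths N (κ + 1)).Nonempty := ⟨D, c, hc, hck, hcD⟩
  refine ⟨hne, ?_⟩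
  have hle : minOptimalDepth N (κ + 1) ≤ D := Nat.sInf_le ⟨c, hc, hck, hcD⟩
  obtain ⟨c', hc', hck', hcD'⟩ := Nat.sInf_mem hne
  change c'.depth = minOptimalDepth N (κ + 1) at hcD'
  have hwidth := (hc'.width_le hκ hck').trans (sum_capacity_le_diagonalSum κ c'.depth)
  rw [hcD'] at hwidth
  have hupper : Real.logb α N ≤ Real.logb α K + 1 + minOptimalDepth N (κ + 1) := by
    have h1 : (N : ℝ) ≤ K * α ^ (minOptimalDepth N (κ + 1) + 1) :=
      le_trans (by exact_mod_cast hwidth) (hK _)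
    have h2 := Real.logb_le_logb_of_le hα hN0 h1
    rw [Real.logb_mul hK0.ne' (by positivity), Real.logb_pow, Real.logb_self_eq_one hα] at h2
    push_cast at h2
    linarith
  have hlower : (D : ℝ) ≤ Real.logb α N + (κ + 2) := by
    have hlog : 0 ≤ Real.logb α N := Real.logb_nonneg hα (by exact_mod_cast hN)
    rcases Nat.lt_or_ge D 2 with h | h
    · have : (D : ℝ) < 2 := by exact_mod_cast h
      have : (0 : ℝ) ≤ κ := Nat.cast_nonneg κ
      linarith
    · obtain ⟨n, rfl⟩ : ∃ n, D = n + 2 := ⟨D - 2, by omega⟩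
      have h1 := hmin (n + 1) (by omega)
      rw [maxWidth_succ] at h1
      have h2 : (diagonalSum (branchWidth κ · · 0) n : ℝ) ≤ N := by
        exact_mod_cast (by omega : diagonalSum (branchWidth κ · · 0) n ≤ N)
      have h3 : α ^ n ≤ α ^ κ * N :=
        (hlow n).trans (mul_le_mul_of_nonneg_left h2 (by positivity))
      have h4 := Real.logb_le_logb_of_le hα (by positivity) h3
      rw [Real.logb_mul (by positivity) hN0.ne', Real.logb_pow, Real.logb_pow,
        Real.logb_self_eq_one hα] at h4
      push_cast
      linarith
  have hle' : (minOptimalDepth N (κ + 1) : ℝ) ≤ D := by exact_mod_cast hle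
  rw [abs_le]
  have := le_max_left (Real.logb α K + 1) ((κ : ℝ) + 2)
  have := le_max_right (Real.logb α K + 1) ((κ : ℝ) + 2)
  constructor <;> linarith
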